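/- **Setting.** Let $1\le d\le 3$, $\Omega=\prod_{i=1}^d(a_i,b_i)$ with $a_i<b_i$, $T>0$. Let $H^s_p(\Omega)$ be the periodic Sobolev space: those $v\in L^2(\Omega;\mathbb C)$ having, for every $|\alpha|\le s$, a weak derivative $D^\alpha v\in L^2(\Omega)$ when tested against all smooth $\Omega$-periodic functions, with norm $\|v\|_s=\big(\sum_{|\alpha|\le s}\|D^\alpha v\|_{L^2(\Omega)}^2\big)^{1/2}$. Write $(w,v)=\int_\Omega w\bar v\,dx$ and $a(w,v)=\int_\Omega\nabla w\cdot\overline{\nabla v}\,dx$. Let $f:\mathbb R\times\mathbb C\times\mathbb C^d\to\mathbb C$ be continuously differentiable in the real sense, and suppose that there are $K$ and $p>0$, with $p\le 2$ if $d=3$, such that $$\Big|\frac{\partial f}{\partial\xi}(t,\xi,\eta)\Big|\le K(1+|\xi|^p),\qquad \Big|\frac{\partial f}{\partial\eta}(t,\xi,\eta)\Big|\le K(1+|\eta|^p)$$ for all $t\in[0,T]$, $\xi\in\mathbb C$, $\eta\in\mathbb C^d$. (A nonlinearity $g$ given on real arguments is included through $f(t,\xi,\eta)=g(t,\operatorname{Re}\xi,\operatorname{Re}\eta)$.)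 Let $u$ be an exact solution of the periodic problem $u_t=\Delta u+f(t,u,\nabla u)$, $u(0)=u_0$, on $[0,T]$, that is, $u:[0,T]\to H^2_p(\Omega)$ is continuous, $u$ is differentiable as an $L^2(\Omega)$-valued function on $[0,T]$, and the equation holds in $L^2(\Omega)$ at every $t\in[0,T]$. For positive even integers $N_1,\dots,N_d$ let $N=\max_j N_j$, $$X_N=\operatorname{span}\Big\{\prod_{j=1}^d e^{2\pi \mathrm i k_jx_j/(b_j-a_j)}\ :\ -\tfrac{N_j}2\le k_j\le \tfrac{N_j}2-1\Big\},$$ and let $P_N:L^2(\Omega)\to X_N$ be the $L^2$-orthogonal projection. A semi-discrete Fourier Galerkin solution is a differentiable $u_N:[0,T]\to X_N$ with $u_N(0)=P_Nu_0$ and $$(u_{N,t},v)+a(u_N,v)=(f(t,u_N,\nabla u_N),v)\qquad\forall\,v\in X_N,\ t\in[0,T].$$ **Theorem.** Let $m\ge 2$ be an integer, and suppose that $u(t)\in H^m_p(\Omega)$ for all $t\in[0,T]$ and $\sup_{0\le t\le T}\|u(t)\|_m<\infty$. Then for every $\kappa$ there are a constant $C>0$ and an integer $N_0$ such that the following holds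 for all positive even $N_1,\dots,N_d$ with $N\le\kappa N_j$ for all $j$. If $N\ge N_0$, a semi-discrete solution $u_N$ on $[0,T]$ exists; and every semi-discrete solution $u_N$ on $[0,T]$ (whether or not $N\ge N_0$) satisfies $$\|u(t)-u_N(t)\|_2\le C\,N^{2-m}\qquad\text{for all } t\in[0,T].$$ In particular $C$ does not depend on $N$. -/

import Mathlib

open MeasureTheory Set
open scoped ContDiff ComplexConjugate

noncomputable section

namespace FourierGalerkin

variable {d : ℕ}

/-- The open rectangular domain `Ω = ∏ᵢ (aᵢ, bᵢ)`. -/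
def box (a b : Fin d → ℝ) : Set (Fin d → ℝ) :=
  Set.univ.pi fun i => Set.Ioo (a i) (b i)

/-- Lebesgue measure on `Ω`. -/
abbrev boxMeasure (a b : Fin d → ℝ) : Measure (Fin d → ℝ) :=
  volume.restrict (box a b)

/-- The complex Hilbert space `L²(Ω)`. -/
abbrev L2 (a b : Fin d → ℝ) : Type :=
  Lp ℂ 2 (boxMeasure a b)

instance isFiniteMeasure_boxMeasure (a b : Fin d → ℝ) : IsFiniteMeasure (boxMeasure a b) := by
  refine ⟨?_⟩
  rw [Measure.restrict_apply_univ, box, Real.volume_pi_Ioo]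
  exact ENNReal.prod_lt_top fun i _ => ENNReal.ofReal_lt_top

/-! ### Periodic Sobolev spaces -/

/-- Periodic smooth test functions: smooth on `ℝᵈ`, with period `bᵢ - aᵢ` in the `i`-th variable. -/
structure IsPeriodicTest (a b : Fin d → ℝ) (φ : (Fin d → ℝ) → ℂ) : Prop where
  smooth : ContDiff ℝ ∞ φ
  periodic : ∀ (i : Fin d) (x : Fin d → ℝ), φ (x + Pi.single i (b i - a i)) = φ x

/-- The classical partial derivative `∂ᵢ φ`. -/
def partialDeriv (i : Fin d) (φ : (Fin d → ℝ) → ℂ) : (Fin d → ℝ) → ℂ :=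
  fun x => fderiv ℝ φ x (Pi.single i 1)

/-- The classical derivative `D^α φ = ∂₁^{α₁} ⋯ ∂_d^{α_d} φ` for a multi-index `α`. -/
def multiDeriv (α : Fin d → ℕ) (φ : (Fin d → ℝ) → ℂ) : (Fin d → ℝ) → ℂ :=
  (List.finRange d).foldr (fun i g => (partialDeriv i)^[α i] g) φ

/-- `w ∈ L²(Ω)` is the periodic weak derivative `D^α v` of `v ∈ L²(Ω)`. Testing against all smooth
periodic functions, and not only those with compact support in `Ω`, is what makes the lower order
derivatives of `v` match on opposite faces of the box. -/
def HasWeakDeriv {a b : Fin d → ℝ} (α : Fin d → ℕ) (v w : L2 a b) : Prop :=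
  ∀ φ : (Fin d → ℝ) → ℂ, IsPeriodicTest a b φ →
    ∫ x, v x * multiDeriv α φ x ∂(boxMeasure a b)
      = (-1 : ℂ) ^ (∑ i, α i) * ∫ x, w x * φ x ∂(boxMeasure a b)

/-- Membership in `H^s_p(Ω)`: all periodic weak derivatives of order at most `s` exist in `L²`. -/
def MemHp {a b : Fin d → ℝ} (s : ℕ) (v : L2 a b) : Prop :=
  ∀ α : Fin d → ℕ, ∑ i, α i ≤ s → ∃ w : L2 a b, HasWeakDeriv α v w

open Classical in
/-- The periodic weak derivative `D^α v` (and `0` if there is none). -/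
def weakDeriv {a b : Fin d → ℝ} (α : Fin d → ℕ) (v : L2 a b) : L2 a b :=
  if h : ∃ w : L2 a b, HasWeakDeriv α v w then h.choose else 0

/-- The multi-indices of order at most `s`. -/
def multiIndices (d s : ℕ) : Finset (Fin d → ℕ) :=
  (Finset.Iic fun _ : Fin d => s).filter fun α => ∑ i, α i ≤ s

/-- The Sobolev norm `‖v‖_s = (∑_{|α| ≤ s} ‖D^α v‖²_{L²})^{1/2}`. -/
def sobolevNorm {a b : Fin d → ℝ} (s : ℕ) (v : L2 a b) : ℝ :=
  Real.sqrt (∑ α ∈ multiIndices d s, ‖weakDeriv α v‖ ^ 2)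

/-- The weak gradient `∇v`. -/
def gradient {a b : Fin d → ℝ} (v : L2 a b) (x : Fin d → ℝ) : EuclideanSpace ℂ (Fin d) :=
  WithLp.toLp 2 fun i => weakDeriv (Pi.single i 1) v x

/-- The weak Laplacian `Δv`. -/
def laplacian {a b : Fin d → ℝ} (v : L2 a b) : L2 a b :=
  ∑ i, weakDeriv (Pi.single i 2) v

/-! ### The parabolic problem -/

/-- The nonlinearity `f(t, ξ, η)` is continuously differentiable in the real sense and grows mildly:
`|∂f/∂ξ| ≤ K (1 + |ξ|^p)` and `|∂f/∂η| ≤ K (1 + |η|^p)`, for some `K`. -/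
structure IsMildNonlinearity (T p : ℝ) (f : ℝ → ℂ → EuclideanSpace ℂ (Fin d) → ℂ) : Prop where
  smooth : ContDiff ℝ 1 fun z : ℝ × ℂ × EuclideanSpace ℂ (Fin d) => f z.1 z.2.1 z.2.2
  growth : ∃ K : ℝ, ∀ t ∈ Icc 0 T, ∀ (ξ : ℂ) (η : EuclideanSpace ℂ (Fin d)),
    ‖fderiv ℝ (fun ξ' => f t ξ' η) ξ‖ ≤ K * (1 + ‖ξ‖ ^ p) ∧
    ‖fderiv ℝ (fun η' => f t ξ η') η‖ ≤ K * (1 + ‖η‖ ^ p)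

/-- `u` is a (strict) solution on `[0, T]` of `u_t = Δu + f(t, u, ∇u)` with periodic boundary
conditions and `u(0) = u₀`: it is continuous with values in `H²_p(Ω)`, differentiable with values in
`L²(Ω)`, and satisfies the equation in `L²(Ω)` at every time. -/
structure IsExactSolution {a b : Fin d → ℝ} (T : ℝ)
    (f : ℝ → ℂ → EuclideanSpace ℂ (Fin d) → ℂ) (u₀ : L2 a b) (u : ℝ → L2 a b) : Prop where
  mem : ∀ t ∈ Icc 0 T, MemHp 2 (u t)
  cont : ∀ α : Fin d → ℕ, ∑ i, α i ≤ 2 → ContinuousOn (fun t => weakDeriv α (u t)) (Icc 0 T)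
  init : u 0 = u₀
  equation : ∀ t ∈ Icc 0 T, ∃ u' : L2 a b, HasDerivWithinAt u u' (Icc 0 T) t ∧
    u' =ᵐ[boxMeasure a b] fun x => laplacian (u t) x + f t (u t x) (gradient (u t) x)

/-! ### The Fourier Galerkin semi-discretization -/

/-- The basis function `φ_k(x) = ∏ⱼ exp(2πi kⱼ xⱼ / (bⱼ - aⱼ))`. -/
def basisFun (a b : Fin d → ℝ) (k : Fin d → ℤ) (x : Fin d → ℝ) : ℂ :=
  ∏ j, Complex.exp (((2 * Real.pi * k j / (b j - a j) * x j : ℝ) : ℂ) * Complex.I)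

theorem memLp_basisFun (a b : Fin d → ℝ) (k : Fin d → ℤ) :
    MemLp (basisFun a b k) 2 (boxMeasure a b) := by
  refine MemLp.of_bound (C := 1) ?_ (Filter.Eventually.of_forall fun x => ?_)
  · apply Continuous.aestronglyMeasurable
    unfold basisFun
    fun_prop
  · unfold basisFun
    rw [norm_prod]
    simp only [Complex.norm_exp_ofReal_mul_I, Finset.prod_const_one, le_refl]

/-- The frequencies `Λ_N`: all `k` with `-Nⱼ/2 ≤ kⱼ ≤ Nⱼ/2 - 1`. -/
def frequencies (Nn : Fin d → ℕ) : Finset (Fin d → ℤ) :=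
  Fintype.piFinset fun j => Finset.Icc (-((Nn j / 2 : ℕ) : ℤ)) (((Nn j / 2 : ℕ) : ℤ) - 1)

/-- The Fourier approximation space `X_N = span {φ_k : k ∈ Λ_N}`. -/
def XN (a b : Fin d → ℝ) (Nn : Fin d → ℕ) : Submodule ℂ (L2 a b) :=
  Submodule.span ℂ ((fun k => (memLp_basisFun a b k).toLp (basisFun a b k)) '' (frequencies Nn))

instance finiteDimensional_XN (a b : Fin d → ℝ) (Nn : Fin d → ℕ) :
    FiniteDimensional ℂ (XN a b Nn) :=
  FiniteDimensional.span_of_finite ℂ ((frequencies Nn).finite_toSet.image _)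

/-- The `L²`-orthogonal projection `P_N : L²(Ω) → X_N`. -/
def PN {a b : Fin d → ℝ} (Nn : Fin d → ℕ) (v : L2 a b) : L2 a b :=
  (XN a b Nn).starProjection v

/-- The `L²` inner product `(w, v) = ∫_Ω w v̄`, for functions `w`, `v` on `Ω`. -/
def pairing (a b : Fin d → ℝ) (w v : (Fin d → ℝ) → ℂ) : ℂ :=
  ∫ x, w x * conj (v x) ∂(boxMeasure a b)

/-- The bilinear form `a(w, v) = ∫_Ω ∇w · ∇v̄`. -/
def energyForm {a b : Fin d → ℝ} (w v : L2 a b) : ℂ :=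
  ∫ x, ∑ i, gradient w x i * conj (gradient v x i) ∂(boxMeasure a b)

/-- `u_N : [0, T] → X_N` solves the Fourier Galerkin system
`(u_{N,t}, v) + a(u_N, v) = (f(t, u_N, ∇u_N), v)` for all `v ∈ X_N`, with `u_N(0) = P_N u₀`. -/
structure IsSemidiscreteSolution {a b : Fin d → ℝ} (T : ℝ)
    (f : ℝ → ℂ → EuclideanSpace ℂ (Fin d) → ℂ) (u₀ : L2 a b) (Nn : Fin d → ℕ)
    (uN : ℝ → L2 a b) : Prop where
  mem : ∀ t ∈ Icc 0 T, uN t ∈ XN a b Nn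
  init : uN 0 = PN Nn u₀
  equation : ∀ t ∈ Icc 0 T, ∃ uN' : L2 a b, HasDerivWithinAt uN uN' (Icc 0 T) t ∧
    ∀ v ∈ XN a b Nn, pairing a b uN' v + energyForm (uN t) v
      = pairing a b (fun x => f t (uN t x) (gradient (uN t) x)) v

/-- The number of meshes `N = maxⱼ Nⱼ`. -/
def meshNumber (Nn : Fin d → ℕ) : ℕ :=
  Finset.univ.sup Nn

end FourierGalerkin

end

noncomputable section

namespace FourierGalerkin

variable {d : ℕ}

/-! Write `ρ = u - u_N`. The Laplacian is diagonal in the Fourier basis, so for the frequencies `k`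
of `X_N` the coefficients of `ρ` start at zero and solve `ρ_k' = -λ_k ρ_k + F_k`, where `F` is the
difference of the nonlinearities at `u` and `u_N` and `λ_k` is the eigenvalue. The remaining
coefficients are those of `u` itself, and the `H^m` bound makes them of size `ε ~ N^(2-m)` in `H²`.
It remains to bound the resolved part by a multiple of `ε` in `H²`. All norms are weighted sums of
squared coefficients over arbitrary finite sets (`HBound`), so no summability has to be carried
along.

The growth allowed for `d = 3` is critical: `|∇ρ|³` is only just controlled by the embedding `H¹ ⊂
L⁶`, which `exists_eLpNorm_le` proves by cutting the Fourier series at a frequency depending on the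
level. Smallness must come from elsewhere. Since `u` is continuous into `H²`, its range is compact,
so `u(t)` is a trigonometric polynomial with bounded gradient plus a remainder that is small in
`H²`, uniformly in `t`; and `ρ` is small in `H²` by a bootstrap. Thus `F` consists of a lower order
part with a large constant `K₀` and a critical part with a constant `θ` as small as desired
(`exists_nonlinear_estimate`).

Forcing bounded in `L²` uniformly in time does not directly give an `H²` bound uniform in time,
since the heat semigroup has the singularity `1/t` there. The error is therefore cut into blocks
with `1 + |k|² ~ 16^j`, `j ≤ J`, `4^J ~ N`, and measured by the largest `2^J 8^j ‖ρ_j‖ e^(-νt)`. The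
factor `8^j` lies strictly between the `H¹` factor `4^j` and the `H²` factor `16^j`. Hence, seen
from block `j`, the lower blocks sum geometrically in `H²` and the higher ones in `H¹`. The lower
blocks are paired with the test function in `L²`, the higher ones with the test function in `L⁶`.
The unresolved frequencies enter only through their `H¹` norm, of order `ε / 4^J`. The decay rate
`16^j` of block `j` then pays for the critical term, while a large `ν` pays for the `K₀` term. A
bound `D` for the weighted maximum improves to `(D + ε) / 2`, hence to `ε`
(`exists_apriori_estimate`).

A truncated, globally Lipschitz Galerkin system has a solution, and the bootstrap shows that on fine
meshes the truncation is never active (`exists_error_estimate`). Only finitely many meshes are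
coarse; on each of them semi-discrete solutions are unique, so the error is bounded. -/

/-! ### The Fourier basis of the box, transported from the unit torus -/

/-- The volume of the box. -/
def boxVolume (a b : Fin d → ℝ) : ℝ := ∏ i, (b i - a i)

theorem boxVolume_pos {a b : Fin d → ℝ} (hab : ∀ i, a i < b i) : 0 < boxVolume a b :=
  Finset.prod_pos fun i _ => sub_pos.2 (hab i)

/-- The map from the box to the unit torus that rescales each coordinate. -/
def toTorus (a b : Fin d → ℝ) (x : Fin d → ℝ) : UnitAddTorus (Fin d) :=
  fun i => ((x i / (b i - a i) : ℝ) : UnitAddCircle)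

theorem continuous_toTorus (a b : Fin d → ℝ) : Continuous (toTorus a b) := by
  unfold toTorus
  refine continuous_pi fun i => ?_
  exact (AddCircle.continuous_mk' 1).comp ((continuous_apply i).div_const _)

theorem mFourier_toTorus (a b : Fin d → ℝ) (k : Fin d → ℤ) (x : Fin d → ℝ) :
    UnitAddTorus.mFourier k (toTorus a b x) = basisFun a b k x := by
  unfold basisFun toTorus
  simp only [UnitAddTorus.mFourier, ContinuousMap.coe_mk]
  refine Finset.prod_congr rfl fun j _ => ?_
  rw [fourier_coe_apply]
  congr 1
  push_cast
  ring

theorem continuous_basisFun (a b : Fin d → ℝ) (k : Fin d → ℤ) : Continuous (basisFun a b k) := by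
  unfold basisFun
  fun_prop

theorem norm_basisFun (a b : Fin d → ℝ) (k : Fin d → ℤ) (x : Fin d → ℝ) :
    ‖basisFun a b k x‖ = 1 := by
  unfold basisFun
  rw [norm_prod]
  simp only [Complex.norm_exp_ofReal_mul_I, Finset.prod_const_one]

theorem conj_basisFun (a b : Fin d → ℝ) (k : Fin d → ℤ) (x : Fin d → ℝ) :
    conj (basisFun a b k x) = basisFun a b (-k) x := by
  rw [← mFourier_toTorus, ← mFourier_toTorus, UnitAddTorus.mFourier_neg]

/-- Dividing by the length maps the interval onto one of length `1`, a fundamental domain up to a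
null set, on which the projection to the circle preserves measure. The factor is the Jacobian of the
rescaling. -/
theorem map_div_restrict {α β : ℝ} (h : α < β) :
    Measure.map (fun x : ℝ => ((x / (β - α) : ℝ) : UnitAddCircle)) (volume.restrict (Ioo α β))
      = ENNReal.ofReal (β - α) • (AddCircle.haarAddCircle : Measure UnitAddCircle) := by
  have hL : 0 < β - α := sub_pos.2 h
  have h1 : Measure.map (fun x : ℝ => x / (β - α)) (volume.restrict (Ioo α β))
      = ENNReal.ofReal (β - α) • volume.restrict (Ioo (α / (β - α)) (α / (β - α) + 1)) := by
    have hpre : (fun x : ℝ => x / (β - α)) ⁻¹' (Ioo (α / (β - α)) (α / (β - α) + 1)) = Ioo α β := by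
      ext x
      simp only [mem_preimage, mem_Ioo]
      rw [div_lt_div_iff_of_pos_right hL, show α / (β - α) + 1 = β / (β - α) by field_simp; ring,
        div_lt_div_iff_of_pos_right hL]
    rw [← hpre, ← Measure.restrict_map (by fun_prop) measurableSet_Ioo]
    have := Real.map_volume_mul_right (a := (β - α)⁻¹) (inv_ne_zero hL.ne')
    simp only [inv_inv, ← div_eq_mul_inv] at this
    rw [this, abs_of_pos hL, Measure.restrict_smul]
  have h2 : (fun x : ℝ => ((x / (β - α) : ℝ) : UnitAddCircle))
      = (fun y : ℝ => (y : UnitAddCircle)) ∘ fun x : ℝ => x / (β - α) := rfl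
  rw [h2, ← Measure.map_map (AddCircle.measurable_mk') (by fun_prop), h1, Measure.map_smul]
  congr 1
  rw [Measure.restrict_congr_set Ioo_ae_eq_Ioc]
  have h3 := (UnitAddCircle.measurePreserving_mk (α / (β - α))).map_eq
  rw [AddCircle.volume_eq_smul_haarAddCircle, ENNReal.ofReal_one, one_smul] at h3
  exact h3

/-- Haar probability measure on the torus. -/
abbrev torusMeasure (d : ℕ) : Measure (UnitAddTorus (Fin d)) :=
  Measure.pi fun _ => AddCircle.haarAddCircle

theorem map_toTorus {a b : Fin d → ℝ} (hab : ∀ i, a i < b i) :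
    Measure.map (toTorus a b) (boxMeasure a b)
      = ENNReal.ofReal (boxVolume a b) • torusMeasure d := by
  have hfin : ∀ i, IsFiniteMeasure (Measure.map
      (fun x : ℝ => ((x / (b i - a i) : ℝ) : UnitAddCircle)) (volume.restrict (Ioo (a i) (b i)))) := by
    intro i
    infer_instance
  rw [boxMeasure, box, volume_pi, Measure.restrict_pi_pi]
  have h := Measure.pi_map_pi (μ := fun i => volume.restrict (Ioo (a i) (b i)))
    (f := fun i (x : ℝ) => ((x / (b i - a i) : ℝ) : UnitAddCircle))
    (fun i => (AddCircle.measurable_mk'.comp (measurable_id.div_const _)).aemeasurable)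
  have h' : toTorus a b = fun x i => ((x i / (b i - a i) : ℝ) : UnitAddCircle) := rfl
  rw [h', h]
  refine Measure.pi_eq fun s hs => ?_
  simp only [map_div_restrict (hab _), Measure.smul_apply, smul_eq_mul, Measure.pi_pi]
  rw [Finset.prod_mul_distrib, boxVolume, ENNReal.ofReal_prod_of_nonneg]
  exact fun i _ => (sub_pos.2 (hab i)).le

theorem integral_comp_toTorus {a b : Fin d → ℝ} (hab : ∀ i, a i < b i)
    {g : UnitAddTorus (Fin d) → ℂ} (hg : AEStronglyMeasurable g (torusMeasure d)) :
    ∫ x, g (toTorus a b x) ∂(boxMeasure a b) = boxVolume a b * ∫ y, g y ∂(torusMeasure d) := by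
  rw [← integral_map (continuous_toTorus a b).aemeasurable, map_toTorus hab, integral_smul_measure,
    ENNReal.toReal_ofReal (boxVolume_pos hab).le]
  · simp
  · rw [map_toTorus hab]
    exact hg.smul_measure _

theorem integral_basisFun_mul_conj {a b : Fin d → ℝ} (hab : ∀ i, a i < b i) (k l : Fin d → ℤ) :
    ∫ x, basisFun a b k x * conj (basisFun a b l x) ∂(boxMeasure a b)
      = if k = l then (boxVolume a b : ℂ) else 0 := by
  have h := integral_comp_toTorus hab
    (g := fun y => UnitAddTorus.mFourier k y * conj (UnitAddTorus.mFourier l y))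
    (by apply Continuous.aestronglyMeasurable; fun_prop)
  simp only [mFourier_toTorus] at h
  rw [h]
  have h2 := orthonormal_iff_ite.1 (UnitAddTorus.orthonormal_mFourier (d := Fin d)) l k
  rw [ContinuousMap.inner_toLp] at h2
  have h3 : ∫ y, UnitAddTorus.mFourier k y * conj (UnitAddTorus.mFourier l y) ∂(torusMeasure d)
      = if l = k then 1 else 0 := h2
  rw [h3]
  by_cases hkl : k = l
  · simp [hkl]
  · rw [if_neg hkl, if_neg (Ne.symm hkl), mul_zero]

/-- A measurable inverse of the projection of the box to the torus. -/
def ofTorus (a b : Fin d → ℝ) (y : UnitAddTorus (Fin d)) : Fin d → ℝ :=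
  fun i => (AddCircle.measurableEquivIoc 1 (a i / (b i - a i)) (y i) : ℝ) * (b i - a i)

theorem measurable_ofTorus (a b : Fin d → ℝ) : Measurable (ofTorus a b) := by
  refine measurable_pi_lambda _ fun i => ?_
  refine Measurable.mul_const ?_ _
  exact measurable_subtype_coe.comp
    ((AddCircle.measurableEquivIoc 1 (a i / (b i - a i))).measurable.comp (measurable_pi_apply i))

theorem ofTorus_toTorus {a b : Fin d → ℝ} (hab : ∀ i, a i < b i) {x : Fin d → ℝ}
    (hx : x ∈ box a b) : ofTorus a b (toTorus a b x) = x := by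
  funext i
  have hL : 0 < b i - a i := sub_pos.2 (hab i)
  have hxi : x i ∈ Ioo (a i) (b i) := hx i (mem_univ i)
  have hmem : x i / (b i - a i) ∈ Ioc (a i / (b i - a i)) (a i / (b i - a i) + 1) := by
    constructor
    · exact div_lt_div_of_pos_right hxi.1 hL
    · rw [show a i / (b i - a i) + 1 = b i / (b i - a i) by field_simp; ring]
      exact (div_lt_div_of_pos_right hxi.2 hL).le
  have h := (AddCircle.equivIoc (1 : ℝ) (a i / (b i - a i))).apply_symm_apply ⟨_, hmem⟩
  have h2 : AddCircle.equivIoc (1 : ℝ) (a i / (b i - a i)) (toTorus a b x i) = ⟨_, hmem⟩ := h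
  have h3 : ofTorus a b (toTorus a b x) i
      = (AddCircle.equivIoc (1 : ℝ) (a i / (b i - a i)) (toTorus a b x i) : ℝ) * (b i - a i) := rfl
  rw [h3, h2]
  field_simp

/-- Completeness of the modes is inherited from the torus: `v` is transported by the measurable
section `ofTorus`, the coefficients of the resulting function vanish, and `L²` convergence of its
Fourier series makes it zero. -/
theorem eq_zero_of_forall_integral_basisFun {a b : Fin d → ℝ} (hab : ∀ i, a i < b i) (v : L2 a b)
    (hv : ∀ k, ∫ x, v x * conj (basisFun a b k x) ∂(boxMeasure a b) = 0) : v = 0 := by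
  set g : UnitAddTorus (Fin d) → ℂ := fun y => v (ofTorus a b y) with hg
  have hgm : StronglyMeasurable g := (Lp.stronglyMeasurable v).comp_measurable
    (measurable_ofTorus a b)
  have hgv : ∀ x ∈ box a b, g (toTorus a b x) = v x := fun x hx => by
    simp only [hg, ofTorus_toTorus hab hx]
  have hbox : MeasurableSet (box a b) := MeasurableSet.univ_pi fun i => measurableSet_Ioo
  have hae : (fun x => g (toTorus a b x)) =ᵐ[boxMeasure a b] v :=
    (ae_restrict_iff' hbox).2 (Filter.Eventually.of_forall hgv)
  have hV := boxVolume_pos hab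
  have hV' : ENNReal.ofReal (boxVolume a b) ≠ 0 := by simpa using hV
  have hgL : MemLp g 2 (torusMeasure d) := by
    have h1 : MemLp (g ∘ toTorus a b) 2 (boxMeasure a b) :=
      (memLp_congr_ae hae).2 (Lp.memLp v)
    rw [← memLp_map_measure_iff hgm.aestronglyMeasurable (continuous_toTorus a b).aemeasurable,
      map_toTorus hab] at h1
    -- The image of the box measure is a positive multiple of Haar measure; the factor is divided
    -- out.
    have h2 := h1.smul_measure (c := (ENNReal.ofReal (boxVolume a b))⁻¹) (by simpa using hV)
    rwa [smul_smul, ENNReal.inv_mul_cancel hV' ENNReal.ofReal_ne_top, one_smul] at h2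
  have hcoef : ∀ k, UnitAddTorus.mFourierCoeff g k = 0 := by
    intro k
    have h1 := integral_comp_toTorus hab
      (g := fun y => g y * conj (UnitAddTorus.mFourier k y))
      (hgm.aestronglyMeasurable.mul (by apply Continuous.aestronglyMeasurable; fun_prop))
    have h2 : ∫ x, g (toTorus a b x) * conj (UnitAddTorus.mFourier k (toTorus a b x))
        ∂(boxMeasure a b) = 0 := by
      rw [← hv k]
      refine integral_congr_ae ?_
      filter_upwards [hae] with x hx
      rw [hx, mFourier_toTorus]
    rw [h2] at h1
    have h3 : ∫ y, g y * conj (UnitAddTorus.mFourier k y) ∂(torusMeasure d) = 0 := by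
      rcases mul_eq_zero.1 h1.symm with h | h
      · exact absurd (by exact_mod_cast h) hV.ne'
      · exact h
    rw [← h3]
    refine integral_congr_ae (Filter.Eventually.of_forall fun y => ?_)
    simp only [UnitAddTorus.mFourier_neg, smul_eq_mul, mul_comm]
  have hg0 : g =ᵐ[torusMeasure d] 0 := by
    set G := hgL.toLp g with hG
    have hGg := hgL.coeFn_toLp
    have hs := UnitAddTorus.hasSum_mFourier_series_L2 G
    have hz : ∀ k, UnitAddTorus.mFourierCoeff G k = 0 := by
      intro k
      rw [← hcoef k]
      refine integral_congr_ae ?_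
      filter_upwards [hGg] with y hy
      rw [hy]
    have : G = 0 := by
      refine hs.unique ?_
      simp only [hz, zero_smul]
      exact hasSum_zero
    refine hGg.symm.trans ?_
    rw [← hG, this]
    exact Lp.coeFn_zero _ _ _
  have hv0 : v =ᵐ[boxMeasure a b] 0 := by
    refine hae.symm.trans ?_
    have : ∀ᵐ y ∂(Measure.map (toTorus a b) (boxMeasure a b)), g y = 0 := by
      rw [map_toTorus hab]
      exact Measure.ae_smul_measure hg0 _
    exact ae_of_ae_map (continuous_toTorus a b).aemeasurable this
  exact (Lp.eq_zero_iff_ae_eq_zero).2 hv0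

/-- The normalized Fourier mode `|Ω|^{-1/2} φ_k`, as a function. -/
def modeFun (a b : Fin d → ℝ) (k : Fin d → ℤ) (x : Fin d → ℝ) : ℂ :=
  (((Real.sqrt (boxVolume a b))⁻¹ : ℝ) : ℂ) * basisFun a b k x

/-- The normalized Fourier mode in `L²(Ω)`. -/
def mode (a b : Fin d → ℝ) (k : Fin d → ℤ) : L2 a b :=
  (((Real.sqrt (boxVolume a b))⁻¹ : ℝ) : ℂ) • (memLp_basisFun a b k).toLp (basisFun a b k)

/-- The Fourier coefficient `(v, |Ω|^{-1/2} φ_k)`. -/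
def coeff {a b : Fin d → ℝ} (k : Fin d → ℤ) : L2 a b →L[ℂ] ℂ := innerSL ℂ (mode a b k)

theorem mode_ae_eq (a b : Fin d → ℝ) (k : Fin d → ℤ) :
    mode a b k =ᵐ[boxMeasure a b] modeFun a b k := by
  filter_upwards [Lp.coeFn_smul (((Real.sqrt (boxVolume a b))⁻¹ : ℝ) : ℂ)
    ((memLp_basisFun a b k).toLp (basisFun a b k)), (memLp_basisFun a b k).coeFn_toLp] with x h1 h2
  rw [mode, h1, Pi.smul_apply, h2, smul_eq_mul, modeFun]

theorem continuous_modeFun (a b : Fin d → ℝ) (k : Fin d → ℤ) : Continuous (modeFun a b k) :=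
  continuous_const.mul (continuous_basisFun a b k)

theorem norm_modeFun (a b : Fin d → ℝ) (k : Fin d → ℤ) (x : Fin d → ℝ) :
    ‖modeFun a b k x‖ = (Real.sqrt (boxVolume a b))⁻¹ := by
  rw [modeFun, norm_mul, norm_basisFun, mul_one, Complex.norm_real, Real.norm_eq_abs, abs_of_nonneg]
  positivity

theorem inner_eq_integral {a b : Fin d → ℝ} (v w : L2 a b) :
    inner ℂ v w = ∫ x, w x * conj (v x) ∂(boxMeasure a b) := by
  rw [L2.inner_def]
  simp only [RCLike.inner_apply]

theorem coeff_apply {a b : Fin d → ℝ} (k : Fin d → ℤ) (v : L2 a b) :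
    coeff k v = inner ℂ (mode a b k) v := rfl

theorem coeff_eq_integral {a b : Fin d → ℝ} (k : Fin d → ℤ) (v : L2 a b) :
    coeff k v = ∫ x, v x * conj (modeFun a b k x) ∂(boxMeasure a b) := by
  rw [coeff_apply, inner_eq_integral]
  refine integral_congr_ae ?_
  filter_upwards [mode_ae_eq a b k] with x hx
  rw [hx]

theorem coeff_eq_integral_basisFun {a b : Fin d → ℝ} (k : Fin d → ℤ) (v : L2 a b) :
    coeff k v = (((Real.sqrt (boxVolume a b))⁻¹ : ℝ) : ℂ)
      * ∫ x, v x * conj (basisFun a b k x) ∂(boxMeasure a b) := by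
  rw [coeff_eq_integral, ← integral_const_mul]
  refine integral_congr_ae (Filter.Eventually.of_forall fun x => ?_)
  simp only [modeFun, map_mul, Complex.conj_ofReal]
  ring

theorem orthonormal_mode {a b : Fin d → ℝ} (hab : ∀ i, a i < b i) : Orthonormal ℂ (mode a b) := by
  classical
  rw [orthonormal_iff_ite]
  intro k l
  have hV := boxVolume_pos hab
  rw [← coeff_apply, coeff_eq_integral_basisFun]
  have h1 : ∫ x, mode a b l x * conj (basisFun a b k x) ∂(boxMeasure a b)
      = (((Real.sqrt (boxVolume a b))⁻¹ : ℝ) : ℂ)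
        * ∫ x, basisFun a b l x * conj (basisFun a b k x) ∂(boxMeasure a b) := by
    rw [← integral_const_mul]
    refine integral_congr_ae ?_
    filter_upwards [mode_ae_eq a b l] with x hx
    rw [hx, modeFun]
    ring
  rw [h1, integral_basisFun_mul_conj hab]
  by_cases h : k = l
  · rw [if_pos h, if_pos h.symm]
    have h2 : Real.sqrt (boxVolume a b) ≠ 0 := (Real.sqrt_pos.2 hV).ne'
    have h3 := Real.mul_self_sqrt hV.le
    norm_cast
    nth_rw 3 [← h3]
    field_simp
  · rw [if_neg h, if_neg (Ne.symm h)]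
    simp

/-- The Fourier basis of `L²(Ω)`. -/
def fourierHilbertBasis {a b : Fin d → ℝ} (hab : ∀ i, a i < b i) :
    HilbertBasis (Fin d → ℤ) ℂ (L2 a b) :=
  HilbertBasis.mkOfOrthogonalEqBot (orthonormal_mode hab) <| by
    rw [Submodule.eq_bot_iff]
    intro v hv
    refine eq_zero_of_forall_integral_basisFun hab v fun k => ?_
    have h := (Submodule.mem_orthogonal _ _).1 hv (mode a b k)
      (Submodule.subset_span (mem_range_self k))
    rw [← coeff_apply, coeff_eq_integral_basisFun] at h
    rcases mul_eq_zero.1 h with h | h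
    · exfalso
      have hV := Real.sqrt_pos.2 (boxVolume_pos hab)
      exact (inv_pos.2 hV).ne' (by exact_mod_cast h)
    · exact h

theorem fourierHilbertBasis_apply {a b : Fin d → ℝ} (hab : ∀ i, a i < b i) (k : Fin d → ℤ) :
    fourierHilbertBasis hab k = mode a b k := by
  simp [fourierHilbertBasis]

theorem hasSum_coeff_smul_mode {a b : Fin d → ℝ} (hab : ∀ i, a i < b i) (v : L2 a b) :
    HasSum (fun k => coeff k v • mode a b k) v := by
  have h := (fourierHilbertBasis hab).hasSum_repr v
  simpa only [HilbertBasis.repr_apply_apply, fourierHilbertBasis_apply, ← coeff_apply] using h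

theorem hasSum_sq_norm_coeff {a b : Fin d → ℝ} (hab : ∀ i, a i < b i) (v : L2 a b) :
    HasSum (fun k => ‖coeff k v‖ ^ 2) (‖v‖ ^ 2) := by
  have h := (fourierHilbertBasis hab).hasSum_inner_mul_inner v v
  have h2 := RCLike.hasSum_re ℂ h
  rw [inner_self_eq_norm_sq] at h2
  convert h2 using 2 with k
  rw [fourierHilbertBasis_apply, ← inner_conj_symm v, ← coeff_apply, mul_comm, Complex.mul_conj']
  norm_cast

theorem ext_coeff {a b : Fin d → ℝ} (hab : ∀ i, a i < b i) {v w : L2 a b}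
    (h : ∀ k, coeff k v = coeff k w) : v = w := by
  have h1 := hasSum_coeff_smul_mode hab v
  simp only [h] at h1
  exact h1.unique (hasSum_coeff_smul_mode hab w)

theorem coeff_mode {a b : Fin d → ℝ} (hab : ∀ i, a i < b i) (k l : Fin d → ℤ) :
    coeff k (mode a b l) = if k = l then 1 else 0 :=
  orthonormal_iff_ite.1 (orthonormal_mode hab) k l

/-! ### Trigonometric polynomials and the space `X_N` -/

/-- The trigonometric polynomial `∑_{k ∈ S} c_k |Ω|^{-1/2} φ_k` in `L²(Ω)`. -/
def trigPoly (a b : Fin d → ℝ) (S : Finset (Fin d → ℤ)) (c : (Fin d → ℤ) → ℂ) : L2 a b :=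
  ∑ k ∈ S, c k • mode a b k

/-- The trigonometric polynomial `∑_{k ∈ S} c_k |Ω|^{-1/2} φ_k` as a function. -/
def trigFun (a b : Fin d → ℝ) (S : Finset (Fin d → ℤ)) (c : (Fin d → ℤ) → ℂ)
    (x : Fin d → ℝ) : ℂ :=
  ∑ k ∈ S, c k * modeFun a b k x

theorem trigPoly_ae_eq (a b : Fin d → ℝ) (S : Finset (Fin d → ℤ)) (c : (Fin d → ℤ) → ℂ) :
    trigPoly a b S c =ᵐ[boxMeasure a b] trigFun a b S c := by
  classical
  induction S using Finset.induction_on with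
  | empty =>
    simp only [trigPoly, Finset.sum_empty]
    exact Lp.coeFn_zero _ _ _
  | insert k S hk ih =>
    have h : trigPoly a b (insert k S) c = c k • mode a b k + trigPoly a b S c := by
      simp only [trigPoly, Finset.sum_insert hk]
    rw [h]
    filter_upwards [ih, Lp.coeFn_add (c k • mode a b k) (trigPoly a b S c),
      Lp.coeFn_smul (c k) (mode a b k), mode_ae_eq a b k] with x h1 h2 h3 h4
    rw [h2, Pi.add_apply, h3, Pi.smul_apply, h4, h1, trigFun, trigFun, Finset.sum_insert hk,
      smul_eq_mul]

theorem continuous_trigFun (a b : Fin d → ℝ) (S : Finset (Fin d → ℤ)) (c : (Fin d → ℤ) → ℂ) :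
    Continuous (trigFun a b S c) :=
  continuous_finsetSum _ fun k _ => continuous_const.mul (continuous_modeFun a b k)

theorem norm_trigFun_le (a b : Fin d → ℝ) (S : Finset (Fin d → ℤ)) (c : (Fin d → ℤ) → ℂ)
    (x : Fin d → ℝ) :
    ‖trigFun a b S c x‖ ≤ (Real.sqrt (boxVolume a b))⁻¹ * ∑ k ∈ S, ‖c k‖ := by
  rw [Finset.mul_sum]
  refine (norm_sum_le _ _).trans (Finset.sum_le_sum fun k _ => ?_)
  rw [norm_mul, norm_modeFun, mul_comm]

theorem coeff_trigPoly {a b : Fin d → ℝ} (hab : ∀ i, a i < b i) (S : Finset (Fin d → ℤ))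
    (c : (Fin d → ℤ) → ℂ) (k : Fin d → ℤ) [Decidable (k ∈ S)] :
    coeff k (trigPoly a b S c) = if k ∈ S then c k else 0 := by
  classical
  simp only [trigPoly, map_sum, map_smul, coeff_mode hab, smul_eq_mul, mul_ite, mul_one, mul_zero,
    Finset.sum_ite_eq]
  congr

theorem XN_eq_span_mode {a b : Fin d → ℝ} (hab : ∀ i, a i < b i) (Nn : Fin d → ℕ) :
    XN a b Nn = Submodule.span ℂ (mode a b '' (frequencies Nn)) := by
  have hV := Real.sqrt_pos.2 (boxVolume_pos hab)
  refine le_antisymm (Submodule.span_le.2 ?_) (Submodule.span_le.2 ?_)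
  · rintro _ ⟨k, hk, rfl⟩
    have h : (memLp_basisFun a b k).toLp (basisFun a b k)
        = ((Real.sqrt (boxVolume a b) : ℝ) : ℂ) • mode a b k := by
      rw [mode, smul_smul, ← Complex.ofReal_mul, mul_inv_cancel₀ hV.ne', Complex.ofReal_one, one_smul]
    simp only [h]
    exact Submodule.smul_mem _ _ (Submodule.subset_span ⟨k, hk, rfl⟩)
  · rintro _ ⟨k, hk, rfl⟩
    exact Submodule.smul_mem _ _ (Submodule.subset_span ⟨k, hk, rfl⟩)

theorem mode_mem_XN {a b : Fin d → ℝ} (hab : ∀ i, a i < b i) {Nn : Fin d → ℕ} {k : Fin d → ℤ}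
    (hk : k ∈ frequencies Nn) : mode a b k ∈ XN a b Nn := by
  rw [XN_eq_span_mode hab]
  exact Submodule.subset_span ⟨k, hk, rfl⟩

theorem trigPoly_mem_XN {a b : Fin d → ℝ} (hab : ∀ i, a i < b i) (Nn : Fin d → ℕ)
    {S : Finset (Fin d → ℤ)} (hS : S ⊆ frequencies Nn)
    (c : (Fin d → ℤ) → ℂ) : trigPoly a b S c ∈ XN a b Nn :=
  Submodule.sum_mem _ fun _ hk => Submodule.smul_mem _ _ (mode_mem_XN hab (hS hk))

theorem coeff_eq_zero_of_mem_XN {a b : Fin d → ℝ} (hab : ∀ i, a i < b i) {Nn : Fin d → ℕ}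
    {v : L2 a b} (hv : v ∈ XN a b Nn) {k : Fin d → ℤ} (hk : k ∉ frequencies Nn) :
    coeff k v = 0 := by
  rw [XN_eq_span_mode hab] at hv
  induction hv using Submodule.span_induction with
  | mem x hx =>
    obtain ⟨l, hl, rfl⟩ := hx
    rw [coeff_mode hab, if_neg]
    rintro rfl
    exact hk hl
  | zero => simp
  | add x y _ _ hx hy => rw [map_add, hx, hy, add_zero]
  | smul c x _ hx => rw [map_smul, hx, smul_zero]

theorem eq_trigPoly_of_coeff_eq_zero {a b : Fin d → ℝ} (hab : ∀ i, a i < b i)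
    {S : Finset (Fin d → ℤ)} {v : L2 a b} (hv : ∀ k ∉ S, coeff k v = 0) :
    v = trigPoly a b S fun k => coeff k v := by
  classical
  refine ext_coeff hab fun k => ?_
  rw [coeff_trigPoly hab]
  split_ifs with h
  · rfl
  · exact hv k h

theorem coeff_PN {a b : Fin d → ℝ} (hab : ∀ i, a i < b i) (Nn : Fin d → ℕ) (v : L2 a b)
    {k : Fin d → ℤ} (hk : k ∈ frequencies Nn) : coeff k (PN Nn v) = coeff k v := by
  have h := (XN a b Nn).starProjection_inner_eq_zero v (mode a b k) (mode_mem_XN hab hk)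
  rw [PN, eq_comm, ← sub_eq_zero, ← map_sub, coeff_apply, ← inner_conj_symm, h, map_zero]

/-! ### Periodic weak derivatives as Fourier multipliers -/

/-- The angular frequency `2 π k_j / (b_j - a_j)`. -/
def angFreq (a b : Fin d → ℝ) (k : Fin d → ℤ) (j : Fin d) : ℝ :=
  2 * Real.pi * k j / (b j - a j)

/-- The symbol `(iκ)^α` of the derivative `D^α`. -/
def symbol (a b : Fin d → ℝ) (α : Fin d → ℕ) (k : Fin d → ℤ) : ℂ :=
  ∏ j, (Complex.I * (angFreq a b k j : ℂ)) ^ α j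

theorem contDiff_basisFun (a b : Fin d → ℝ) (k : Fin d → ℤ) : ContDiff ℝ ∞ (basisFun a b k) := by
  unfold basisFun
  refine contDiff_prod fun j _ => ?_
  refine ContDiff.cexp (ContDiff.mul ?_ contDiff_const)
  exact Complex.ofRealCLM.contDiff.comp (contDiff_const.mul (contDiff_apply ℝ ℝ j))

theorem basisFun_eq_exp (a b : Fin d → ℝ) (k : Fin d → ℤ) (x : Fin d → ℝ) :
    basisFun a b k x = Complex.exp (∑ j, (angFreq a b k j : ℂ) * (x j : ℂ) * Complex.I) := by
  rw [Complex.exp_sum]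
  refine Finset.prod_congr rfl fun j _ => ?_
  rw [angFreq]
  push_cast
  rfl

theorem isPeriodicTest_basisFun {a b : Fin d → ℝ} (hab : ∀ i, a i < b i) (k : Fin d → ℤ) :
    IsPeriodicTest a b (basisFun a b k) := by
  refine ⟨contDiff_basisFun a b k, fun i x => ?_⟩
  have hL : b i - a i ≠ 0 := (sub_pos.2 (hab i)).ne'
  unfold basisFun
  refine Finset.prod_congr rfl fun j _ => ?_
  by_cases hji : j = i
  · subst hji
    rw [Pi.add_apply, Pi.single_eq_same]
    have : (((2 * Real.pi * k j / (b j - a j) * (x j + (b j - a j)) : ℝ) : ℂ) * Complex.I)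
        = ((2 * Real.pi * k j / (b j - a j) * x j : ℝ) : ℂ) * Complex.I
          + k j * (2 * Real.pi * Complex.I) := by
      rw [mul_add, div_mul_cancel₀ _ hL]
      push_cast
      ring
    rw [this, Complex.exp_add, Complex.exp_int_mul_two_pi_mul_I, mul_one]
  · rw [Pi.add_apply, Pi.single_eq_of_ne hji, add_zero]

theorem IsPeriodicTest.mul {a b : Fin d → ℝ} {φ ψ : (Fin d → ℝ) → ℂ} (hφ : IsPeriodicTest a b φ)
    (hψ : IsPeriodicTest a b ψ) : IsPeriodicTest a b fun x => φ x * ψ x :=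
  ⟨hφ.smooth.mul hψ.smooth, fun i x => by simp only [hφ.periodic, hψ.periodic]⟩

theorem IsPeriodicTest.partialDeriv {a b : Fin d → ℝ} {φ : (Fin d → ℝ) → ℂ}
    (hφ : IsPeriodicTest a b φ) (i : Fin d) : IsPeriodicTest a b (partialDeriv i φ) := by
  refine ⟨?_, fun j x => ?_⟩
  · have h := hφ.smooth.fderiv_right (m := ∞) (by simp)
    exact h.clm_apply contDiff_const
  · have h : (fun y => φ (y + Pi.single j (b j - a j))) = φ := funext fun y => hφ.periodic j y
    unfold FourierGalerkin.partialDeriv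
    rw [← fderiv_comp_add_right, h]

theorem partialDeriv_basisFun (a b : Fin d → ℝ) (k : Fin d → ℤ) (i : Fin d) (x : Fin d → ℝ) :
    partialDeriv i (basisFun a b k) x = Complex.I * (angFreq a b k i : ℂ) * basisFun a b k x := by
  have hdiff : DifferentiableAt ℝ (basisFun a b k) x :=
    (contDiff_basisFun a b k).differentiable (by simp) x
  unfold partialDeriv
  rw [← hdiff.lineDeriv_eq_fderiv]
  unfold lineDeriv
  have h : (fun t : ℝ => basisFun a b k (x + t • Pi.single i 1))
      = fun t : ℝ => Complex.exp ((t : ℂ) * (Complex.I * (angFreq a b k i : ℂ)))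
          * basisFun a b k x := by
    funext t
    rw [basisFun_eq_exp, basisFun_eq_exp, ← Complex.exp_add]
    congr 1
    have : ∀ j, (angFreq a b k j : ℂ) * (((x + t • Pi.single i (1 : ℝ) : Fin d → ℝ) j : ℝ) : ℂ) * Complex.I
        = (if j = i then (t : ℂ) * (Complex.I * (angFreq a b k i : ℂ)) else 0)
          + (angFreq a b k j : ℂ) * (x j : ℂ) * Complex.I := by
      intro j
      by_cases hji : j = i
      · subst hji
        simp only [Pi.add_apply, Pi.smul_apply, Pi.single_eq_same, smul_eq_mul, if_true]
        push_cast
        ring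
      · simp [hji]
    simp only [this, Finset.sum_add_distrib, Finset.sum_ite_eq', Finset.mem_univ, if_true]
  rw [h]
  have h1 : HasDerivAt (fun t : ℝ => Complex.exp ((t : ℂ) * (Complex.I * (angFreq a b k i : ℂ)))
      * basisFun a b k x)
      (Complex.exp (((0 : ℝ) : ℂ) * (Complex.I * (angFreq a b k i : ℂ)))
        * (1 * (Complex.I * (angFreq a b k i : ℂ))) * basisFun a b k x) 0 :=
    (((Complex.ofRealCLM.hasDerivAt (x := (0 : ℝ))).mul_const _).cexp).mul_const _
  rw [h1.deriv]
  simp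

theorem integral_boxMeasure_eq_Icc (a b : Fin d → ℝ) (g : (Fin d → ℝ) → ℂ) :
    ∫ x, g x ∂(boxMeasure a b) = ∫ x in Icc a b, g x := by
  rw [boxMeasure, box]
  exact setIntegral_congr_set Measure.univ_pi_Ioo_ae_eq_Icc

/-- This is the divergence theorem for the field `φ eᵢ`: its two boundary integrals are over
opposite faces and cancel by periodicity. -/
theorem integral_partialDeriv_eq_zero {a b : Fin d → ℝ} (hab : ∀ i, a i < b i)
    {φ : (Fin d → ℝ) → ℂ} (hφ : IsPeriodicTest a b φ) (i : Fin d) :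
    ∫ x, partialDeriv i φ x ∂(boxMeasure a b) = 0 := by
  -- The divergence theorem is phrased on `Fin (n + 1)`; the existence of the index `i` rules out `d
  -- = 0`.
  obtain ⟨n, rfl⟩ : ∃ n, d = n + 1 := ⟨d - 1, by have := i.2; omega⟩
  rw [integral_boxMeasure_eq_Icc]
  have hd : Differentiable ℝ φ := hφ.smooth.differentiable (by simp)
  have key := integral_divergence_of_hasFDerivAt_off_countable' a b (fun j => (hab j).le)
    (fun j => if j = i then φ else 0) (fun j => if j = i then fderiv ℝ φ else 0) ∅ countable_empty
    (fun j => by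
      split_ifs
      · exact hd.continuous.continuousOn
      · exact continuousOn_const)
    (fun x _ j => by
      by_cases hji : j = i
      · simp only [hji, if_true]
        exact (hd x).hasFDerivAt
      · simp only [hji, if_false]
        exact hasFDerivAt_const _ _)
    (by
      refine ContinuousOn.integrableOn_compact isCompact_Icc (Continuous.continuousOn ?_)
      refine continuous_finsetSum _ fun j _ => ?_
      by_cases hji : j = i
      · simp only [hji, if_true]
        exact (hφ.partialDeriv i).smooth.continuous
      · simp only [hji, if_false]
        exact continuous_const)
  have h1 : ∀ x : Fin (n + 1) → ℝ, ∑ j, (if j = i then fderiv ℝ φ else 0) x (Pi.single j 1)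
      = partialDeriv i φ x := by
    intro x
    rw [Finset.sum_eq_single i]
    · simp [partialDeriv]
    · intro j _ hji
      simp [hji]
    · simp
  simp only [h1] at key
  rw [key]
  refine Finset.sum_eq_zero fun j _ => ?_
  by_cases hji : j = i
  · subst hji
    simp only [if_true]
    rw [sub_eq_zero]
    refine integral_congr_ae (Filter.Eventually.of_forall fun x => ?_)
    have h2 : Fin.insertNth (α := fun _ => ℝ) j (b j) x
        = Fin.insertNth (α := fun _ => ℝ) j (a j) x + Pi.single j (b j - a j) := by
      funext l
      rcases Fin.eq_self_or_eq_succAbove j l with rfl | ⟨l, rfl⟩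
      · simp
      · simp
    simp only [h2, hφ.periodic]
  · simp [hji]

theorem IsPeriodicTest.integrable {a b : Fin d → ℝ} {φ : (Fin d → ℝ) → ℂ}
    (hφ : IsPeriodicTest a b φ) : Integrable φ (boxMeasure a b) := by
  have h : IntegrableOn φ (Icc a b) :=
    hφ.smooth.continuous.continuousOn.integrableOn_compact isCompact_Icc
  exact h.mono_set fun x hx => ⟨fun i => (hx i (mem_univ i)).1.le, fun i => (hx i (mem_univ i)).2.le⟩

theorem integral_basisFun_mul_partialDeriv {a b : Fin d → ℝ} (hab : ∀ i, a i < b i)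
    (k : Fin d → ℤ) {φ : (Fin d → ℝ) → ℂ} (hφ : IsPeriodicTest a b φ) (i : Fin d) :
    ∫ x, basisFun a b k x * partialDeriv i φ x ∂(boxMeasure a b)
      = -(Complex.I * (angFreq a b k i : ℂ)) * ∫ x, basisFun a b k x * φ x ∂(boxMeasure a b) := by
  have hb := isPeriodicTest_basisFun hab k
  have h0 := integral_partialDeriv_eq_zero hab (hb.mul hφ) i
  have h1 : ∀ x, partialDeriv i (fun x => basisFun a b k x * φ x) x
      = basisFun a b k x * partialDeriv i φ x
        + (Complex.I * (angFreq a b k i : ℂ)) * (basisFun a b k x * φ x) := by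
    intro x
    have hp := partialDeriv_basisFun a b k i x
    unfold partialDeriv at hp ⊢
    rw [fderiv_fun_mul ((hb.smooth.differentiable (by simp)) x)
      ((hφ.smooth.differentiable (by simp)) x)]
    simp only [_root_.add_apply, _root_.smul_apply, hp, smul_eq_mul]
    ring
  simp only [h1] at h0
  rw [integral_add (hb.mul (hφ.partialDeriv i)).integrable
    ((hb.mul hφ).integrable.const_mul _), integral_const_mul] at h0
  linear_combination h0

theorem isPeriodicTest_iterate_partialDeriv {a b : Fin d → ℝ} {φ : (Fin d → ℝ) → ℂ}
    (hφ : IsPeriodicTest a b φ) (i : Fin d) (n : ℕ) :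
    IsPeriodicTest a b ((partialDeriv i)^[n] φ) := by
  induction n with
  | zero => exact hφ
  | succ n ih =>
    rw [Function.iterate_succ_apply']
    exact ih.partialDeriv i

theorem integral_basisFun_mul_iterate {a b : Fin d → ℝ} (hab : ∀ i, a i < b i)
    (k : Fin d → ℤ) {φ : (Fin d → ℝ) → ℂ} (hφ : IsPeriodicTest a b φ) (i : Fin d) (n : ℕ) :
    ∫ x, basisFun a b k x * ((partialDeriv i)^[n] φ) x ∂(boxMeasure a b)
      = (-(Complex.I * (angFreq a b k i : ℂ))) ^ n
        * ∫ x, basisFun a b k x * φ x ∂(boxMeasure a b) := by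
  induction n with
  | zero => simp
  | succ n ih =>
    rw [Function.iterate_succ_apply', integral_basisFun_mul_partialDeriv hab k
      (isPeriodicTest_iterate_partialDeriv hφ i n), ih, pow_succ']
    ring

theorem integral_basisFun_mul_multiDeriv {a b : Fin d → ℝ} (hab : ∀ i, a i < b i)
    (k : Fin d → ℤ) {φ : (Fin d → ℝ) → ℂ} (hφ : IsPeriodicTest a b φ) (α : Fin d → ℕ) :
    ∫ x, basisFun a b k x * multiDeriv α φ x ∂(boxMeasure a b)
      = (-1) ^ (∑ i, α i) * symbol a b α k * ∫ x, basisFun a b k x * φ x ∂(boxMeasure a b) := by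
  have key : ∀ l : List (Fin d),
      IsPeriodicTest a b (l.foldr (fun i g => (partialDeriv i)^[α i] g) φ) ∧
      ∫ x, basisFun a b k x * (l.foldr (fun i g => (partialDeriv i)^[α i] g) φ) x
        ∂(boxMeasure a b)
      = (l.map fun i => (-(Complex.I * (angFreq a b k i : ℂ))) ^ α i).prod
        * ∫ x, basisFun a b k x * φ x ∂(boxMeasure a b) := by
    intro l
    induction l with
    | nil => simpa using hφ
    | cons i l ih =>
      refine ⟨isPeriodicTest_iterate_partialDeriv ih.1 i _, ?_⟩
      rw [List.foldr_cons, integral_basisFun_mul_iterate hab k ih.1, ih.2, List.map_cons,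
        List.prod_cons, mul_assoc]
  rw [multiDeriv, (key _).2]
  congr 1
  rw [← Fin.prod_univ_def, symbol, ← Finset.prod_pow_eq_pow_sum, ← Finset.prod_mul_distrib]
  refine Finset.prod_congr rfl fun j _ => ?_
  rw [neg_pow]

theorem multiDeriv_basisFun (a b : Fin d → ℝ) (k : Fin d → ℤ) (α : Fin d → ℕ) (x : Fin d → ℝ) :
    multiDeriv α (basisFun a b k) x = symbol a b α k * basisFun a b k x := by
  have h1 : ∀ (i : Fin d) (c : ℂ), partialDeriv i (fun x => c * basisFun a b k x)
      = fun x => (Complex.I * (angFreq a b k i : ℂ)) * c * basisFun a b k x := by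
    intro i c
    funext x
    have hp := partialDeriv_basisFun a b k i x
    unfold partialDeriv at hp ⊢
    rw [fderiv_const_mul ((contDiff_basisFun a b k).differentiable (by simp) x)]
    simp only [_root_.smul_apply, hp, smul_eq_mul]
    ring
  have h2 : ∀ (i : Fin d) (n : ℕ) (c : ℂ), (partialDeriv i)^[n] (fun x => c * basisFun a b k x)
      = fun x => (Complex.I * (angFreq a b k i : ℂ)) ^ n * c * basisFun a b k x := by
    intro i n
    induction n with
    | zero => simp
    | succ n ih =>
      intro c
      rw [Function.iterate_succ_apply, h1, ih]
      funext x
      rw [pow_succ]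
      ring
  have key : ∀ l : List (Fin d),
      l.foldr (fun i g => (partialDeriv i)^[α i] g) (basisFun a b k)
        = fun x => (l.map fun i => (Complex.I * (angFreq a b k i : ℂ)) ^ α i).prod
          * basisFun a b k x := by
    intro l
    induction l with
    | nil => simp
    | cons i l ih =>
      rw [List.foldr_cons, ih, h2, List.map_cons, List.prod_cons]
  rw [multiDeriv, key, ← Fin.prod_univ_def, symbol]

theorem angFreq_neg (a b : Fin d → ℝ) (k : Fin d → ℤ) (j : Fin d) :
    angFreq a b (-k) j = -angFreq a b k j := by
  simp only [angFreq, Pi.neg_apply, Int.cast_neg]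
  ring

theorem symbol_neg (a b : Fin d → ℝ) (α : Fin d → ℕ) (k : Fin d → ℤ) :
    symbol a b α (-k) = (-1) ^ (∑ i, α i) * symbol a b α k := by
  rw [symbol, symbol, ← Finset.prod_pow_eq_pow_sum, ← Finset.prod_mul_distrib]
  refine Finset.prod_congr rfl fun j _ => ?_
  rw [angFreq_neg, ← mul_pow]
  congr 1
  push_cast
  ring

/-- Test with the conjugate mode, which is the mode of `-k`: the sign in `symbol_neg` cancels the
one in the definition of the weak derivative. Uniqueness of weak derivatives follows because
coefficients determine a function. -/
theorem coeff_of_hasWeakDeriv {a b : Fin d → ℝ} (hab : ∀ i, a i < b i) {α : Fin d → ℕ}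
    {v w : L2 a b} (h : HasWeakDeriv α v w) (k : Fin d → ℤ) :
    coeff k w = symbol a b α k * coeff k v := by
  have h1 := h _ (isPeriodicTest_basisFun hab (-k))
  simp only [multiDeriv_basisFun] at h1
  rw [coeff_eq_integral_basisFun, coeff_eq_integral_basisFun]
  simp only [conj_basisFun]
  have h2 : ∫ x, v x * (symbol a b α (-k) * basisFun a b (-k) x) ∂(boxMeasure a b)
      = symbol a b α (-k) * ∫ x, v x * basisFun a b (-k) x ∂(boxMeasure a b) := by
    rw [← integral_const_mul]
    congr 1
    funext x
    ring
  rw [h2, symbol_neg, mul_assoc] at h1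
  have h3 : ((-1 : ℂ) ^ (∑ i, α i)) ≠ 0 := pow_ne_zero _ (by norm_num)
  have h4 := mul_left_cancel₀ h3 h1
  rw [← h4]
  ring

theorem integrable_mul_of_continuous {a b : Fin d → ℝ} (v : L2 a b) {φ : (Fin d → ℝ) → ℂ}
    (hφ : Continuous φ) : Integrable (fun x => v x * φ x) (boxMeasure a b) := by
  have hv : Integrable v (boxMeasure a b) := (Lp.memLp v).integrable (by norm_num)
  obtain ⟨C, hC⟩ := (isCompact_Icc (a := a) (b := b)).exists_bound_of_continuousOn hφ.continuousOn
  refine hv.mul_bdd (c := C) hφ.aestronglyMeasurable ?_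
  have hbox : MeasurableSet (box a b) := MeasurableSet.univ_pi fun i => measurableSet_Ioo
  refine (ae_restrict_iff' hbox).2 (Filter.Eventually.of_forall fun x hx => hC x ?_)
  exact ⟨fun i => (hx i (mem_univ i)).1.le, fun i => (hx i (mem_univ i)).2.le⟩

theorem contDiff_multiDeriv {a b : Fin d → ℝ} {φ : (Fin d → ℝ) → ℂ}
    (hφ : IsPeriodicTest a b φ) (α : Fin d → ℕ) : IsPeriodicTest a b (multiDeriv α φ) := by
  unfold multiDeriv
  induction List.finRange d with
  | nil => exact hφ
  | cons i l ih => exact isPeriodicTest_iterate_partialDeriv ih i _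

theorem HasWeakDeriv.add {a b : Fin d → ℝ} {α : Fin d → ℕ} {v w v' w' : L2 a b}
    (h : HasWeakDeriv α v w) (h' : HasWeakDeriv α v' w') : HasWeakDeriv α (v + v') (w + w') := by
  intro φ hφ
  have hα := (contDiff_multiDeriv hφ α).smooth.continuous
  have e1 : ∫ x, (v + v' : L2 a b) x * multiDeriv α φ x ∂(boxMeasure a b)
      = ∫ x, v x * multiDeriv α φ x + v' x * multiDeriv α φ x ∂(boxMeasure a b) := by
    refine integral_congr_ae ?_
    filter_upwards [Lp.coeFn_add v v'] with x hx
    rw [hx, Pi.add_apply, add_mul]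
  have e2 : ∫ x, (w + w' : L2 a b) x * φ x ∂(boxMeasure a b)
      = ∫ x, w x * φ x + w' x * φ x ∂(boxMeasure a b) := by
    refine integral_congr_ae ?_
    filter_upwards [Lp.coeFn_add w w'] with x hx
    rw [hx, Pi.add_apply, add_mul]
  rw [e1, e2, integral_add (integrable_mul_of_continuous v hα) (integrable_mul_of_continuous v' hα),
    integral_add (integrable_mul_of_continuous w hφ.smooth.continuous)
      (integrable_mul_of_continuous w' hφ.smooth.continuous), h φ hφ, h' φ hφ]
  ring

theorem HasWeakDeriv.smul {a b : Fin d → ℝ} {α : Fin d → ℕ} {v w : L2 a b} (c : ℂ)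
    (h : HasWeakDeriv α v w) : HasWeakDeriv α (c • v) (c • w) := by
  intro φ hφ
  have e : ∀ (v : L2 a b) (ψ : (Fin d → ℝ) → ℂ), ∫ x, (c • v : L2 a b) x * ψ x ∂(boxMeasure a b)
      = c * ∫ x, v x * ψ x ∂(boxMeasure a b) := by
    intro v ψ
    rw [← integral_const_mul]
    refine integral_congr_ae ?_
    filter_upwards [Lp.coeFn_smul c v] with x hx
    rw [hx, Pi.smul_apply, smul_eq_mul, mul_assoc]
  rw [e, e, h φ hφ]
  ring

theorem HasWeakDeriv.sub {a b : Fin d → ℝ} {α : Fin d → ℕ} {v w v' w' : L2 a b}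
    (h : HasWeakDeriv α v w) (h' : HasWeakDeriv α v' w') : HasWeakDeriv α (v - v') (w - w') := by
  have h2 := h.add (h'.smul (-1))
  simpa only [neg_smul, one_smul, ← sub_eq_add_neg] using h2

theorem hasWeakDeriv_zero {a b : Fin d → ℝ} (α : Fin d → ℕ) :
    HasWeakDeriv α (0 : L2 a b) 0 := by
  intro φ _
  have e : ∀ ψ : (Fin d → ℝ) → ℂ, ∫ x, (0 : L2 a b) x * ψ x ∂(boxMeasure a b) = 0 := by
    intro ψ
    rw [← integral_zero (Fin d → ℝ) ℂ]
    refine integral_congr_ae ?_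
    filter_upwards [Lp.coeFn_zero ℂ 2 (boxMeasure a b)] with x hx
    rw [hx, Pi.zero_apply, zero_mul]
  rw [e, e, mul_zero]

theorem hasWeakDeriv_mode {a b : Fin d → ℝ} (hab : ∀ i, a i < b i) (α : Fin d → ℕ)
    (k : Fin d → ℤ) : HasWeakDeriv α (mode a b k) (symbol a b α k • mode a b k) := by
  refine HasWeakDeriv.smul (w := symbol a b α k • (memLp_basisFun a b k).toLp (basisFun a b k)) _ ?_
    |> fun h => by simpa only [mode, smul_comm (symbol a b α k)] using h
  intro φ hφ
  have e : ∀ ψ : (Fin d → ℝ) → ℂ,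
      ∫ x, (memLp_basisFun a b k).toLp (basisFun a b k) x * ψ x ∂(boxMeasure a b)
        = ∫ x, basisFun a b k x * ψ x ∂(boxMeasure a b) := by
    intro ψ
    refine integral_congr_ae ?_
    filter_upwards [(memLp_basisFun a b k).coeFn_toLp] with x hx
    rw [hx]
  have e2 : ∫ x, (symbol a b α k • (memLp_basisFun a b k).toLp (basisFun a b k) : L2 a b) x * φ x
        ∂(boxMeasure a b)
      = symbol a b α k * ∫ x, basisFun a b k x * φ x ∂(boxMeasure a b) := by
    rw [← e, ← integral_const_mul]
    refine integral_congr_ae ?_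
    filter_upwards [Lp.coeFn_smul (symbol a b α k)
      ((memLp_basisFun a b k).toLp (basisFun a b k))] with x hx
    rw [hx, Pi.smul_apply, smul_eq_mul, mul_assoc]
  rw [e, e2, integral_basisFun_mul_multiDeriv hab k hφ, mul_assoc]

theorem hasWeakDeriv_trigPoly {a b : Fin d → ℝ} (hab : ∀ i, a i < b i) (α : Fin d → ℕ)
    (S : Finset (Fin d → ℤ)) (c : (Fin d → ℤ) → ℂ) :
    HasWeakDeriv α (trigPoly a b S c) (trigPoly a b S fun k => symbol a b α k * c k) := by
  classical
  induction S using Finset.induction_on with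
  | empty => exact hasWeakDeriv_zero α
  | insert k S hk ih =>
    simp only [trigPoly, Finset.sum_insert hk] at ih ⊢
    refine HasWeakDeriv.add ?_ ih
    have := (hasWeakDeriv_mode hab α k).smul (c k)
    rwa [smul_smul, mul_comm] at this

theorem HasWeakDeriv.unique {a b : Fin d → ℝ} (hab : ∀ i, a i < b i) {α : Fin d → ℕ}
    {v w w' : L2 a b} (h : HasWeakDeriv α v w) (h' : HasWeakDeriv α v w') : w = w' :=
  ext_coeff hab fun k => by rw [coeff_of_hasWeakDeriv hab h, coeff_of_hasWeakDeriv hab h']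

theorem hasWeakDeriv_weakDeriv {a b : Fin d → ℝ} {α : Fin d → ℕ} {v : L2 a b}
    (h : ∃ w : L2 a b, HasWeakDeriv α v w) : HasWeakDeriv α v (weakDeriv α v) := by
  rw [weakDeriv, dif_pos h]
  exact h.choose_spec

/-- By uniqueness the choice inside `weakDeriv` is immaterial, and an explicitly exhibited
derivative may replace it. -/
theorem HasWeakDeriv.weakDeriv_eq {a b : Fin d → ℝ} (hab : ∀ i, a i < b i) {α : Fin d → ℕ}
    {v w : L2 a b} (h : HasWeakDeriv α v w) : weakDeriv α v = w :=
  (hasWeakDeriv_weakDeriv ⟨w, h⟩).unique hab h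

theorem MemHp.hasWeakDeriv {a b : Fin d → ℝ} {s : ℕ} {v : L2 a b} (h : MemHp s v) {α : Fin d → ℕ}
    (hα : ∑ i, α i ≤ s) : HasWeakDeriv α v (weakDeriv α v) :=
  hasWeakDeriv_weakDeriv (h α hα)

theorem MemHp.coeff_weakDeriv {a b : Fin d → ℝ} (hab : ∀ i, a i < b i) {s : ℕ} {v : L2 a b}
    (h : MemHp s v) {α : Fin d → ℕ} (hα : ∑ i, α i ≤ s) (k : Fin d → ℤ) :
    coeff k (weakDeriv α v) = symbol a b α k * coeff k v :=
  coeff_of_hasWeakDeriv hab (h.hasWeakDeriv hα) k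

theorem MemHp.sub {a b : Fin d → ℝ} {s : ℕ} {v w : L2 a b} (h : MemHp s v) (h' : MemHp s w) :
    MemHp s (v - w) := fun _ hα => ⟨_, (h.hasWeakDeriv hα).sub (h'.hasWeakDeriv hα)⟩

theorem memHp_trigPoly {a b : Fin d → ℝ} (hab : ∀ i, a i < b i) (s : ℕ)
    (S : Finset (Fin d → ℤ)) (c : (Fin d → ℤ) → ℂ) : MemHp s (trigPoly a b S c) :=
  fun α _ => ⟨_, hasWeakDeriv_trigPoly hab α S c⟩

theorem memHp_of_mem_XN {a b : Fin d → ℝ} (hab : ∀ i, a i < b i) (s : ℕ) {Nn : Fin d → ℕ}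
    {v : L2 a b} (hv : v ∈ XN a b Nn) : MemHp s v := by
  rw [eq_trigPoly_of_coeff_eq_zero hab (S := frequencies Nn)
    fun k hk => coeff_eq_zero_of_mem_XN hab hv hk]
  exact memHp_trigPoly hab s _ _

theorem MemHp.weakDeriv_sub {a b : Fin d → ℝ} (hab : ∀ i, a i < b i) {s : ℕ} {v w : L2 a b}
    (h : MemHp s v) (h' : MemHp s w) {α : Fin d → ℕ} (hα : ∑ i, α i ≤ s) :
    weakDeriv α (v - w) = weakDeriv α v - weakDeriv α w :=
  ((h.hasWeakDeriv hα).sub (h'.hasWeakDeriv hα)).weakDeriv_eq hab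

/-! ### Sobolev norms in terms of Fourier coefficients -/

/-- The integer weight `1 + |k|²`. -/
def natWeight (k : Fin d → ℤ) : ℕ := 1 + ∑ j, (k j).natAbs ^ 2

/-- The weight `1 + |k|²` as a real number. -/
def weight (k : Fin d → ℤ) : ℝ := natWeight k

/-- The weight is defined through a natural number so that frequencies can later be sorted into
blocks by `Nat.log`. -/
theorem weight_eq (k : Fin d → ℤ) : weight k = 1 + ∑ j, (k j : ℝ) ^ 2 := by
  unfold weight natWeight
  push_cast
  congr 1
  refine Finset.sum_congr rfl fun j _ => ?_
  rw [Nat.cast_natAbs, Int.cast_abs, sq_abs]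

theorem one_le_weight (k : Fin d → ℤ) : 1 ≤ weight k := by
  rw [weight_eq]
  have : 0 ≤ ∑ j, (k j : ℝ) ^ 2 := Finset.sum_nonneg fun _ _ => sq_nonneg _
  linarith

theorem weight_pos (k : Fin d → ℤ) : 0 < weight k := one_pos.trans_le (one_le_weight k)

theorem sq_le_weight (k : Fin d → ℤ) (j : Fin d) : (k j : ℝ) ^ 2 ≤ weight k := by
  rw [weight_eq]
  have := Finset.single_le_sum (f := fun j => (k j : ℝ) ^ 2) (fun _ _ => sq_nonneg _)
    (Finset.mem_univ j)
  linarith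

/-- The eigenvalue `|κ|²` of `-Δ`. -/
def eigenvalue (a b : Fin d → ℝ) (k : Fin d → ℤ) : ℝ := ∑ j, angFreq a b k j ^ 2

theorem exists_angFreq_bounds {a b : Fin d → ℝ} (hab : ∀ i, a i < b i) :
    ∃ c C : ℝ, 0 < c ∧ c ≤ 1 ∧ 1 ≤ C ∧ ∀ (k : Fin d → ℤ) (j : Fin d),
      c * (k j : ℝ) ^ 2 ≤ angFreq a b k j ^ 2 ∧ angFreq a b k j ^ 2 ≤ C * (k j : ℝ) ^ 2 := by
  set g : Fin d → ℝ := fun j => (2 * Real.pi / (b j - a j)) ^ 2 with hg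
  have hgpos : ∀ j, 0 < g j := fun j =>
    pow_pos (div_pos (by positivity) (sub_pos.2 (hab j))) 2
  have hsum : 0 ≤ ∑ j, (g j)⁻¹ := Finset.sum_nonneg fun j _ => (inv_pos.2 (hgpos j)).le
  have hsum2 : 0 ≤ ∑ j, g j := Finset.sum_nonneg fun j _ => (hgpos j).le
  -- Sums over the directions serve all `j` at once; the added `1` yields `c ≤ 1 ≤ C`.
  refine ⟨(1 + ∑ j, (g j)⁻¹)⁻¹, 1 + ∑ j, g j, by positivity, inv_le_one_of_one_le₀ (by linarith),
    by linarith, fun k j => ?_⟩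
  have e : angFreq a b k j ^ 2 = g j * (k j : ℝ) ^ 2 := by
    rw [hg, angFreq, ← mul_pow]
    congr 1
    ring
  rw [e]
  have h1 : (g j)⁻¹ ≤ ∑ j, (g j)⁻¹ :=
    Finset.single_le_sum (f := fun j => (g j)⁻¹) (fun j _ => (inv_pos.2 (hgpos j)).le)
      (Finset.mem_univ j)
  have h2 : g j ≤ ∑ j, g j :=
    Finset.single_le_sum (f := g) (fun j _ => (hgpos j).le) (Finset.mem_univ j)
  constructor
  · refine mul_le_mul_of_nonneg_right ?_ (sq_nonneg _)
    rw [inv_le_comm₀ (by positivity) (hgpos j)]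
    linarith
  · exact mul_le_mul_of_nonneg_right (by linarith) (sq_nonneg _)

theorem exists_mul_weight_le_eigenvalue {a b : Fin d → ℝ} (hab : ∀ i, a i < b i) :
    ∃ c : ℝ, 0 < c ∧ ∀ k : Fin d → ℤ, c * weight k ≤ 1 + eigenvalue a b k := by
  obtain ⟨c, C, hc, hc1, -, h⟩ := exists_angFreq_bounds hab
  refine ⟨c, hc, fun k => ?_⟩
  rw [weight_eq, mul_add, mul_one, Finset.mul_sum, eigenvalue]
  exact add_le_add hc1 (Finset.sum_le_sum fun j _ => (h k j).1)

theorem eigenvalue_nonneg (a b : Fin d → ℝ) (k : Fin d → ℤ) : 0 ≤ eigenvalue a b k :=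
  Finset.sum_nonneg fun _ _ => sq_nonneg _

theorem exists_norm_symbol_le {a b : Fin d → ℝ} (hab : ∀ i, a i < b i) :
    ∃ C : ℝ, 1 ≤ C ∧ ∀ (α : Fin d → ℕ) (k : Fin d → ℤ),
      ‖symbol a b α k‖ ^ 2 ≤ (C * weight k) ^ (∑ i, α i) := by
  obtain ⟨_, C, -, -, hC, h⟩ := exists_angFreq_bounds hab
  refine ⟨C, hC, fun α k => ?_⟩
  rw [symbol, norm_prod, ← Finset.prod_pow, ← Finset.prod_pow_eq_pow_sum]
  refine Finset.prod_le_prod (fun _ _ => by positivity) fun j _ => ?_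
  rw [norm_pow, norm_mul, Complex.norm_I, one_mul, Complex.norm_real, ← pow_mul, mul_comm, pow_mul,
    Real.norm_eq_abs, sq_abs]
  refine pow_le_pow_left₀ (sq_nonneg _) ?_ _
  exact (h k j).2.trans (mul_le_mul_of_nonneg_left (sq_le_weight k j) (by linarith))

/-- `v` has `H^s` norm at most `B`, measured by Fourier coefficients. -/
def HBound {a b : Fin d → ℝ} (s : ℕ) (v : L2 a b) (B : ℝ) : Prop :=
  ∀ S : Finset (Fin d → ℤ), ∑ k ∈ S, weight k ^ s * ‖coeff k v‖ ^ 2 ≤ B ^ 2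

theorem HBound.mono {a b : Fin d → ℝ} {s : ℕ} {v : L2 a b} {B B' : ℝ} (h : HBound s v B)
    (hB : 0 ≤ B) (hB' : B ≤ B') : HBound s v B' :=
  fun S => (h S).trans (pow_le_pow_left₀ hB hB' 2)

theorem HBound.mono_exponent {a b : Fin d → ℝ} {s s' : ℕ} {v : L2 a b} {B : ℝ} (h : HBound s v B)
    (hs : s' ≤ s) : HBound s' v B := fun S =>
  (Finset.sum_le_sum fun k _ => mul_le_mul_of_nonneg_right
    (pow_le_pow_right₀ (one_le_weight k) hs) (sq_nonneg _)).trans (h S)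

theorem hBound_zero_norm {a b : Fin d → ℝ} (hab : ∀ i, a i < b i) (v : L2 a b) :
    HBound 0 v ‖v‖ := fun S => by
  simp only [pow_zero, one_mul]
  exact sum_le_hasSum S (fun _ _ => sq_nonneg _) (hasSum_sq_norm_coeff hab v)

theorem HBound.norm_le {a b : Fin d → ℝ} (hab : ∀ i, a i < b i) {v : L2 a b} {s : ℕ} {B : ℝ}
    (hB : 0 ≤ B) (h : HBound s v B) : ‖v‖ ≤ B := by
  have h1 : ‖v‖ ^ 2 ≤ B ^ 2 := by
    refine hasSum_le_of_sum_le (hasSum_sq_norm_coeff hab v) fun S => ?_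
    simpa using h.mono_exponent (Nat.zero_le s) S
  exact le_of_abs_le (abs_le_of_sq_le_sq h1 hB)

theorem HBound.norm_coeff_le {a b : Fin d → ℝ} {v : L2 a b} {s : ℕ} {B : ℝ}
    (hB : 0 ≤ B) (h : HBound s v B) (k : Fin d → ℤ) : ‖coeff k v‖ ≤ B := by
  have h1 := h.mono_exponent (Nat.zero_le s) {k}
  simp only [pow_zero, one_mul, Finset.sum_singleton] at h1
  exact le_of_abs_le (abs_le_of_sq_le_sq h1 hB)

/-- The squared symbol of order `r` is at most `(C * weight k) ^ r`. The constant `C ^ r` is cruder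
than its square root, which is harmless as `C ≥ 1`. -/
theorem exists_hBound_weakDeriv {a b : Fin d → ℝ} (hab : ∀ i, a i < b i) :
    ∃ C : ℝ, 1 ≤ C ∧ ∀ (r s : ℕ) (α : Fin d → ℕ) (v w : L2 a b) (B : ℝ), 0 ≤ B →
      ∑ i, α i = r → HasWeakDeriv α v w → HBound (s + r) v B → HBound s w (C ^ r * B) := by
  obtain ⟨C, hC, h⟩ := exists_norm_symbol_le hab
  refine ⟨C, hC, fun r s α v w B hB hα hw hv S => ?_⟩
  calc ∑ k ∈ S, weight k ^ s * ‖coeff k w‖ ^ 2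
      ≤ ∑ k ∈ S, C ^ r * (weight k ^ (s + r) * ‖coeff k v‖ ^ 2) := by
        refine Finset.sum_le_sum fun k _ => ?_
        rw [coeff_of_hasWeakDeriv hab hw, norm_mul, mul_pow]
        have h1 := h α k
        rw [hα, mul_pow] at h1
        calc weight k ^ s * (‖symbol a b α k‖ ^ 2 * ‖coeff k v‖ ^ 2)
            ≤ weight k ^ s * ((C ^ r * weight k ^ r) * ‖coeff k v‖ ^ 2) := by
              have := weight_pos k
              gcongr
          _ = _ := by ring
    _ = C ^ r * ∑ k ∈ S, weight k ^ (s + r) * ‖coeff k v‖ ^ 2 := by rw [Finset.mul_sum]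
    _ ≤ C ^ r * B ^ 2 := mul_le_mul_of_nonneg_left (hv S) (by positivity)
    _ ≤ (C ^ r * B) ^ 2 := by
        rw [mul_pow]
        refine mul_le_mul_of_nonneg_right ?_ (sq_nonneg _)
        have : 1 ≤ C ^ r := one_le_pow₀ hC
        nlinarith

theorem exists_sobolevNorm_le {a b : Fin d → ℝ} (hab : ∀ i, a i < b i) (s : ℕ) :
    ∃ C : ℝ, 0 < C ∧ ∀ (v : L2 a b) (B : ℝ), 0 ≤ B → MemHp s v → HBound s v B →
      sobolevNorm s v ≤ C * B := by
  obtain ⟨C, hC, h⟩ := exists_hBound_weakDeriv hab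
  refine ⟨Real.sqrt ((multiIndices d s).card + 1) * C ^ s, by positivity, fun v B hB hv hvB => ?_⟩
  rw [sobolevNorm]
  refine Real.sqrt_le_iff.2 ⟨by positivity, ?_⟩
  calc ∑ α ∈ multiIndices d s, ‖weakDeriv α v‖ ^ 2
      ≤ ∑ α ∈ multiIndices d s, (C ^ s * B) ^ 2 := by
        refine Finset.sum_le_sum fun α hα => ?_
        have hαs : ∑ i, α i ≤ s := (Finset.mem_filter.1 hα).2
        refine pow_le_pow_left₀ (norm_nonneg _) ?_ 2
        have h1 := h (∑ i, α i) 0 α v _ B hB rfl (hv.hasWeakDeriv hαs)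
          (hvB.mono_exponent (by omega))
        refine (h1.norm_le hab (by positivity)).trans ?_
        exact mul_le_mul_of_nonneg_right (pow_le_pow_right₀ hC hαs) hB
    _ = (multiIndices d s).card * (C ^ s * B) ^ 2 := by rw [Finset.sum_const, nsmul_eq_mul]
    _ ≤ (Real.sqrt ((multiIndices d s).card + 1) * C ^ s * B) ^ 2 := by
        rw [mul_assoc (Real.sqrt _), mul_pow (Real.sqrt _), Real.sq_sqrt (by positivity)]
        refine mul_le_mul_of_nonneg_right ?_ (sq_nonneg _)
        linarith

theorem symbol_single (a b : Fin d → ℝ) (j : Fin d) (n : ℕ) (k : Fin d → ℤ) :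
    symbol a b (Pi.single j n) k = (Complex.I * (angFreq a b k j : ℂ)) ^ n := by
  rw [symbol, Finset.prod_eq_single j]
  · rw [Pi.single_eq_same]
  · intro i _ hi
    rw [Pi.single_eq_of_ne hi, pow_zero]
  · simp

theorem symbol_zero (a b : Fin d → ℝ) (k : Fin d → ℤ) : symbol a b 0 k = 1 := by
  simp [symbol]

theorem sum_single_eq (j : Fin d) (n : ℕ) : ∑ i, (Pi.single j n : Fin d → ℕ) i = n := by
  rw [Finset.sum_pi_single']
  simp

theorem norm_symbol_single_sq (a b : Fin d → ℝ) (j : Fin d) (n : ℕ) (k : Fin d → ℤ) :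
    ‖symbol a b (Pi.single j n) k‖ ^ 2 = (angFreq a b k j ^ 2) ^ n := by
  rw [symbol_single, norm_pow, norm_mul, Complex.norm_I, one_mul, Complex.norm_real, ← pow_mul,
    mul_comm, pow_mul, Real.norm_eq_abs, sq_abs]

/-- The direction in which `|k j|` is largest dominates the weight, so one pure derivative of order
`s` suffices, or the function itself if every `|k j|` is at most `1`. Mixed derivatives are not
needed to control the `H^s` norm. -/
theorem exists_weight_pow_le {a b : Fin d → ℝ} (hab : ∀ i, a i < b i) (s : ℕ) :
    ∃ C : ℝ, 0 < C ∧ ∀ k : Fin d → ℤ, weight k ^ s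
      ≤ C * (‖symbol a b 0 k‖ ^ 2 + ∑ j, ‖symbol a b (Pi.single j s) k‖ ^ 2) := by
  obtain ⟨c, _, hc, hc1, -, hbd⟩ := exists_angFreq_bounds hab
  refine ⟨((d + 1 : ℝ) / c) ^ s, by positivity, fun k => ?_⟩
  simp only [symbol_zero, norm_one, one_pow, norm_symbol_single_sq]
  -- `M` is the larger of `1` and the maximal `(k j)²`.
  have hmax : ∃ M : ℝ, 0 ≤ M ∧ (∀ j, (k j : ℝ) ^ 2 ≤ M) ∧ 1 ≤ M ∧
      (c * M) ^ s ≤ 1 + ∑ j, (angFreq a b k j ^ 2) ^ s := by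
    have hnn : ∀ j, 0 ≤ (angFreq a b k j ^ 2) ^ s := fun j => by positivity
    by_cases hall : ∀ j, (k j : ℝ) ^ 2 ≤ 1
    · refine ⟨1, zero_le_one, hall, le_rfl, ?_⟩
      have := pow_le_one₀ (n := s) hc.le hc1
      rw [mul_one]
      exact this.trans (le_add_of_nonneg_right (Finset.sum_nonneg fun j _ => hnn j))
    · push Not at hall
      obtain ⟨j0, hj0⟩ := hall
      obtain ⟨j, -, hj⟩ := Finset.exists_max_image Finset.univ (fun j => (k j : ℝ) ^ 2)
        ⟨j0, Finset.mem_univ _⟩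
      refine ⟨(k j : ℝ) ^ 2, sq_nonneg _, fun i => hj i (Finset.mem_univ i),
        hj0.le.trans (hj j0 (Finset.mem_univ _)), ?_⟩
      calc (c * (k j : ℝ) ^ 2) ^ s ≤ (angFreq a b k j ^ 2) ^ s :=
            pow_le_pow_left₀ (by positivity) (hbd k j).1 s
        _ ≤ ∑ j, (angFreq a b k j ^ 2) ^ s :=
            Finset.single_le_sum (f := fun j => (angFreq a b k j ^ 2) ^ s) (fun j _ => hnn j)
              (Finset.mem_univ j)
        _ ≤ _ := by linarith
  obtain ⟨M, hM, hkM, h1M, hle⟩ := hmax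
  have hw : weight k ≤ (d + 1) * M := by
    rw [weight_eq]
    have := Finset.sum_le_sum fun j (_ : j ∈ Finset.univ) => hkM j
    rw [Finset.sum_const, Finset.card_univ, Fintype.card_fin, nsmul_eq_mul] at this
    linarith
  calc weight k ^ s ≤ ((d + 1) * M) ^ s := pow_le_pow_left₀ (weight_pos k).le hw s
    _ = ((d + 1 : ℝ) / c) ^ s * (c * M) ^ s := by
        rw [← mul_pow]
        congr 1
        field_simp
    _ ≤ _ := mul_le_mul_of_nonneg_left hle (by positivity)

theorem norm_weakDeriv_sq_le {a b : Fin d → ℝ} {s : ℕ} (v : L2 a b) {α : Fin d → ℕ}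
    (hα : ∑ i, α i ≤ s) : ‖weakDeriv α v‖ ^ 2 ≤ sobolevNorm s v ^ 2 := by
  rw [sobolevNorm, Real.sq_sqrt (Finset.sum_nonneg fun _ _ => sq_nonneg _)]
  refine Finset.single_le_sum (f := fun α => ‖weakDeriv α v‖ ^ 2) (fun _ _ => sq_nonneg _) ?_
  refine Finset.mem_filter.2 ⟨Finset.mem_Iic.2 fun i => ?_, hα⟩
  exact (Finset.single_le_sum (f := α) (fun _ _ => Nat.zero_le _) (Finset.mem_univ i)).trans hα

theorem exists_hBound_sobolevNorm {a b : Fin d → ℝ} (hab : ∀ i, a i < b i) (s : ℕ) :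
    ∃ C : ℝ, 0 < C ∧ ∀ v : L2 a b, MemHp s v → HBound s v (C * sobolevNorm s v) := by
  obtain ⟨C, hC, h⟩ := exists_weight_pow_le hab s
  refine ⟨Real.sqrt (C * (d + 1)), by positivity, fun v hv S => ?_⟩
  have hpart : ∀ α : Fin d → ℕ, ∑ i, α i ≤ s →
      ∑ k ∈ S, ‖symbol a b α k‖ ^ 2 * ‖coeff k v‖ ^ 2 ≤ sobolevNorm s v ^ 2 := by
    intro α hα
    refine le_trans ?_ (norm_weakDeriv_sq_le v hα)
    have := hBound_zero_norm hab (weakDeriv α v) S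
    simpa only [pow_zero, one_mul, hv.coeff_weakDeriv hab hα, norm_mul, mul_pow] using this
  calc ∑ k ∈ S, weight k ^ s * ‖coeff k v‖ ^ 2
      ≤ ∑ k ∈ S, C * (‖symbol a b 0 k‖ ^ 2 * ‖coeff k v‖ ^ 2
          + ∑ j, ‖symbol a b (Pi.single j s) k‖ ^ 2 * ‖coeff k v‖ ^ 2) := by
        refine Finset.sum_le_sum fun k _ => ?_
        rw [← Finset.sum_mul, ← add_mul, ← mul_assoc]
        exact mul_le_mul_of_nonneg_right (h k) (sq_nonneg _)
    _ = C * (∑ k ∈ S, ‖symbol a b 0 k‖ ^ 2 * ‖coeff k v‖ ^ 2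
          + ∑ j, ∑ k ∈ S, ‖symbol a b (Pi.single j s) k‖ ^ 2 * ‖coeff k v‖ ^ 2) := by
        rw [← Finset.mul_sum, Finset.sum_add_distrib, Finset.sum_comm]
    _ ≤ C * (sobolevNorm s v ^ 2 + ∑ _j : Fin d, sobolevNorm s v ^ 2) := by
        refine mul_le_mul_of_nonneg_left (add_le_add (hpart 0 (by simp))
          (Finset.sum_le_sum fun j _ => hpart _ ?_)) hC.le
        exact (sum_single_eq j s).le
    _ = (Real.sqrt (C * (d + 1)) * sobolevNorm s v) ^ 2 := by
        rw [mul_pow, Real.sq_sqrt (by positivity), Finset.sum_const, Finset.card_univ,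
          Fintype.card_fin, nsmul_eq_mul]
        ring

/-! ### Lattice sums of powers of the weight -/

theorem one_add_abs_sq_le (k : Fin d → ℤ) (j : Fin d) :
    (1 + |(k j : ℝ)|) ^ 2 ≤ 2 * weight k := by
  have h1 : 1 + (k j : ℝ) ^ 2 ≤ weight k := by
    rw [weight_eq]
    have := Finset.single_le_sum (f := fun j => (k j : ℝ) ^ 2) (fun _ _ => sq_nonneg _)
      (Finset.mem_univ j)
    linarith
  nlinarith [sq_nonneg (1 - |(k j : ℝ)|), sq_abs (k j : ℝ)]

/-- Twice the weight dominates `(1 + |k j|)²` for every `j`, hence also the geometric mean over the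
`d` directions. The product form reduces lattice sums to one-dimensional ones. -/
theorem weight_rpow_neg_le (hd : 1 ≤ d) {σ : ℝ} (hσ : 0 ≤ σ) (k : Fin d → ℤ) :
    weight k ^ (-σ) ≤ 2 ^ σ * ∏ j, (1 + |(k j : ℝ)|) ^ (-(2 * σ / d)) := by
  have hw := weight_pos k
  have hd0 : (0 : ℝ) < d := by exact_mod_cast hd
  have h1 : ∀ j, (weight k / 2⁻¹) ^ (-(σ / d)) ≤ (1 + |(k j : ℝ)|) ^ (-(2 * σ / d)) := by
    intro j
    have h2 := one_add_abs_sq_le k j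
    have h3 : (0 : ℝ) < 1 + |(k j : ℝ)| := by positivity
    have h4 : (1 + |(k j : ℝ)|) ^ (-(2 * σ / d)) = ((1 + |(k j : ℝ)|) ^ 2) ^ (-(σ / d)) := by
      rw [← Real.rpow_natCast, ← Real.rpow_mul h3.le]
      congr 1
      push_cast
      ring
    rw [h4]
    refine Real.rpow_le_rpow_of_nonpos (by positivity) ?_ ?_
    · rw [div_inv_eq_mul]; linarith
    · have : 0 ≤ σ / d := by positivity
      linarith
  have h5 : ∏ _j : Fin d, (weight k / 2⁻¹) ^ (-(σ / d))
      ≤ ∏ j, (1 + |(k j : ℝ)|) ^ (-(2 * σ / d)) :=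
    Finset.prod_le_prod (fun j _ => by positivity) fun j _ => h1 j
  rw [Finset.prod_const, Finset.card_univ, Fintype.card_fin, ← Real.rpow_natCast,
    ← Real.rpow_mul (by positivity), show -(σ / d) * d = -σ by field_simp, div_inv_eq_mul,
    Real.mul_rpow hw.le (by norm_num), Real.rpow_neg (by norm_num : (0 : ℝ) ≤ 2)] at h5
  have h6 : (0 : ℝ) < 2 ^ σ := by positivity
  calc weight k ^ (-σ) = 2 ^ σ * (weight k ^ (-σ) * (2 ^ σ)⁻¹) := by field_simp
    _ ≤ _ := mul_le_mul_of_nonneg_left h5 h6.le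

theorem sum_weight_rpow_neg_le (hd : 1 ≤ d) {σ : ℝ} (hσ : 0 ≤ σ) (S : Finset (Fin d → ℤ))
    (T : Finset ℤ) (hST : ∀ k ∈ S, ∀ j, k j ∈ T) :
    ∑ k ∈ S, weight k ^ (-σ) ≤ 2 ^ σ * (∑ n ∈ T, (1 + |(n : ℝ)|) ^ (-(2 * σ / d))) ^ d := by
  calc ∑ k ∈ S, weight k ^ (-σ)
      ≤ ∑ k ∈ Fintype.piFinset fun _ : Fin d => T, weight k ^ (-σ) := by
        refine Finset.sum_le_sum_of_subset_of_nonneg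
          (fun k hk => Fintype.mem_piFinset.2 (hST k hk)) fun k _ _ => ?_
        have := weight_pos k
        positivity
    _ ≤ ∑ k ∈ Fintype.piFinset fun _ : Fin d => T,
          2 ^ σ * ∏ j, (1 + |(k j : ℝ)|) ^ (-(2 * σ / d)) :=
        Finset.sum_le_sum fun k _ => weight_rpow_neg_le hd hσ k
    _ = _ := by
        rw [← Finset.mul_sum, Finset.sum_prod_piFinset T
          fun (_ : Fin d) (n : ℤ) => (1 + |(n : ℝ)|) ^ (-(2 * σ / d)), Finset.prod_const,
          Finset.card_univ, Fintype.card_fin]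

theorem exists_sum_one_add_abs_le {p : ℝ} (hp : 1 < p) :
    ∃ C : ℝ, 0 ≤ C ∧ ∀ T : Finset ℤ, ∑ n ∈ T, (1 + |(n : ℝ)|) ^ (-p) ≤ C := by
  have h1 : Summable fun n : ℕ => (1 + (n : ℝ)) ^ (-p) := by
    have := (Real.summable_one_div_nat_add_rpow 1 p).2 hp
    refine this.congr fun n => ?_
    have : (0 : ℝ) ≤ n + 1 := by positivity
    rw [abs_of_nonneg this, Real.rpow_neg (by positivity), one_div, add_comm]
  have h2 : Summable fun n : ℤ => (1 + |(n : ℝ)|) ^ (-p) := by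
    refine Summable.of_nat_of_neg ?_ ?_
    · simpa using h1
    · simpa using h1
  exact ⟨_, tsum_nonneg fun n => by positivity, fun T => h2.sum_le_tsum T fun n _ => by positivity⟩

/-- The one-dimensional exponent is `4 / d`, which exceeds `1` exactly because `d ≤ 3`. This is what
makes `H²` embed into the bounded functions. -/
theorem exists_sum_weight_inv_sq_le (hd : 1 ≤ d) (hd3 : d ≤ 3) :
    ∃ C : ℝ, 0 ≤ C ∧ ∀ S : Finset (Fin d → ℤ), ∑ k ∈ S, (weight k ^ 2)⁻¹ ≤ C := by
  have hd0 : (0 : ℝ) < d := by exact_mod_cast hd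
  have hd3' : (d : ℝ) ≤ 3 := by exact_mod_cast hd3
  obtain ⟨C, hC, h⟩ := exists_sum_one_add_abs_le (p := 2 * 2 / d) (by
    rw [lt_div_iff₀ hd0]; linarith)
  refine ⟨2 ^ (2 : ℝ) * C ^ d, by positivity, fun S => ?_⟩
  have h1 := sum_weight_rpow_neg_le hd (σ := 2) (by norm_num) S
    (S.biUnion fun k => Finset.univ.image k) (fun k hk j =>
      Finset.mem_biUnion.2 ⟨k, hk, Finset.mem_image_of_mem _ (Finset.mem_univ j)⟩)
  have h2 : ∀ k : Fin d → ℤ, weight k ^ (-(2 : ℝ)) = (weight k ^ 2)⁻¹ := fun k => by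
    rw [Real.rpow_neg (weight_pos k).le, Real.rpow_two]
  simp only [h2] at h1
  refine h1.trans (mul_le_mul_of_nonneg_left ?_ (by positivity))
  exact pow_le_pow_left₀ (Finset.sum_nonneg fun n _ => by positivity) (h _) _

/-- A discrete form of integrating `x ^ (θ - 1)`; the induction step is Bernoulli's inequality `n ^
θ ≤ (1 + n) ^ θ * (1 - θ / (1 + n))` for exponents at most `1`. -/
theorem sum_range_rpow_le {θ : ℝ} (h0 : 0 < θ) (h1 : θ ≤ 1) (n : ℕ) :
    ∑ m ∈ Finset.range n, (1 + (m : ℝ)) ^ (θ - 1) ≤ θ⁻¹ * (n : ℝ) ^ θ := by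
  induction n with
  | zero => simp [Real.zero_rpow h0.ne']
  | succ n ih =>
    rw [Finset.sum_range_succ]
    have hn : (0 : ℝ) < 1 + n := by positivity
    have hb := rpow_one_add_le_one_add_mul_self (s := -(1 + (n : ℝ))⁻¹) (p := θ)
      (by rw [neg_le_neg_iff]; exact inv_le_one_of_one_le₀ (by linarith [n.cast_nonneg (α := ℝ)]))
      h0.le h1
    have he : (n : ℝ) ^ θ = (1 + (n : ℝ)) ^ θ * (1 + -(1 + (n : ℝ))⁻¹) ^ θ := by
      rw [← Real.mul_rpow hn.le]
      · congr 1
        field_simp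
        ring
      · rw [← sub_eq_add_neg, sub_nonneg]
        exact inv_le_one_of_one_le₀ (by linarith [n.cast_nonneg (α := ℝ)])
    have hs : (1 + (n : ℝ)) ^ (θ - 1) = (1 + (n : ℝ)) ^ θ * (1 + (n : ℝ))⁻¹ := by
      rw [Real.rpow_sub_one hn.ne', div_eq_mul_inv]
    have hP : 0 < (1 + (n : ℝ)) ^ θ := by positivity
    have h2 := mul_le_mul_of_nonneg_left hb hP.le
    rw [← he] at h2
    push_cast
    rw [add_comm (n : ℝ) 1]
    calc _ ≤ θ⁻¹ * (n : ℝ) ^ θ + (1 + (n : ℝ)) ^ (θ - 1) := by linarith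
      _ ≤ θ⁻¹ * ((1 + (n : ℝ)) ^ θ * (1 + θ * -(1 + (n : ℝ))⁻¹)) + (1 + (n : ℝ)) ^ (θ - 1) := by
          gcongr
      _ = _ := by
          rw [hs]
          field_simp
          ring

theorem sum_one_add_abs_rpow_le {θ : ℝ} (h0 : 0 < θ) (h1 : θ ≤ 1) {r : ℝ} (hr : 0 ≤ r)
    (T : Finset ℤ) (hT : ∀ n ∈ T, 1 + |(n : ℝ)| ≤ r) :
    ∑ n ∈ T, (1 + |(n : ℝ)|) ^ (θ - 1) ≤ 2 * θ⁻¹ * r ^ θ := by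
  set N := ⌊r⌋₊
  have hfib : ∀ m ∈ Finset.range N, ((T.filter fun n => n.natAbs = m).card : ℝ) ≤ 2 := by
    intro m _
    have : (T.filter fun n => n.natAbs = m) ⊆ {(m : ℤ), -(m : ℤ)} := by
      intro n hn
      have := (Finset.mem_filter.1 hn).2
      simp only [Finset.mem_insert, Finset.mem_singleton]
      omega
    exact_mod_cast (Finset.card_le_card this).trans Finset.card_le_two
  have hmaps : ∀ n ∈ T, n.natAbs ∈ Finset.range N := by
    intro n hn
    rw [Finset.mem_range, Nat.lt_iff_add_one_le]
    refine Nat.le_floor ?_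
    have := hT n hn
    push_cast
    rw [Nat.cast_natAbs, Int.cast_abs]
    linarith
  have habs : ∀ n : ℤ, |(n : ℝ)| = (n.natAbs : ℝ) := fun n => by rw [Nat.cast_natAbs, Int.cast_abs]
  calc ∑ n ∈ T, (1 + |(n : ℝ)|) ^ (θ - 1)
      = ∑ m ∈ Finset.range N, ∑ n ∈ T.filter (fun n => n.natAbs = m), (1 + |(n : ℝ)|) ^ (θ - 1) :=
        (Finset.sum_fiberwise_of_maps_to hmaps _).symm
    _ ≤ ∑ m ∈ Finset.range N, 2 * (1 + (m : ℝ)) ^ (θ - 1) := by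
        refine Finset.sum_le_sum fun m hm => ?_
        have : ∑ n ∈ T.filter (fun n => n.natAbs = m), (1 + |(n : ℝ)|) ^ (θ - 1)
            = ∑ n ∈ T.filter (fun n => n.natAbs = m), (1 + (m : ℝ)) ^ (θ - 1) := by
          refine Finset.sum_congr rfl fun n hn => ?_
          rw [habs, (Finset.mem_filter.1 hn).2]
        rw [this, Finset.sum_const, nsmul_eq_mul]
        exact mul_le_mul_of_nonneg_right (hfib m hm) (by positivity)
    _ = 2 * ∑ m ∈ Finset.range N, (1 + (m : ℝ)) ^ (θ - 1) := by rw [Finset.mul_sum]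
    _ ≤ 2 * (θ⁻¹ * (N : ℝ) ^ θ) := by
        have := sum_range_rpow_le h0 h1 N
        linarith
    _ ≤ 2 * (θ⁻¹ * r ^ θ) := by
        have : (N : ℝ) ≤ r := Nat.floor_le hr
        gcongr
    _ = _ := by ring

/-- With `θ = s / d` the one-dimensional exponent `-2 / d` is at most `θ - 1` precisely when `d - s
≤ 2`, and the product of `d` sums of order `r ^ (θ / 2)` is of order `r ^ (s / 2)`. The lemma bounds
the sup norm of the part of an `H¹` function with weights at most `r`; for `d = 3` the exponent `s =
1` is needed. -/
theorem exists_sum_weight_inv_le (hd : 1 ≤ d) {s : ℝ} (hs : 0 < s) (hs1 : s ≤ 1)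
    (hds : (d : ℝ) - s ≤ 2) :
    ∃ C : ℝ, 0 < C ∧ ∀ (r : ℝ) (S : Finset (Fin d → ℤ)), 0 ≤ r → (∀ k ∈ S, weight k ≤ r) →
      ∑ k ∈ S, (weight k)⁻¹ ≤ C * r ^ (s / 2) := by
  have hd0 : (0 : ℝ) < d := by exact_mod_cast hd
  have hd1 : (1 : ℝ) ≤ d := by exact_mod_cast hd
  set θ := s / d with hθ
  have hθ0 : 0 < θ := by positivity
  have hθ1 : θ ≤ 1 := by rw [hθ, div_le_one hd0]; linarith
  refine ⟨2 ^ (1 : ℝ) * (2 * θ⁻¹ * 2 ^ (θ / 2)) ^ d, by positivity, fun r S hr hS => ?_⟩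
  set T := S.biUnion fun k => Finset.univ.image k
  have h1 := sum_weight_rpow_neg_le hd (σ := 1) zero_le_one S T (fun k hk j =>
      Finset.mem_biUnion.2 ⟨k, hk, Finset.mem_image_of_mem _ (Finset.mem_univ j)⟩)
  have hT : ∀ n ∈ T, 1 + |(n : ℝ)| ≤ Real.sqrt (2 * r) := by
    intro n hn
    obtain ⟨k, hk, hn⟩ := Finset.mem_biUnion.1 hn
    obtain ⟨j, -, rfl⟩ := Finset.mem_image.1 hn
    refine Real.le_sqrt_of_sq_le ((one_add_abs_sq_le k j).trans ?_)
    have := hS k hk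
    linarith
  have h2 : ∑ n ∈ T, (1 + |(n : ℝ)|) ^ (-(2 * 1 / d : ℝ))
      ≤ 2 * θ⁻¹ * Real.sqrt (2 * r) ^ θ := by
    refine le_trans (Finset.sum_le_sum fun n _ => ?_)
      (sum_one_add_abs_rpow_le hθ0 hθ1 (Real.sqrt_nonneg _) T hT)
    refine Real.rpow_le_rpow_of_exponent_le (by linarith [abs_nonneg (n : ℝ)]) ?_
    rw [hθ, neg_le_sub_iff_le_add, ← add_div, le_div_iff₀ hd0]
    linarith
  have h3 : ∀ k : Fin d → ℤ, weight k ^ (-(1 : ℝ)) = (weight k)⁻¹ := fun k => by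
    rw [Real.rpow_neg (weight_pos k).le, Real.rpow_one]
  simp only [h3] at h1
  have h4 : (Real.sqrt (2 * r) ^ θ) = 2 ^ (θ / 2) * r ^ (θ / 2) := by
    rw [Real.sqrt_eq_rpow, ← Real.rpow_mul (by positivity), Real.mul_rpow (by norm_num) hr]
    congr 2 <;> ring
  have h5 : (r ^ (θ / 2)) ^ d = r ^ (s / 2) := by
    rw [← Real.rpow_natCast, ← Real.rpow_mul hr, hθ]
    congr 1
    field_simp
  calc ∑ k ∈ S, (weight k)⁻¹ ≤ _ := h1
    _ ≤ 2 ^ (1 : ℝ) * (2 * θ⁻¹ * (2 ^ (θ / 2) * r ^ (θ / 2))) ^ d := by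
        rw [← h4]
        refine mul_le_mul_of_nonneg_left ?_ (by positivity)
        exact pow_le_pow_left₀ (Finset.sum_nonneg fun n _ => by positivity) h2 _
    _ = _ := by rw [← mul_assoc (2 * θ⁻¹), mul_pow _ (r ^ (θ / 2)), h5, ← mul_assoc]

/-! ### Sobolev embeddings of `H²` into `L^∞` and of `H¹` into `L^q` -/

theorem sum_norm_coeff_le {a b : Fin d → ℝ} {v : L2 a b} {s : ℕ} {B : ℝ} (hB : 0 ≤ B)
    (h : HBound s v B) (S : Finset (Fin d → ℤ)) {C : ℝ}
    (hC : ∑ k ∈ S, (weight k ^ s)⁻¹ ≤ C) : ∑ k ∈ S, ‖coeff k v‖ ≤ Real.sqrt C * B := by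
  have h1 := Finset.sum_mul_sq_le_sq_mul_sq S (fun k => Real.sqrt ((weight k ^ s)⁻¹))
    (fun k => Real.sqrt (weight k ^ s) * ‖coeff k v‖)
  have hw : ∀ k : Fin d → ℤ, 0 < weight k ^ s := fun k => pow_pos (weight_pos k) s
  have e1 : ∀ k : Fin d → ℤ, Real.sqrt ((weight k ^ s)⁻¹) * (Real.sqrt (weight k ^ s) * ‖coeff k v‖)
      = ‖coeff k v‖ := fun k => by
    rw [← mul_assoc, Real.sqrt_inv, inv_mul_cancel₀ (Real.sqrt_pos.2 (hw k)).ne', one_mul]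
  have e2 : ∀ k : Fin d → ℤ, Real.sqrt ((weight k ^ s)⁻¹) ^ 2 = (weight k ^ s)⁻¹ := fun k =>
    Real.sq_sqrt (inv_pos.2 (hw k)).le
  have e3 : ∀ k : Fin d → ℤ, (Real.sqrt (weight k ^ s) * ‖coeff k v‖) ^ 2
      = weight k ^ s * ‖coeff k v‖ ^ 2 := fun k => by rw [mul_pow, Real.sq_sqrt (hw k).le]
  simp only [e1, e2, e3] at h1
  have hC0 : 0 ≤ C := (Finset.sum_nonneg fun k _ => (inv_pos.2 (hw k)).le).trans hC
  refine le_of_abs_le (abs_le_of_sq_le_sq ?_ (by positivity))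
  rw [mul_pow, Real.sq_sqrt hC0]
  refine h1.trans (mul_le_mul hC (h S) ?_ hC0)
  exact Finset.sum_nonneg fun k _ => mul_nonneg (hw k).le (sq_nonneg _)

/-- The partial sums converge in `L²`, hence almost everywhere along a sequence of finite sets, and
a uniform bound passes to the limit. -/
theorem ae_norm_le_of_hasSum {a b : Fin d → ℝ} (hab : ∀ i, a i < b i) (v : L2 a b) {C : ℝ}
    (hC : ∀ S x, ‖trigFun a b S (fun k => coeff k v) x‖ ≤ C) : ∀ᵐ x ∂(boxMeasure a b), ‖v x‖ ≤ C := by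
  have h1 : Filter.Tendsto (fun S => trigPoly a b S fun k => coeff k v) Filter.atTop (nhds v) :=
    hasSum_coeff_smul_mode hab v
  have h2 := tendstoInMeasure_of_tendsto_Lp h1
  obtain ⟨ns, -, hns⟩ := h2.exists_seq_tendsto_ae'
  have h3 : ∀ᵐ x ∂(boxMeasure a b), ∀ n,
      trigPoly a b (ns n) (fun k => coeff k v) x = trigFun a b (ns n) (fun k => coeff k v) x :=
    ae_all_iff.2 fun n => trigPoly_ae_eq a b _ _
  filter_upwards [hns, h3] with x hx hx3
  refine le_of_tendsto hx.norm (Filter.Eventually.of_forall fun n => ?_)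
  rw [hx3]
  exact hC _ _

theorem exists_ae_norm_le {a b : Fin d → ℝ} (hab : ∀ i, a i < b i) (hd : 1 ≤ d) (hd3 : d ≤ 3) :
    ∃ C : ℝ, 0 < C ∧ ∀ (v : L2 a b) (B : ℝ), 0 ≤ B → HBound 2 v B →
      ∀ᵐ x ∂(boxMeasure a b), ‖v x‖ ≤ C * B := by
  obtain ⟨C, hC, h⟩ := exists_sum_weight_inv_sq_le hd hd3
  have hV := Real.sqrt_pos.2 (boxVolume_pos hab)
  refine ⟨(Real.sqrt (boxVolume a b))⁻¹ * (Real.sqrt C + 1), by positivity,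
    fun v B hB hv => ae_norm_le_of_hasSum hab v fun S x => ?_⟩
  refine (norm_trigFun_le a b S _ x).trans ?_
  rw [mul_assoc]
  refine mul_le_mul_of_nonneg_left ?_ (by positivity)
  refine (sum_norm_coeff_le hB hv S (h S)).trans ?_
  rw [add_mul]
  linarith

theorem ofReal_norm_sq_eq_tsum {a b : Fin d → ℝ} (hab : ∀ i, a i < b i) (v : L2 a b) :
    ENNReal.ofReal (‖v‖ ^ 2) = ∑' k, ENNReal.ofReal (‖coeff k v‖ ^ 2) := by
  have h := hasSum_sq_norm_coeff hab v
  rw [← h.tsum_eq, ENNReal.ofReal_tsum_of_nonneg (fun _ => sq_nonneg _) h.summable]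

theorem finite_weight_le (r : ℝ) : {k : Fin d → ℤ | weight k ≤ r}.Finite := by
  refine Set.Finite.subset (Fintype.piFinset fun _ : Fin d => Finset.Icc (-⌈r⌉) ⌈r⌉).finite_toSet
    fun k hk => ?_
  rw [Finset.mem_coe, Fintype.mem_piFinset]
  intro j
  rw [Finset.mem_Icc, ← abs_le]
  have h1 : (|k j| : ℤ) ≤ ((|k j| ^ 2 : ℤ)) := by
    rcases eq_or_ne (k j) 0 with h | h
    · simp [h]
    · have : 1 ≤ |k j| := Int.one_le_abs h
      nlinarith
  have h2 : ((|k j| ^ 2 : ℤ) : ℝ) ≤ r := by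
    push_cast
    rw [sq_abs]
    exact (sq_le_weight k j).trans hk
  have h3 : ((|k j| : ℤ) : ℝ) ≤ (⌈r⌉ : ℝ) := (Int.cast_le.2 h1).trans (h2.trans (Int.le_ceil r))
  exact_mod_cast h3

theorem norm_trigFun_coeff_le_of_weight_le {a b : Fin d → ℝ} {C s : ℝ}
    (hC : ∀ (r : ℝ) (S : Finset (Fin d → ℤ)), 0 ≤ r → (∀ k ∈ S, weight k ≤ r) →
      ∑ k ∈ S, (weight k)⁻¹ ≤ C * r ^ (s / 2)) {v : L2 a b} {B r : ℝ} (hB : 0 ≤ B) (hr : 0 ≤ r)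
    (h : HBound 1 v B) (S : Finset (Fin d → ℤ)) (hS : ∀ k ∈ S, weight k ≤ r) (x : Fin d → ℝ) :
    ‖trigFun a b S (fun k => coeff k v) x‖
      ≤ (Real.sqrt (boxVolume a b))⁻¹ * (Real.sqrt (C * r ^ (s / 2)) * B) := by
  refine (norm_trigFun_le a b S _ x).trans (mul_le_mul_of_nonneg_left ?_ (by positivity))
  exact sum_norm_coeff_le hB h S (by simpa only [pow_one] using hC r S hr hS)

/-- Where `|v|` exceeds `t` the part of `v` outside `S` has size at least `t / 2`; Chebyshev's
inequality in `L²` and Parseval do the rest. -/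
theorem measure_lt_norm_le {a b : Fin d → ℝ} (hab : ∀ i, a i < b i) (v : L2 a b) {t : ℝ}
    (ht : 0 < t) (S : Finset (Fin d → ℤ))
    (hS : ∀ x, ‖trigFun a b S (fun k => coeff k v) x‖ ≤ t / 2) :
    boxMeasure a b {x | t < ‖v x‖}
      ≤ ENNReal.ofReal (4 / t ^ 2) * ∑' k, if k ∈ S then 0 else ENNReal.ofReal (‖coeff k v‖ ^ 2) := by
  classical
  set p : L2 a b := trigPoly a b S fun k => coeff k v with hp
  have h1 : boxMeasure a b {x | t < ‖v x‖}
      ≤ boxMeasure a b {x | ENNReal.ofReal (t / 2) ≤ ‖(v - p) x‖ₑ} := by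
    refine measure_mono_ae ?_
    filter_upwards [Lp.coeFn_sub v p, trigPoly_ae_eq a b S fun k => coeff k v] with x h1 h2 h3
    change ENNReal.ofReal (t / 2) ≤ ‖(v - p) x‖ₑ
    have h3' : t < ‖v x‖ := h3
    rw [h1, Pi.sub_apply, hp, h2, ← ofReal_norm]
    refine ENNReal.ofReal_le_ofReal ?_
    have := norm_sub_norm_le (v x) (trigFun a b S (fun k => coeff k v) x)
    have := hS x
    linarith
  have h2 := meas_ge_le_mul_pow_eLpNorm_enorm (boxMeasure a b) (p := 2) (by norm_num) (by norm_num)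
    (Lp.aestronglyMeasurable (v - p)) (ε := ENNReal.ofReal (t / 2))
    (by simpa using ht) (fun h => absurd h ENNReal.ofReal_ne_top)
  refine h1.trans (h2.trans (le_of_eq ?_))
  have h3 : eLpNorm (v - p : L2 a b) 2 (boxMeasure a b) = ENNReal.ofReal ‖v - p‖ := by
    rw [Lp.norm_def, ENNReal.ofReal_toReal (Lp.eLpNorm_ne_top _)]
  rw [h3, ENNReal.toReal_ofNat, ENNReal.rpow_two, ENNReal.rpow_two,
    ← ENNReal.ofReal_pow (norm_nonneg _), ofReal_norm_sq_eq_tsum hab,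
    ← ENNReal.ofReal_inv_of_pos (by positivity), ← ENNReal.ofReal_pow (by positivity)]
  congr 1
  · congr 1
    field_simp
    norm_num
  · refine tsum_congr fun k => ?_
    rw [map_sub, hp, coeff_trigPoly hab]
    split_ifs <;> simp

/-- The Sobolev embedding `H¹ ⊂ L^q` on the box. -/
theorem exists_eLpNorm_le {a b : Fin d → ℝ} (hab : ∀ i, a i < b i) (hd : 1 ≤ d) {q : ℝ}
    (hq : 6 ≤ q) (hdq : (d : ℝ) - 4 / (q - 2) ≤ 2) :
    ∃ C : ℝ, 0 < C ∧ ∀ (v : L2 a b) (B : ℝ), 0 ≤ B → HBound 1 v B →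
      eLpNorm v (ENNReal.ofReal q) (boxMeasure a b) ≤ ENNReal.ofReal (C * B) := by
  classical
  have hq2 : 0 < q - 2 := by linarith
  set s := 4 / (q - 2) with hs
  obtain ⟨C, hC, hsum⟩ := exists_sum_weight_inv_le hd (s := s) (by positivity)
    (by rw [hs, div_le_one hq2]; linarith) hdq
  have hV := Real.sqrt_pos.2 (boxVolume_pos hab)
  set C1 := (Real.sqrt (boxVolume a b))⁻¹ * Real.sqrt C with hC1
  have hC1pos : 0 < C1 := by positivity
  refine ⟨(4 * q * (2 * C1) ^ (q - 2)) ^ (1 / q), by positivity, fun v B hB hv => ?_⟩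
  -- For `B = 0` the scale `M` below would vanish and could not be divided by.
  rcases hB.eq_or_lt with rfl | hBpos
  · have hv0 : v = 0 := norm_le_zero_iff.1 (hv.norm_le hab le_rfl)
    subst hv0
    rw [eLpNorm_congr_ae (Lp.coeFn_zero _ _ _)]
    simp
  set M := 2 * C1 * B with hM
  have hMpos : 0 < M := by positivity
  -- `τ k` is the level up to which the frequency `k` counts as high: `weight k` exceeds the cutoff
  -- `r` at level `t` exactly if `t < τ k`.
  set τ : (Fin d → ℤ) → ℝ := fun k => M * weight k ^ (1 / (q - 2)) with hτ
  have hτpos : ∀ k, 0 < τ k := fun k => by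
    have := weight_pos k
    positivity
  have hmeas : ∀ t ∈ Ioi (0 : ℝ), boxMeasure a b {x | t < ‖v x‖} * ENNReal.ofReal (t ^ (q - 1))
      ≤ ∑' k, (Ioo 0 (τ k)).indicator
        (fun _ => ENNReal.ofReal (4 * ‖coeff k v‖ ^ 2 * τ k ^ (q - 3))) t := by
    intro t (ht : 0 < t)
    -- The cutoff depends on the level. It is chosen so that the bound `C1 * r ^ (s / 4) * B` for
    -- the low part equals `t / 2`; this explains `s = 4 / (q - 2)` and `M = 2 * C1 * B`.
    set r := (t / M) ^ (q - 2) with hr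
    have hrpos : 0 < r := by positivity
    set S := (finite_weight_le (d := d) r).toFinset with hS
    have hSmem : ∀ k, k ∈ S ↔ weight k ≤ r := fun k => by simp [hS]
    have hlow : ∀ x, ‖trigFun a b S (fun k => coeff k v) x‖ ≤ t / 2 := by
      intro x
      refine (norm_trigFun_coeff_le_of_weight_le hsum hB hrpos.le hv S
        (fun k hk => (hSmem k).1 hk) x).trans (le_of_eq ?_)
      have h1 : r ^ (s / 2) = (t / M) ^ 2 := by
        rw [hr, ← Real.rpow_mul (by positivity), ← Real.rpow_two]
        congr 1
        rw [hs]
        field_simp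
        norm_num
      rw [h1, Real.sqrt_mul hC.le, Real.sqrt_sq (by positivity), hM]
      field_simp
      rw [hC1]
      field_simp
    refine (mul_le_mul_left (measure_lt_norm_le hab v ht S hlow) _).trans ?_
    rw [mul_right_comm, ← ENNReal.tsum_mul_left]
    refine ENNReal.tsum_le_tsum fun k => ?_
    by_cases hk : weight k ≤ r
    · simp [(hSmem k).2 hk]
    · rw [if_neg (fun h => hk ((hSmem k).1 h))]
      have htk : t < τ k := by
        rw [hτ]
        have h1 : t / M < weight k ^ (1 / (q - 2)) := by
          rw [one_div, Real.lt_rpow_inv_iff_of_pos (by positivity) (weight_pos k).le hq2]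
          exact not_le.1 hk
        rw [div_lt_iff₀ hMpos] at h1
        linarith
      rw [indicator_of_mem (show t ∈ Ioo 0 (τ k) from ⟨ht, htk⟩), ← ENNReal.ofReal_mul (by positivity),
        ← ENNReal.ofReal_mul (by positivity)]
      refine ENNReal.ofReal_le_ofReal ?_
      have h2 : 4 / t ^ 2 * t ^ (q - 1) = 4 * t ^ (q - 3) := by
        rw [show q - 1 = (q - 3) + 2 by ring, Real.rpow_add ht, Real.rpow_two]
        field_simp
      rw [h2]
      have h3 : t ^ (q - 3) ≤ τ k ^ (q - 3) := Real.rpow_le_rpow ht.le htk.le (by linarith)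
      calc 4 * t ^ (q - 3) * ‖coeff k v‖ ^ 2 ≤ 4 * τ k ^ (q - 3) * ‖coeff k v‖ ^ 2 := by gcongr
        _ = _ := by ring
  have hint : ∫⁻ x, ENNReal.ofReal (‖v x‖ ^ q) ∂(boxMeasure a b)
      ≤ ENNReal.ofReal (4 * q * M ^ (q - 2) * B ^ 2) := by
    rw [lintegral_rpow_eq_lintegral_meas_lt_mul _ (Filter.Eventually.of_forall fun x => norm_nonneg _)
      (Lp.aestronglyMeasurable v).norm.aemeasurable (by linarith : 0 < q)]
    -- Exchanging the level integral with the sum over `k` leaves at most `4 * ‖coeff k v‖ ^ 2 * τ k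
    -- ^ (q - 3)` on an interval of length `τ k`, and `τ k ^ (q - 2) = M ^ (q - 2) * weight k`
    -- restores the `H¹` norm without logarithmic loss.
    calc ENNReal.ofReal q * ∫⁻ t in Ioi 0, boxMeasure a b {x | t < ‖v x‖}
            * ENNReal.ofReal (t ^ (q - 1))
        ≤ ENNReal.ofReal q * ∫⁻ t, ∑' k, (Ioo 0 (τ k)).indicator
            (fun _ => ENNReal.ofReal (4 * ‖coeff k v‖ ^ 2 * τ k ^ (q - 3))) t := by
          refine mul_le_mul_right ?_ _
          exact (setLIntegral_mono' measurableSet_Ioi hmeas).trans (setLIntegral_le_lintegral _ _)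
      _ = ENNReal.ofReal q * ∑' k, ENNReal.ofReal (4 * ‖coeff k v‖ ^ 2 * τ k ^ (q - 3))
            * ENNReal.ofReal (τ k) := by
          rw [lintegral_tsum fun k => (measurable_const.indicator measurableSet_Ioo).aemeasurable]
          congr 1
          refine tsum_congr fun k => ?_
          rw [lintegral_indicator measurableSet_Ioo, setLIntegral_const, Real.volume_Ioo, sub_zero]
      _ = ∑' k, ENNReal.ofReal (4 * q * M ^ (q - 2)) * ENNReal.ofReal (weight k * ‖coeff k v‖ ^ 2) := by
          rw [← ENNReal.tsum_mul_left]
          refine tsum_congr fun k => ?_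
          have h1 := hτpos k
          have hw := weight_pos k
          rw [← ENNReal.ofReal_mul (by positivity), ← ENNReal.ofReal_mul (by positivity),
            ← ENNReal.ofReal_mul (by positivity)]
          congr 1
          have h2 : τ k ^ (q - 3) * τ k = M ^ (q - 2) * weight k := by
            rw [← Real.rpow_add_one h1.ne', show q - 3 + 1 = q - 2 by ring, hτ,
              Real.mul_rpow hMpos.le (by positivity), ← Real.rpow_mul hw.le,
              one_div_mul_cancel hq2.ne', Real.rpow_one]
          linear_combination (q * 4 * ‖coeff k v‖ ^ 2) * h2
      _ = ENNReal.ofReal (4 * q * M ^ (q - 2)) * ∑' k, ENNReal.ofReal (weight k * ‖coeff k v‖ ^ 2) :=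
          ENNReal.tsum_mul_left
      _ ≤ ENNReal.ofReal (4 * q * M ^ (q - 2)) * ENNReal.ofReal (B ^ 2) := by
          refine mul_le_mul_right ?_ _
          rw [ENNReal.tsum_eq_iSup_sum]
          refine iSup_le fun S => ?_
          rw [← ENNReal.ofReal_sum_of_nonneg fun k _ => mul_nonneg (weight_pos k).le (sq_nonneg _)]
          exact ENNReal.ofReal_le_ofReal (by simpa only [pow_one] using hv S)
      _ = _ := (ENNReal.ofReal_mul (by positivity)).symm
  have hq0 : 0 < q := by linarith
  rw [eLpNorm_eq_lintegral_rpow_enorm_toReal (by simpa using hq0) ENNReal.ofReal_ne_top,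
    ENNReal.toReal_ofReal hq0.le]
  have h1 : ∀ x, ‖v x‖ₑ ^ q = ENNReal.ofReal (‖v x‖ ^ q) := fun x => by
    rw [← ofReal_norm, ENNReal.ofReal_rpow_of_nonneg (norm_nonneg _) hq0.le]
  simp only [h1]
  refine (ENNReal.rpow_le_rpow hint (by positivity)).trans (le_of_eq ?_)
  rw [ENNReal.ofReal_rpow_of_nonneg (by positivity) (by positivity)]
  congr 1
  rw [hM, Real.mul_rpow (by positivity) hB, ← mul_assoc, mul_assoc _ (B ^ (q - 2)),
    ← Real.rpow_two B, ← Real.rpow_add hBpos, sub_add_cancel, Real.mul_rpow (by positivity)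
    (by positivity), ← Real.rpow_mul hB, mul_one_div_cancel hq0.ne', Real.rpow_one]

/-! ### Hölder estimates for the difference of nonlinearities -/

section Holder

variable {α : Type*} [MeasurableSpace α] {μ : Measure α}

theorem lintegral_enorm_mul_enorm_le {E F : Type*} [NormedAddCommGroup E] [NormedAddCommGroup F]
    {g : α → E} {z : α → F} (hg : AEStronglyMeasurable g μ) (hz : AEStronglyMeasurable z μ) :
    ∫⁻ x, ‖g x‖ₑ * ‖z x‖ₑ ∂μ ≤ eLpNorm g 2 μ * eLpNorm z 2 μ := by
  have h := ENNReal.lintegral_mul_le_Lp_mul_Lq μ Real.HolderConjugate.two_two hg.enorm hz.enorm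
  rw [eLpNorm_eq_lintegral_rpow_enorm_toReal (by norm_num) (by norm_num),
    eLpNorm_eq_lintegral_rpow_enorm_toReal (by norm_num) (by norm_num)]
  simpa using h

theorem lintegral_mul_mul_le {A B C : α → ENNReal} (hA : AEMeasurable A μ) (hB : AEMeasurable B μ)
    (hC : AEMeasurable C μ) :
    ∫⁻ x, A x * B x * C x ∂μ ≤ (∫⁻ x, A x ^ (3 : ℝ) ∂μ) ^ (1 / 3 : ℝ)
      * (∫⁻ x, B x ^ (2 : ℝ) ∂μ) ^ (1 / 2 : ℝ) * (∫⁻ x, C x ^ (6 : ℝ) ∂μ) ^ (1 / 6 : ℝ) := by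
  have h := ENNReal.lintegral_prod_norm_pow_le (μ := μ) (Finset.univ : Finset (Fin 3))
    (f := ![fun x => A x ^ (3 : ℝ), fun x => B x ^ (2 : ℝ), fun x => C x ^ (6 : ℝ)])
    (p := ![1 / 3, 1 / 2, 1 / 6])
    (fun i _ => by fin_cases i <;> simp <;> fun_prop)
    (by simp [Fin.sum_univ_three]; norm_num)
    (fun i _ => by fin_cases i <;> simp)
  simp only [Fin.prod_univ_three, Matrix.cons_val_zero, Matrix.cons_val_one, Matrix.cons_val_two,
    Matrix.tail_cons, Matrix.head_cons, ← ENNReal.rpow_mul] at h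
  norm_num at h
  norm_num
  exact h

/-- Hölder with `1/3 + 1/2 + 1/6 = 1`, the power `n` being placed in `L³`. For `n = 2` the norm of
`γ` is the `L⁶` norm, the endpoint of the embedding of `H¹` in three dimensions. -/
theorem lintegral_enorm_pow_mul_mul_le {E F G : Type*} [NormedAddCommGroup E]
    [NormedAddCommGroup F] [NormedAddCommGroup G] {n : ℕ} (hn : 1 ≤ n)
    {γ : α → E} {g : α → F} {z : α → G} (hγ : AEStronglyMeasurable γ μ)
    (hg : AEStronglyMeasurable g μ) (hz : AEStronglyMeasurable z μ) :
    ∫⁻ x, ‖γ x‖ₑ ^ n * ‖g x‖ₑ * ‖z x‖ₑ ∂μ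
      ≤ eLpNorm γ (ENNReal.ofReal (3 * n)) μ ^ n * eLpNorm g 2 μ
        * eLpNorm z (ENNReal.ofReal 6) μ := by
  have hn0 : (0 : ℝ) < n := by exact_mod_cast hn
  have h := lintegral_mul_mul_le (μ := μ) (hγ.enorm.pow_const n) hg.enorm hz.enorm
  refine h.trans (le_of_eq ?_)
  have h3n : ENNReal.ofReal (3 * n) ≠ 0 := (ENNReal.ofReal_pos.2 (by positivity)).ne'
  rw [eLpNorm_eq_lintegral_rpow_enorm_toReal h3n ENNReal.ofReal_ne_top,
    eLpNorm_eq_lintegral_rpow_enorm_toReal (by norm_num) (by norm_num),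
    eLpNorm_eq_lintegral_rpow_enorm_toReal (by norm_num) ENNReal.ofReal_ne_top,
    ENNReal.toReal_ofReal (by positivity), ENNReal.toReal_ofReal (by norm_num), ENNReal.toReal_ofNat]
  congr 2
  rw [← ENNReal.rpow_natCast, ← ENNReal.rpow_mul]
  have e : ∀ x, (‖γ x‖ₑ ^ n) ^ (3 : ℝ) = ‖γ x‖ₑ ^ (3 * (n : ℝ)) := fun x => by
    rw [← ENNReal.rpow_natCast, ← ENNReal.rpow_mul, mul_comm]
  simp only [e]
  congr 1
  field_simp

/-- Only one factor of the superlinear term is split, as `g = g₁ + g₂`. The smooth part `g₁` takes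
the `L⁶` norm and leaves `z` in `L²`; the rough part `g₂` is kept in `L²` and pushes `z` into `L⁶`.
The powers of `γ` and `g` use `L^(3n)` and will be small. -/
theorem norm_integral_mul_conj_le {E : Type*} [NormedAddCommGroup E] {n : ℕ} (hn : 1 ≤ n)
    {F ρ z : α → ℂ} {γ g g₁ g₂ : α → E} (hρ : AEStronglyMeasurable ρ μ)
    (hz : AEStronglyMeasurable z μ) (hγ : AEStronglyMeasurable γ μ) (hg : AEStronglyMeasurable g μ)
    (hg₁ : AEStronglyMeasurable g₁ μ) (hg₂ : AEStronglyMeasurable g₂ μ)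
    {K₀ K₁ Γ R R₀ G₀ G₁ G₂ Z₂ Z₆ : ℝ} (hK₀ : 0 ≤ K₀) (hK₁ : 0 ≤ K₁) (hΓ : 0 ≤ Γ) (hR : 0 ≤ R)
    (hR₀ : 0 ≤ R₀) (hG₀ : 0 ≤ G₀) (hG₁ : 0 ≤ G₁) (hG₂ : 0 ≤ G₂) (hZ₂ : 0 ≤ Z₂) (hZ₆ : 0 ≤ Z₆)
    (hF : ∀ᵐ x ∂μ, ‖F x‖ ≤ K₀ * (‖ρ x‖ + ‖g x‖) + K₁ * (‖γ x‖ ^ n + ‖g x‖ ^ n) * ‖g x‖)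
    (hgg : ∀ᵐ x ∂μ, g x = g₁ x + g₂ x)
    (bγ : eLpNorm γ (ENNReal.ofReal (3 * n)) μ ≤ ENNReal.ofReal Γ)
    (bg : eLpNorm g (ENNReal.ofReal (3 * n)) μ ≤ ENNReal.ofReal R)
    (bρ₂ : eLpNorm ρ 2 μ ≤ ENNReal.ofReal R₀) (bg₂ : eLpNorm g 2 μ ≤ ENNReal.ofReal G₀)
    (bg₁ : eLpNorm g₁ (ENNReal.ofReal 6) μ ≤ ENNReal.ofReal G₁)
    (bg₂' : eLpNorm g₂ 2 μ ≤ ENNReal.ofReal G₂)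
    (bz₂ : eLpNorm z 2 μ ≤ ENNReal.ofReal Z₂)
    (bz₆ : eLpNorm z (ENNReal.ofReal 6) μ ≤ ENNReal.ofReal Z₆) :
    ‖∫ x, F x * conj (z x) ∂μ‖
      ≤ K₀ * (R₀ + G₀) * Z₂ + K₁ * (Γ ^ n + R ^ n) * (G₁ * Z₂ + G₂ * Z₆) := by
  have t0 : ∫⁻ x, ‖ρ x‖ₑ * ‖z x‖ₑ ∂μ ≤ ENNReal.ofReal (R₀ * Z₂) := by
    rw [ENNReal.ofReal_mul hR₀]
    exact (lintegral_enorm_mul_enorm_le hρ hz).trans (mul_le_mul' bρ₂ bz₂)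
  have t0' : ∫⁻ x, ‖g x‖ₑ * ‖z x‖ₑ ∂μ ≤ ENNReal.ofReal (G₀ * Z₂) := by
    rw [ENNReal.ofReal_mul hG₀]
    exact (lintegral_enorm_mul_enorm_le hg hz).trans (mul_le_mul' bg₂ bz₂)
  have t1 : ∀ {h : α → E} {P : ℝ}, AEStronglyMeasurable h μ →
      eLpNorm h (ENNReal.ofReal (3 * n)) μ ≤ ENNReal.ofReal P → 0 ≤ P →
      ∫⁻ x, ‖h x‖ₑ ^ n * ‖z x‖ₑ * ‖g₁ x‖ₑ ∂μ ≤ ENNReal.ofReal (P ^ n * Z₂ * G₁) := by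
    intro h P hh hP hP0
    rw [ENNReal.ofReal_mul (by positivity), ENNReal.ofReal_mul (by positivity),
      ENNReal.ofReal_pow hP0]
    refine (lintegral_enorm_pow_mul_mul_le hn hh hz hg₁).trans ?_
    gcongr
  have t2 : ∀ {h : α → E} {P : ℝ}, AEStronglyMeasurable h μ →
      eLpNorm h (ENNReal.ofReal (3 * n)) μ ≤ ENNReal.ofReal P → 0 ≤ P →
      ∫⁻ x, ‖h x‖ₑ ^ n * ‖g₂ x‖ₑ * ‖z x‖ₑ ∂μ ≤ ENNReal.ofReal (P ^ n * G₂ * Z₆) := by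
    intro h P hh hP hP0
    rw [ENNReal.ofReal_mul (by positivity), ENNReal.ofReal_mul (by positivity),
      ENNReal.ofReal_pow hP0]
    refine (lintegral_enorm_pow_mul_mul_le hn hh hg₂ hz).trans ?_
    gcongr
  have hpt : ∀ᵐ x ∂μ, ENNReal.ofReal ‖F x * conj (z x)‖
      ≤ ENNReal.ofReal K₀ * (‖ρ x‖ₑ * ‖z x‖ₑ + ‖g x‖ₑ * ‖z x‖ₑ)
        + ENNReal.ofReal K₁ * ((‖γ x‖ₑ ^ n * ‖z x‖ₑ * ‖g₁ x‖ₑ + ‖γ x‖ₑ ^ n * ‖g₂ x‖ₑ * ‖z x‖ₑ)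
          + (‖g x‖ₑ ^ n * ‖z x‖ₑ * ‖g₁ x‖ₑ + ‖g x‖ₑ ^ n * ‖g₂ x‖ₑ * ‖z x‖ₑ)) := by
    filter_upwards [hF, hgg] with x h1 h2
    simp only [← ofReal_norm]
    have h3 : ‖g x‖ ≤ ‖g₁ x‖ + ‖g₂ x‖ := by rw [h2]; exact norm_add_le _ _
    simp only [← ENNReal.ofReal_pow (norm_nonneg _)]
    have e : ∀ {p q : ℝ}, 0 ≤ p → 0 ≤ q →
      ENNReal.ofReal p * ENNReal.ofReal q = ENNReal.ofReal (p * q) := fun hp _ =>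
        (ENNReal.ofReal_mul hp).symm
    have e' : ∀ {p q : ℝ}, 0 ≤ p → 0 ≤ q →
      ENNReal.ofReal p + ENNReal.ofReal q = ENNReal.ofReal (p + q) := fun hp hq =>
        (ENNReal.ofReal_add hp hq).symm
    -- Folds the right-hand side into a single `ENNReal.ofReal`, so that the inequality can be
    -- checked between real numbers.
    repeat (first
      | rw [e (by positivity) (by positivity)]
      | rw [e' (by positivity) (by positivity)])
    refine ENNReal.ofReal_le_ofReal ?_
    rw [norm_mul, RCLike.norm_conj]
    calc ‖F x‖ * ‖z x‖
        ≤ (K₀ * (‖ρ x‖ + ‖g x‖) + K₁ * (‖γ x‖ ^ n + ‖g x‖ ^ n) * (‖g₁ x‖ + ‖g₂ x‖)) * ‖z x‖ := by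
          refine mul_le_mul_of_nonneg_right (h1.trans ?_) (norm_nonneg _)
          gcongr
      _ = _ := by ring
  refine (norm_integral_le_lintegral_norm _).trans ?_
  refine ENNReal.toReal_le_of_le_ofReal (by positivity) ?_
  have m1 : AEMeasurable (fun x => ‖ρ x‖ₑ * ‖z x‖ₑ) μ := hρ.enorm.mul hz.enorm
  have m2 : AEMeasurable (fun x => ‖g x‖ₑ * ‖z x‖ₑ) μ := hg.enorm.mul hz.enorm
  have m3 : ∀ {h : α → E}, AEStronglyMeasurable h μ →
      AEMeasurable (fun x => ‖h x‖ₑ ^ n * ‖z x‖ₑ * ‖g₁ x‖ₑ) μ :=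
    fun hh => ((hh.enorm.pow_const n).mul hz.enorm).mul hg₁.enorm
  have m4 : ∀ {h : α → E}, AEStronglyMeasurable h μ →
      AEMeasurable (fun x => ‖h x‖ₑ ^ n * ‖g₂ x‖ₑ * ‖z x‖ₑ) μ :=
    fun hh => ((hh.enorm.pow_const n).mul hg₂.enorm).mul hz.enorm
  have m12 : AEMeasurable (fun x => ENNReal.ofReal K₀ * (‖ρ x‖ₑ * ‖z x‖ₑ + ‖g x‖ₑ * ‖z x‖ₑ)) μ :=
    (m1.add m2).const_mul _
  have m34 : AEMeasurable
      (fun x => ‖γ x‖ₑ ^ n * ‖z x‖ₑ * ‖g₁ x‖ₑ + ‖γ x‖ₑ ^ n * ‖g₂ x‖ₑ * ‖z x‖ₑ) μ :=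
    (m3 hγ).add (m4 hγ)
  refine (lintegral_mono_ae hpt).trans ?_
  rw [lintegral_add_left' m12, lintegral_const_mul' _ _ ENNReal.ofReal_ne_top,
    lintegral_const_mul' _ _ ENNReal.ofReal_ne_top, lintegral_add_left' m1,
    lintegral_add_left' m34, lintegral_add_left' (m3 hγ), lintegral_add_left' (m3 hg)]
  calc _ ≤ ENNReal.ofReal K₀ * (ENNReal.ofReal (R₀ * Z₂) + ENNReal.ofReal (G₀ * Z₂))
        + ENNReal.ofReal K₁ * ((ENNReal.ofReal (Γ ^ n * Z₂ * G₁) + ENNReal.ofReal (Γ ^ n * G₂ * Z₆))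
          + (ENNReal.ofReal (R ^ n * Z₂ * G₁) + ENNReal.ofReal (R ^ n * G₂ * Z₆))) := by
        refine add_le_add (mul_le_mul_right (add_le_add ?_ ?_) _) (mul_le_mul_right
          (add_le_add (add_le_add ?_ ?_) (add_le_add ?_ ?_)) _)
        · exact t0
        · exact t0'
        · exact t1 hγ bγ hΓ
        · exact t2 hγ bγ hΓ
        · exact t1 hg bg hR
        · exact t2 hg bg hR
    _ = _ := by
        rw [← ENNReal.ofReal_add (by positivity) (by positivity),
          ← ENNReal.ofReal_add (by positivity) (by positivity),
          ← ENNReal.ofReal_add (by positivity) (by positivity),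
          ← ENNReal.ofReal_add (by positivity) (by positivity),
          ← ENNReal.ofReal_mul hK₀, ← ENNReal.ofReal_mul hK₁,
          ← ENNReal.ofReal_add (by positivity) (by positivity)]
        congr 1
        ring

end Holder

/-! ### Gradients in `L^q` -/

theorem MemHp.mono {a b : Fin d → ℝ} {s s' : ℕ} {v : L2 a b} (h : MemHp s v) (hs : s' ≤ s) :
    MemHp s' v := fun α hα => h α (hα.trans hs)

theorem aestronglyMeasurable_gradient {a b : Fin d → ℝ} (v : L2 a b) :
    AEStronglyMeasurable (gradient v) (boxMeasure a b) := by
  have h : AEStronglyMeasurable (fun x i => weakDeriv (Pi.single i 1) v x) (boxMeasure a b) :=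
    (aemeasurable_pi_lambda _ fun i =>
      (Lp.aestronglyMeasurable (weakDeriv (Pi.single i 1) v)).aemeasurable).aestronglyMeasurable
  exact (PiLp.continuous_toLp 2 fun _ : Fin d => ℂ).comp_aestronglyMeasurable h

theorem norm_toLp_le_sum (g : Fin d → ℂ) :
    ‖(WithLp.toLp 2 g : EuclideanSpace ℂ (Fin d))‖ ≤ ∑ i, ‖g i‖ := by
  rw [EuclideanSpace.norm_eq]
  refine Real.sqrt_le_iff.2 ⟨Finset.sum_nonneg fun _ _ => norm_nonneg _, ?_⟩
  exact Finset.sum_sq_le_sq_sum_of_nonneg fun _ _ => norm_nonneg _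

theorem eLpNorm_gradient_le {a b : Fin d → ℝ} (v : L2 a b) {p : ENNReal} (hp : 1 ≤ p) :
    eLpNorm (gradient v) p (boxMeasure a b)
      ≤ ∑ i, eLpNorm (weakDeriv (Pi.single i 1) v) p (boxMeasure a b) := by
  have h1 : eLpNorm (gradient v) p (boxMeasure a b)
      ≤ eLpNorm (∑ i, fun x => ‖weakDeriv (Pi.single i 1) v x‖) p (boxMeasure a b) := by
    refine eLpNorm_mono_real fun x => ?_
    rw [Finset.sum_apply]
    exact norm_toLp_le_sum _
  refine h1.trans ((eLpNorm_sum_le (fun i _ => (Lp.aestronglyMeasurable _).norm) hp).trans ?_)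
  exact Finset.sum_le_sum fun i _ => (eLpNorm_norm _).le

theorem eLpNorm_two_eq {a b : Fin d → ℝ} (v : L2 a b) :
    eLpNorm v 2 (boxMeasure a b) = ENNReal.ofReal ‖v‖ := by
  rw [Lp.norm_def, ENNReal.ofReal_toReal (Lp.eLpNorm_ne_top _)]

theorem exists_eLpNorm_gradient_two_le {a b : Fin d → ℝ} (hab : ∀ i, a i < b i) :
    ∃ C : ℝ, 0 < C ∧ ∀ (v : L2 a b) (B : ℝ), 0 ≤ B → MemHp 1 v → HBound 1 v B →
      eLpNorm (gradient v) 2 (boxMeasure a b) ≤ ENNReal.ofReal (C * B) := by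
  obtain ⟨C, hC, h⟩ := exists_hBound_weakDeriv hab
  refine ⟨(d + 1) * C ^ 1, by positivity, fun v B hB hv hvB => ?_⟩
  refine (eLpNorm_gradient_le v (by norm_num)).trans ?_
  calc ∑ i, eLpNorm (weakDeriv (Pi.single i 1) v) 2 (boxMeasure a b)
      ≤ ∑ _i : Fin d, ENNReal.ofReal (C ^ 1 * B) := by
        refine Finset.sum_le_sum fun i _ => ?_
        rw [eLpNorm_two_eq]
        refine ENNReal.ofReal_le_ofReal ?_
        exact (h 1 0 _ v _ B hB (sum_single_eq i 1)
          (hv.hasWeakDeriv (sum_single_eq i 1).le) hvB).norm_le hab (by positivity)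
    _ = ENNReal.ofReal (d * (C ^ 1 * B)) := by
        rw [Finset.sum_const, Finset.card_univ, Fintype.card_fin, nsmul_eq_mul,
          ENNReal.ofReal_mul (Nat.cast_nonneg d), ENNReal.ofReal_natCast]
    _ ≤ _ := by
        refine ENNReal.ofReal_le_ofReal ?_
        rw [mul_assoc]
        have : 0 ≤ C ^ 1 * B := by positivity
        nlinarith

theorem exists_eLpNorm_gradient_le {a b : Fin d → ℝ} (hab : ∀ i, a i < b i) (hd : 1 ≤ d) {q : ℝ}
    (hq : 6 ≤ q) (hdq : (d : ℝ) - 4 / (q - 2) ≤ 2) :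
    ∃ C : ℝ, 0 < C ∧ ∀ (v : L2 a b) (B : ℝ), 0 ≤ B → MemHp 1 v → HBound 2 v B →
      eLpNorm (gradient v) (ENNReal.ofReal q) (boxMeasure a b) ≤ ENNReal.ofReal (C * B) := by
  obtain ⟨C, hC, h⟩ := exists_hBound_weakDeriv hab
  obtain ⟨C', hC', h'⟩ := exists_eLpNorm_le hab hd hq hdq
  refine ⟨(d + 1) * (C' * C ^ 1), by positivity, fun v B hB hv hvB => ?_⟩
  refine (eLpNorm_gradient_le v ?_).trans ?_
  · rw [← ENNReal.ofReal_one]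
    exact ENNReal.ofReal_le_ofReal (by linarith)
  calc ∑ i, eLpNorm (weakDeriv (Pi.single i 1) v) (ENNReal.ofReal q) (boxMeasure a b)
      ≤ ∑ _i : Fin d, ENNReal.ofReal (C' * (C ^ 1 * B)) := by
        refine Finset.sum_le_sum fun i _ => ?_
        exact h' _ _ (by positivity) (h 1 1 _ v _ B hB (sum_single_eq i 1)
          (hv.hasWeakDeriv (sum_single_eq i 1).le) hvB)
    _ = ENNReal.ofReal (d * (C' * (C ^ 1 * B))) := by
        rw [Finset.sum_const, Finset.card_univ, Fintype.card_fin, nsmul_eq_mul,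
          ENNReal.ofReal_mul (Nat.cast_nonneg d), ENNReal.ofReal_natCast]
    _ ≤ _ := by
        refine ENNReal.ofReal_le_ofReal ?_
        have : 0 ≤ C' * (C ^ 1 * B) := by positivity
        nlinarith

theorem gradient_sub {a b : Fin d → ℝ} (hab : ∀ i, a i < b i) {v w : L2 a b} (hv : MemHp 1 v)
    (hw : MemHp 1 w) :
    ∀ᵐ x ∂(boxMeasure a b), gradient (v - w) x = gradient v x - gradient w x := by
  have h : ∀ᵐ x ∂(boxMeasure a b), ∀ i : Fin d, weakDeriv (Pi.single i 1) (v - w) x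
      = weakDeriv (Pi.single i 1) v x - weakDeriv (Pi.single i 1) w x := by
    refine ae_all_iff.2 fun i => ?_
    rw [hv.weakDeriv_sub hab hw (sum_single_eq i 1).le]
    exact Lp.coeFn_sub _ _
  filter_upwards [h] with x hx
  ext i
  simp only [gradient, hx, PiLp.sub_apply]

/-- The gradient of a trigonometric polynomial, as a function. -/
def trigGrad (a b : Fin d → ℝ) (S : Finset (Fin d → ℤ)) (c : (Fin d → ℤ) → ℂ)
    (x : Fin d → ℝ) : EuclideanSpace ℂ (Fin d) :=
  WithLp.toLp 2 fun i => trigFun a b S (fun k => symbol a b (Pi.single i 1) k * c k) x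

theorem gradient_trigPoly {a b : Fin d → ℝ} (hab : ∀ i, a i < b i) (S : Finset (Fin d → ℤ))
    (c : (Fin d → ℤ) → ℂ) :
    gradient (trigPoly a b S c) =ᵐ[boxMeasure a b] trigGrad a b S c := by
  have h : ∀ᵐ x ∂(boxMeasure a b), ∀ i : Fin d, weakDeriv (Pi.single i 1) (trigPoly a b S c) x
      = trigFun a b S (fun k => symbol a b (Pi.single i 1) k * c k) x := by
    refine ae_all_iff.2 fun i => ?_
    rw [(hasWeakDeriv_trigPoly hab (Pi.single i 1) S c).weakDeriv_eq hab]
    exact trigPoly_ae_eq a b S _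
  filter_upwards [h] with x hx
  ext i
  simp only [gradient, trigGrad, hx]

theorem continuous_trigGrad (a b : Fin d → ℝ) (S : Finset (Fin d → ℤ)) (c : (Fin d → ℤ) → ℂ) :
    Continuous (trigGrad a b S c) :=
  (PiLp.continuous_toLp 2 fun _ : Fin d => ℂ).comp
    (continuous_pi fun _ => continuous_trigFun a b S _)

theorem norm_trigGrad_le (a b : Fin d → ℝ) (S : Finset (Fin d → ℤ)) (c : (Fin d → ℤ) → ℂ)
    (x : Fin d → ℝ) :
    ‖trigGrad a b S c x‖ ≤ (Real.sqrt (boxVolume a b))⁻¹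
      * ∑ i, ∑ k ∈ S, ‖symbol a b (Pi.single i 1) k‖ * ‖c k‖ := by
  refine (norm_toLp_le_sum _).trans ?_
  rw [Finset.mul_sum]
  refine Finset.sum_le_sum fun i _ => (norm_trigFun_le a b S _ x).trans (le_of_eq ?_)
  simp only [norm_mul]

/-! ### Pointwise growth of the nonlinearity -/

/-- `f(t, ·, ·)` is locally Lipschitz with constants growing like a power, uniformly in `t`. -/
def HasPowerGrowth (T : ℝ) (n : ℕ) (K : ℝ) (f : ℝ → ℂ → EuclideanSpace ℂ (Fin d) → ℂ) : Prop :=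
  ∀ t ∈ Icc 0 T, ∀ (ξ ξ' : ℂ) (η η' : EuclideanSpace ℂ (Fin d)) (X Y : ℝ),
    ‖ξ‖ ≤ X → ‖ξ'‖ ≤ X → ‖η‖ ≤ Y → ‖η'‖ ≤ Y →
    ‖f t ξ η - f t ξ' η'‖ ≤ K * (1 + X ^ n) * ‖ξ - ξ'‖ + K * (1 + Y ^ n) * ‖η - η'‖

/-- The mean value inequality is applied on a ball first in `ξ`, then in `η`; each derivative bound
involves only the variable being moved. The real power `p` is replaced by a natural one through `x ^
p ≤ 1 + X ^ n`. -/
theorem IsMildNonlinearity.exists_hasPowerGrowth {T p : ℝ}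
    {f : ℝ → ℂ → EuclideanSpace ℂ (Fin d) → ℂ} (hf : IsMildNonlinearity T p f) (hp : 0 < p) {n : ℕ}
    (hn : p ≤ n) : ∃ K : ℝ, 0 ≤ K ∧ HasPowerGrowth T n K f := by
  obtain ⟨K, hK⟩ := hf.growth
  refine ⟨2 * |K|, by positivity, fun t ht ξ ξ' η η' X Y hξ hξ' hη hη' => ?_⟩
  have hpow : ∀ x X : ℝ, 0 ≤ x → x ≤ X → K * (1 + x ^ p) ≤ 2 * |K| * (1 + X ^ n) := by
    intro x X hx hxX
    have hX : 0 ≤ X := hx.trans hxX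
    have h1 : x ^ p ≤ 1 + X ^ n := by
      refine (Real.rpow_le_rpow hx hxX hp.le).trans ?_
      rcases le_total X 1 with h | h
      · have h2 := Real.rpow_le_one hX h hp.le
        have : 0 ≤ X ^ n := by positivity
        linarith
      · have := Real.rpow_le_rpow_of_exponent_le h hn
        rw [Real.rpow_natCast] at this
        linarith
    have h2 : 0 ≤ X ^ n := by positivity
    calc K * (1 + x ^ p) ≤ |K| * (1 + x ^ p) :=
          mul_le_mul_of_nonneg_right (le_abs_self K) (by positivity)
      _ ≤ |K| * (2 * (1 + X ^ n)) := mul_le_mul_of_nonneg_left (by linarith) (abs_nonneg K)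
      _ = _ := by ring
  have hsm := hf.smooth.differentiable one_ne_zero
  have d1 : Differentiable ℝ fun ξ => f t ξ η := by
    have : (fun ξ => f t ξ η) = (fun z : ℝ × ℂ × EuclideanSpace ℂ (Fin d) => f z.1 z.2.1 z.2.2)
        ∘ fun ξ => (t, ξ, η) := rfl
    rw [this]
    exact hsm.comp (by fun_prop)
  have d2 : Differentiable ℝ fun η => f t ξ' η := by
    have : (fun η => f t ξ' η) = (fun z : ℝ × ℂ × EuclideanSpace ℂ (Fin d) => f z.1 z.2.1 z.2.2)
        ∘ fun η => (t, ξ', η) := rfl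
    rw [this]
    exact hsm.comp (by fun_prop)
  have b1 := (convex_closedBall (0 : ℂ) X).norm_image_sub_le_of_norm_fderiv_le
    (f := fun ξ => f t ξ η) (C := 2 * |K| * (1 + X ^ n)) (𝕜 := ℝ) (fun z _ => d1 z)
    (fun z hz => ((hK t ht z η).1).trans (hpow _ _ (norm_nonneg _) (mem_closedBall_zero_iff.1 hz)))
    (mem_closedBall_zero_iff.2 hξ') (mem_closedBall_zero_iff.2 hξ)
  have b2 := (convex_closedBall (0 : EuclideanSpace ℂ (Fin d)) Y).norm_image_sub_le_of_norm_fderiv_le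
    (f := fun η => f t ξ' η) (C := 2 * |K| * (1 + Y ^ n)) (𝕜 := ℝ) (fun z _ => d2 z)
    (fun z hz => ((hK t ht ξ' z).2).trans (hpow _ _ (norm_nonneg _) (mem_closedBall_zero_iff.1 hz)))
    (mem_closedBall_zero_iff.2 hη') (mem_closedBall_zero_iff.2 hη)
  calc ‖f t ξ η - f t ξ' η'‖ = ‖(f t ξ η - f t ξ' η) + (f t ξ' η - f t ξ' η')‖ := by
        rw [sub_add_sub_cancel]
    _ ≤ _ := (norm_add_le _ _).trans (add_le_add b1 b2)

theorem add_add_pow_le {x y z : ℝ} (hx : 0 ≤ x) (hy : 0 ≤ y) (hz : 0 ≤ z) (n : ℕ) :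
    (x + y + z) ^ n ≤ 3 ^ n * (x ^ n + y ^ n + z ^ n) := by
  obtain ⟨w, hw, hxw, hyw, hzw, hle⟩ : ∃ w, 0 ≤ w ∧ x ≤ w ∧ y ≤ w ∧ z ≤ w ∧
      w ^ n ≤ x ^ n + y ^ n + z ^ n := by
    have h1 : 0 ≤ x ^ n := by positivity
    have h2 : 0 ≤ y ^ n := by positivity
    have h3 : 0 ≤ z ^ n := by positivity
    rcases le_total x y with hxy | hxy
    · rcases le_total y z with hyz | hyz
      · exact ⟨z, hz, hxy.trans hyz, hyz, le_rfl, by linarith⟩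
      · exact ⟨y, hy, hxy, le_rfl, hyz, by linarith⟩
    · rcases le_total x z with hxz | hxz
      · exact ⟨z, hz, hxz, hxy.trans hxz, le_rfl, by linarith⟩
      · exact ⟨x, hx, le_rfl, hxy, hxz, by linarith⟩
  calc (x + y + z) ^ n ≤ (3 * w) ^ n := pow_le_pow_left₀ (by positivity) (by linarith) n
    _ = 3 ^ n * w ^ n := mul_pow _ _ _
    _ ≤ _ := mul_le_mul_of_nonneg_left hle (by positivity)

/-- Both gradients have norm at most `R + ‖γ‖ + ‖g‖`. The bounded part `r` of `η` is absorbed into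
the linear term, so the superlinear coefficient contains only `γ` and `g`, the two quantities that
will be small. -/
theorem HasPowerGrowth.norm_sub_le {T K : ℝ} {n : ℕ} {f : ℝ → ℂ → EuclideanSpace ℂ (Fin d) → ℂ}
    (hf : HasPowerGrowth T n K f) (hK : 0 ≤ K) {t : ℝ} (ht : t ∈ Icc 0 T) {ξ ξ' : ℂ}
    {η η' r γ g : EuclideanSpace ℂ (Fin d)} {A R : ℝ} (hA : 0 ≤ A) (hξ : ‖ξ‖ ≤ A) (hξ' : ‖ξ'‖ ≤ A)
    (hη : η = r + γ) (hg : g = η - η') (hr : ‖r‖ ≤ R) :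
    ‖f t ξ η - f t ξ' η'‖ ≤ K * (1 + A ^ n + 3 ^ n * R ^ n) * (‖ξ - ξ'‖ + ‖g‖)
      + K * 3 ^ n * (‖γ‖ ^ n + ‖g‖ ^ n) * ‖g‖ := by
  have hR : 0 ≤ R := (norm_nonneg _).trans hr
  have h1 : ‖η‖ ≤ R + ‖γ‖ + ‖g‖ := by
    rw [hη]
    have := norm_add_le r γ
    have := norm_nonneg g
    linarith
  have h2 : ‖η'‖ ≤ R + ‖γ‖ + ‖g‖ := by
    have e : η' = r + γ - g := by rw [hg, hη]; abel
    rw [e]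
    have := _root_.norm_sub_le (r + γ) g
    have := norm_add_le r γ
    linarith
  have h := hf t ht ξ ξ' η η' A _ hξ hξ' h1 h2
  rw [← hg] at h
  have h3 := add_add_pow_le hR (norm_nonneg γ) (norm_nonneg g) n
  have hAn : 0 ≤ A ^ n := by positivity
  have hRn : 0 ≤ 3 ^ n * R ^ n := by positivity
  calc _ ≤ _ := h
    _ ≤ K * (1 + A ^ n + 3 ^ n * R ^ n) * ‖ξ - ξ'‖
        + K * (1 + A ^ n + (3 ^ n * (R ^ n + ‖γ‖ ^ n + ‖g‖ ^ n))) * ‖g‖ := by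
        refine add_le_add (mul_le_mul_of_nonneg_right (mul_le_mul_of_nonneg_left (by linarith) hK)
          (norm_nonneg _)) (mul_le_mul_of_nonneg_right (mul_le_mul_of_nonneg_left (by linarith) hK)
          (norm_nonneg _))
    _ = _ := by ring

/-! ### The exact and the Galerkin equation for Fourier coefficients -/

/-- The composed nonlinearity `x ↦ f(t, v(x), ∇v(x))`. -/
def nonlinearity {a b : Fin d → ℝ} (f : ℝ → ℂ → EuclideanSpace ℂ (Fin d) → ℂ) (t : ℝ) (v : L2 a b)
    (x : Fin d → ℝ) : ℂ :=
  f t (v x) (gradient v x)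

theorem coeff_laplacian {a b : Fin d → ℝ} (hab : ∀ i, a i < b i) {v : L2 a b} (hv : MemHp 2 v)
    (k : Fin d → ℤ) : coeff k (laplacian v) = -(eigenvalue a b k : ℂ) * coeff k v := by
  rw [laplacian, map_sum, eigenvalue, Complex.ofReal_sum, ← Finset.sum_neg_distrib, Finset.sum_mul]
  refine Finset.sum_congr rfl fun i _ => ?_
  rw [hv.coeff_weakDeriv hab (sum_single_eq i 2).le, symbol_single, mul_pow, Complex.I_sq]
  push_cast
  ring

theorem coeff_toLp {a b : Fin d → ℝ} {g : (Fin d → ℝ) → ℂ} (hg : MemLp g 2 (boxMeasure a b))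
    (k : Fin d → ℤ) :
    coeff k (hg.toLp g) = ∫ x, g x * conj (modeFun a b k x) ∂(boxMeasure a b) := by
  rw [coeff_eq_integral]
  refine integral_congr_ae ?_
  filter_upwards [hg.coeFn_toLp] with x hx
  rw [hx]

theorem inner_trigPoly {a b : Fin d → ℝ} (S : Finset (Fin d → ℤ)) (c : (Fin d → ℤ) → ℂ)
    (v : L2 a b) : inner ℂ (trigPoly a b S c) v = ∑ k ∈ S, conj (c k) * coeff k v := by
  rw [trigPoly, sum_inner]
  refine Finset.sum_congr rfl fun k _ => ?_
  rw [inner_smul_left, coeff_apply]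

/-- The equation itself exhibits the nonlinearity as a difference of `L²` functions, so its
coefficients make sense without any growth estimate. -/
theorem IsExactSolution.exists_hasDerivWithinAt {a b : Fin d → ℝ} (hab : ∀ i, a i < b i) {T : ℝ}
    {f : ℝ → ℂ → EuclideanSpace ℂ (Fin d) → ℂ} {u₀ : L2 a b} {u : ℝ → L2 a b}
    (hu : IsExactSolution T f u₀ u) {t : ℝ} (ht : t ∈ Icc 0 T) :
    ∃ hF : MemLp (nonlinearity f t (u t)) 2 (boxMeasure a b), ∃ u' : L2 a b,
      HasDerivWithinAt u u' (Icc 0 T) t ∧ ∀ k, coeff k u'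
        = -(eigenvalue a b k : ℂ) * coeff k (u t) + coeff k (hF.toLp _) := by
  obtain ⟨u', hd, he⟩ := hu.equation t ht
  have hae : (u' - laplacian (u t) : L2 a b) =ᵐ[boxMeasure a b] nonlinearity f t (u t) := by
    filter_upwards [Lp.coeFn_sub u' (laplacian (u t)), he] with x h1 h2
    rw [h1, Pi.sub_apply, h2, nonlinearity]
    ring
  have hF : MemLp (nonlinearity f t (u t)) 2 (boxMeasure a b) := (Lp.memLp _).ae_eq hae
  refine ⟨hF, u', hd, fun k => ?_⟩
  have h3 : hF.toLp _ = u' - laplacian (u t) :=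
    Lp.ext (hF.coeFn_toLp.trans hae.symm)
  rw [h3, map_sub, coeff_laplacian hab (hu.mem t ht)]
  ring

theorem pairing_eq_inner {a b : Fin d → ℝ} {g : (Fin d → ℝ) → ℂ} {w : L2 a b}
    (h : g =ᵐ[boxMeasure a b] w) (v : L2 a b) : pairing a b g v = inner ℂ v w := by
  rw [pairing, inner_eq_integral]
  refine integral_congr_ae ?_
  filter_upwards [h] with x hx
  rw [hx]

theorem energyForm_eq_sum_inner {a b : Fin d → ℝ} (w v : L2 a b) :
    energyForm w v = ∑ i, inner ℂ (weakDeriv (Pi.single i 1) v) (weakDeriv (Pi.single i 1) w) := by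
  rw [energyForm]
  simp only [gradient, inner_eq_integral]
  rw [integral_finsetSum]
  intro i _
  have h := L2.integrable_inner (𝕜 := ℂ) (weakDeriv (Pi.single i 1) v) (weakDeriv (Pi.single i 1) w)
  simpa only [RCLike.inner_apply] using h

theorem energyForm_trigPoly {a b : Fin d → ℝ} (hab : ∀ i, a i < b i) {w : L2 a b}
    (hw : MemHp 1 w) (S : Finset (Fin d → ℤ)) (c : (Fin d → ℤ) → ℂ) :
    energyForm w (trigPoly a b S c)
      = ∑ k ∈ S, conj (c k) * ((eigenvalue a b k : ℂ) * coeff k w) := by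
  rw [energyForm_eq_sum_inner]
  have h1 : ∀ i : Fin d, inner ℂ (weakDeriv (Pi.single i 1) (trigPoly a b S c))
      (weakDeriv (Pi.single i 1) w)
      = ∑ k ∈ S, conj (c k) * (((angFreq a b k i ^ 2 : ℝ) : ℂ) * coeff k w) := by
    intro i
    rw [(hasWeakDeriv_trigPoly hab _ S c).weakDeriv_eq hab, inner_trigPoly]
    refine Finset.sum_congr rfl fun k _ => ?_
    rw [hw.coeff_weakDeriv hab (sum_single_eq i 1).le, symbol_single, pow_one]
    simp only [map_mul, Complex.conj_I, Complex.conj_ofReal]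
    push_cast
    linear_combination (-(angFreq a b k i : ℂ) ^ 2 * conj (c k) * coeff k w) * Complex.I_sq
  simp only [h1]
  rw [Finset.sum_comm]
  refine Finset.sum_congr rfl fun k _ => ?_
  rw [← Finset.mul_sum, ← Finset.sum_mul, eigenvalue, Complex.ofReal_sum]

theorem memLp_nonlinearity_trigPoly {a b : Fin d → ℝ} (hab : ∀ i, a i < b i)
    {f : ℝ → ℂ → EuclideanSpace ℂ (Fin d) → ℂ}
    (hf : Continuous fun z : ℝ × ℂ × EuclideanSpace ℂ (Fin d) => f z.1 z.2.1 z.2.2) (t : ℝ)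
    (S : Finset (Fin d → ℤ)) (c : (Fin d → ℤ) → ℂ) :
    nonlinearity f t (trigPoly a b S c) =ᵐ[boxMeasure a b]
        (fun x => f t (trigFun a b S c x) (trigGrad a b S c x)) ∧
      MemLp (nonlinearity f t (trigPoly a b S c)) 2 (boxMeasure a b) := by
  have hae : nonlinearity f t (trigPoly a b S c) =ᵐ[boxMeasure a b]
        (fun x => f t (trigFun a b S c x) (trigGrad a b S c x)) := by
    filter_upwards [trigPoly_ae_eq a b S c, gradient_trigPoly hab S c] with x h1 h2
    rw [nonlinearity, h1, h2]
  refine ⟨hae, MemLp.ae_eq hae.symm ?_⟩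
  have hc : Continuous fun x => f t (trigFun a b S c x) (trigGrad a b S c x) :=
    hf.comp (continuous_const.prodMk
      ((continuous_trigFun a b S c).prodMk (continuous_trigGrad a b S c)))
  obtain ⟨C, hC⟩ := (isCompact_Icc (a := a) (b := b)).exists_bound_of_continuousOn hc.continuousOn
  refine MemLp.of_bound (C := C) hc.aestronglyMeasurable ?_
  have hbox : MeasurableSet (box a b) := MeasurableSet.univ_pi fun i => measurableSet_Ioo
  refine (ae_restrict_iff' hbox).2 (Filter.Eventually.of_forall fun x hx => hC x ?_)
  exact ⟨fun i => (hx i (mem_univ i)).1.le, fun i => (hx i (mem_univ i)).2.le⟩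

theorem eq_trigPoly_of_mem_XN {a b : Fin d → ℝ} (hab : ∀ i, a i < b i) {Nn : Fin d → ℕ}
    {v : L2 a b} (hv : v ∈ XN a b Nn) :
    v = trigPoly a b (frequencies Nn) fun k => coeff k v :=
  eq_trigPoly_of_coeff_eq_zero hab fun _ hk => coeff_eq_zero_of_mem_XN hab hv hk

theorem memLp_nonlinearity_of_mem_XN {a b : Fin d → ℝ} (hab : ∀ i, a i < b i)
    {f : ℝ → ℂ → EuclideanSpace ℂ (Fin d) → ℂ}
    (hf : Continuous fun z : ℝ × ℂ × EuclideanSpace ℂ (Fin d) => f z.1 z.2.1 z.2.2) (t : ℝ)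
    {Nn : Fin d → ℕ} {v : L2 a b} (hv : v ∈ XN a b Nn) :
    MemLp (nonlinearity f t v) 2 (boxMeasure a b) := by
  rw [eq_trigPoly_of_mem_XN hab hv]
  exact (memLp_nonlinearity_trigPoly hab hf t _ _).2

/-- The weak Galerkin equation at one time is equivalent to a system for the Fourier coefficients. -/
theorem galerkin_equation_iff {a b : Fin d → ℝ} (hab : ∀ i, a i < b i) {Nn : Fin d → ℕ}
    {w w' : L2 a b} (hw : w ∈ XN a b Nn) {g : (Fin d → ℝ) → ℂ} (hg : MemLp g 2 (boxMeasure a b)) :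
    (∀ v ∈ XN a b Nn, pairing a b w' v + energyForm w v = pairing a b g v) ↔
      ∀ k ∈ frequencies Nn, coeff k w'
        = -(eigenvalue a b k : ℂ) * coeff k w + coeff k (hg.toLp g) := by
  have hw1 := memHp_of_mem_XN hab 1 hw
  constructor
  · intro h k hk
    have h1 := h (trigPoly a b {k} 1) (trigPoly_mem_XN hab Nn (by simpa using hk) _)
    rw [pairing_eq_inner (Filter.EventuallyEq.refl _ _), pairing_eq_inner hg.coeFn_toLp.symm,
      energyForm_trigPoly hab hw1, inner_trigPoly, inner_trigPoly] at h1
    simp only [Finset.sum_singleton, Pi.one_apply, map_one, one_mul] at h1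
    linear_combination h1
  · intro h v hv
    rw [eq_trigPoly_of_mem_XN hab hv, pairing_eq_inner (Filter.EventuallyEq.refl _ _),
      pairing_eq_inner hg.coeFn_toLp.symm, energyForm_trigPoly hab hw1, inner_trigPoly,
      inner_trigPoly, ← Finset.sum_add_distrib]
    refine Finset.sum_congr rfl fun k hk => ?_
    rw [h k hk]
    ring

/-! ### Uniform tails of the exact solution and the critical nonlinear estimate -/

/-- An `L²`-bounded continuous curve has uniformly small Fourier tails. -/
theorem exists_finset_tail_le {a b : Fin d → ℝ} (hab : ∀ i, a i < b i) {I : Set ℝ}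
    (hI : IsCompact I) {v : ℝ → L2 a b} (hv : ContinuousOn v I) {δ : ℝ} (hδ : 0 < δ) :
    ∃ S₀ : Finset (Fin d → ℤ), ∀ t ∈ I, ∀ S : Finset (Fin d → ℤ), Disjoint S S₀ →
      ∑ k ∈ S, ‖coeff k (v t)‖ ^ 2 ≤ δ := by
  classical
  -- A finite net of the compact image is used. Both the net radius squared and the tails at net
  -- points are `δ / 4`, because `‖x + y‖² ≤ 2‖x‖² + 2‖y‖²`.
  have hr : 0 < Real.sqrt (δ / 4) := Real.sqrt_pos.2 (by positivity)
  obtain ⟨P, hPsub, hPfin, hP⟩ := (hI.image_of_continuousOn hv).finite_cover_balls hr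
  have htail : ∀ x : L2 a b, ∃ S₀ : Finset (Fin d → ℤ), ∀ S : Finset (Fin d → ℤ), Disjoint S S₀ →
      ∑ k ∈ S, ‖coeff k x‖ ^ 2 ≤ δ / 4 := by
    intro x
    obtain ⟨S₀, hS₀⟩ := summable_iff_vanishing_norm.1 (hasSum_sq_norm_coeff hab x).summable (δ / 4)
      (by positivity)
    exact ⟨S₀, fun S hS => (le_abs_self _).trans (hS₀ S hS).le⟩
  choose σ hσ using htail
  refine ⟨hPfin.toFinset.biUnion σ, fun t ht S hS => ?_⟩
  obtain ⟨x, hx, hxt⟩ := mem_iUnion₂.1 (hP (mem_image_of_mem v ht))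
  have h1 : ∑ k ∈ S, ‖coeff k x‖ ^ 2 ≤ δ / 4 := by
    refine hσ x S (hS.mono_right ?_)
    exact Finset.subset_biUnion_of_mem σ (hPfin.mem_toFinset.2 hx)
  have h2 : ∑ k ∈ S, ‖coeff k (v t - x)‖ ^ 2 ≤ δ / 4 := by
    have h3 := hBound_zero_norm hab (v t - x) S
    simp only [pow_zero, one_mul] at h3
    refine h3.trans ?_
    rw [Metric.mem_ball, dist_eq_norm] at hxt
    have := pow_le_pow_left₀ (norm_nonneg _) hxt.le 2
    rwa [Real.sq_sqrt (by positivity)] at this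
  calc ∑ k ∈ S, ‖coeff k (v t)‖ ^ 2
      ≤ ∑ k ∈ S, (2 * ‖coeff k x‖ ^ 2 + 2 * ‖coeff k (v t - x)‖ ^ 2) := by
        refine Finset.sum_le_sum fun k _ => ?_
        have h4 : ‖coeff k (v t)‖ ≤ ‖coeff k x‖ + ‖coeff k (v t - x)‖ := by
          have := norm_add_le (coeff k x) (coeff k (v t - x))
          rwa [← map_add, add_sub_cancel] at this
        nlinarith [sq_nonneg (‖coeff k x‖ - ‖coeff k (v t - x)‖), norm_nonneg (coeff k (v t))]
    _ = 2 * ∑ k ∈ S, ‖coeff k x‖ ^ 2 + 2 * ∑ k ∈ S, ‖coeff k (v t - x)‖ ^ 2 := by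
        rw [Finset.sum_add_distrib, Finset.mul_sum, Finset.mul_sum]
    _ ≤ δ := by linarith

/-- An exact solution has uniformly small tails in `H²`. -/
theorem IsExactSolution.exists_finset_tail_le {a b : Fin d → ℝ} (hab : ∀ i, a i < b i) {T : ℝ}
    {f : ℝ → ℂ → EuclideanSpace ℂ (Fin d) → ℂ} {u₀ : L2 a b} {u : ℝ → L2 a b}
    (hu : IsExactSolution T f u₀ u) {δ : ℝ} (hδ : 0 < δ) :
    ∃ S₀ : Finset (Fin d → ℤ), ∀ t ∈ Icc 0 T, ∀ S : Finset (Fin d → ℤ), Disjoint S S₀ →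
      ∑ k ∈ S, weight k ^ 2 * ‖coeff k (u t)‖ ^ 2 ≤ δ := by
  classical
  -- The `H²` weight is controlled by `u` and its pure second derivatives, all continuous in time
  -- with values in `L²`; the tail lemma applies to each of them.
  obtain ⟨C, hC, hw⟩ := exists_weight_pow_le hab 2
  have hδ' : 0 < δ / (C * (d + 1)) := by positivity
  have h0 : ∑ i : Fin d, (0 : Fin d → ℕ) i ≤ 2 := by simp
  obtain ⟨σ₀, hσ₀⟩ := FourierGalerkin.exists_finset_tail_le hab isCompact_Icc (hu.cont 0 h0) hδ'
  have h1 : ∀ j : Fin d, ∃ S₀ : Finset (Fin d → ℤ), ∀ t ∈ Icc 0 T, ∀ S : Finset (Fin d → ℤ),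
      Disjoint S S₀ → ∑ k ∈ S, ‖coeff k (weakDeriv (Pi.single j 2) (u t))‖ ^ 2
        ≤ δ / (C * (d + 1)) := fun j =>
    FourierGalerkin.exists_finset_tail_le hab isCompact_Icc (hu.cont _ (sum_single_eq j 2).le) hδ'
  choose σ hσ using h1
  refine ⟨σ₀ ∪ Finset.univ.biUnion σ, fun t ht S hS => ?_⟩
  have b0 := hσ₀ t ht S (hS.mono_right Finset.subset_union_left)
  have b1 : ∀ j, _ := fun j => hσ j t ht S (hS.mono_right
    ((Finset.subset_biUnion_of_mem σ (Finset.mem_univ j)).trans Finset.subset_union_right))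
  simp only [(hu.mem t ht).coeff_weakDeriv hab h0, norm_mul, mul_pow] at b0
  simp only [fun j => (hu.mem t ht).coeff_weakDeriv hab (sum_single_eq j 2).le, norm_mul,
    mul_pow] at b1
  calc ∑ k ∈ S, weight k ^ 2 * ‖coeff k (u t)‖ ^ 2
      ≤ ∑ k ∈ S, C * (‖symbol a b 0 k‖ ^ 2 * ‖coeff k (u t)‖ ^ 2
          + ∑ j, ‖symbol a b (Pi.single j 2) k‖ ^ 2 * ‖coeff k (u t)‖ ^ 2) := by
        refine Finset.sum_le_sum fun k _ => ?_
        rw [← Finset.sum_mul, ← add_mul, ← mul_assoc]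
        exact mul_le_mul_of_nonneg_right (hw k) (sq_nonneg _)
    _ = C * (∑ k ∈ S, ‖symbol a b 0 k‖ ^ 2 * ‖coeff k (u t)‖ ^ 2
          + ∑ j, ∑ k ∈ S, ‖symbol a b (Pi.single j 2) k‖ ^ 2 * ‖coeff k (u t)‖ ^ 2) := by
        rw [← Finset.mul_sum, Finset.sum_add_distrib, Finset.sum_comm]
    _ ≤ C * (δ / (C * (d + 1)) + ∑ _j : Fin d, δ / (C * (d + 1))) :=
        mul_le_mul_of_nonneg_left (add_le_add b0 (Finset.sum_le_sum fun j _ => b1 j)) hC.le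
    _ = δ := by
        rw [Finset.sum_const, Finset.card_univ, Fintype.card_fin, nsmul_eq_mul]
        field_simp
        ring

theorem hBound_sub_trigPoly {a b : Fin d → ℝ} (hab : ∀ i, a i < b i) {s : ℕ} {v : L2 a b} {B : ℝ}
    (S₀ : Finset (Fin d → ℤ)) (h : ∀ S : Finset (Fin d → ℤ), Disjoint S S₀ →
      ∑ k ∈ S, weight k ^ s * ‖coeff k v‖ ^ 2 ≤ B ^ 2) :
    HBound s (v - trigPoly a b S₀ fun k => coeff k v) B := by
  classical
  intro S
  refine le_trans (le_of_eq ?_) (h (S \ S₀) Finset.sdiff_disjoint)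
  rw [Finset.sdiff_eq_filter, Finset.sum_filter]
  refine Finset.sum_congr rfl fun k _ => ?_
  rw [map_sub, coeff_trigPoly hab]
  by_cases hk : k ∈ S₀
  · simp [hk]
  · simp [hk]

theorem exists_pos_pow_le {n : ℕ} (hn : 1 ≤ n) {c ε : ℝ} (hc : 0 ≤ c) (hε : 0 < ε) :
    ∃ δ : ℝ, 0 < δ ∧ δ ≤ 1 ∧ c * δ ^ n ≤ ε := by
  refine ⟨min 1 (ε / (c + 1)), by positivity, min_le_left _ _, ?_⟩
  set δ := min 1 (ε / (c + 1))
  have h0 : 0 ≤ δ := by positivity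
  have h1 : δ ^ n ≤ δ := pow_le_of_le_one h0 (min_le_left _ _) (by omega)
  calc c * δ ^ n ≤ (c + 1) * δ := by
        have : 0 ≤ δ ^ n := by positivity
        nlinarith
    _ ≤ (c + 1) * (ε / (c + 1)) := mul_le_mul_of_nonneg_left (min_le_right _ _) (by positivity)
    _ = ε := by field_simp

/-- The critical estimate for the difference of the nonlinearities at the exact solution `u` and at
a nearby function `w`, with the increment split into a smooth and a rough part. -/
theorem exists_nonlinear_estimate {a b : Fin d → ℝ} (hab : ∀ i, a i < b i) (hd : 1 ≤ d)
    (hd3 : d ≤ 3) {T K M θ : ℝ} {n : ℕ} (hn : 2 ≤ n) (hdn : d = 3 → n = 2)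
    {f : ℝ → ℂ → EuclideanSpace ℂ (Fin d) → ℂ} (hK : 0 ≤ K) (hf : HasPowerGrowth T n K f)
    {u₀ : L2 a b} {u : ℝ → L2 a b} (hu : IsExactSolution T f u₀ u) (hM : 0 ≤ M)
    (huM : ∀ t ∈ Icc 0 T, HBound 2 (u t) M) (hθ : 0 < θ) :
    ∃ δ K₀ : ℝ, 0 < δ ∧ 0 ≤ K₀ ∧ ∀ t ∈ Icc 0 T, ∀ w ρ₁ z : L2 a b, MemHp 2 w → MemHp 2 ρ₁ →
      ∀ A P₁ P₂ Z₀ Z₁ : ℝ, 0 ≤ A → 0 ≤ P₁ → 0 ≤ P₂ → 0 ≤ Z₀ → 0 ≤ Z₁ →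
      HBound 2 (u t - w) δ → HBound 1 (u t - w) A → HBound 2 ρ₁ P₁ → HBound 1 (u t - w - ρ₁) P₂ →
      HBound 0 z Z₀ → HBound 1 z Z₁ →
      ‖∫ x, (nonlinearity f t (u t) x - nonlinearity f t w x) * conj (z x) ∂(boxMeasure a b)‖
        ≤ K₀ * A * Z₀ + θ * (P₁ * Z₀ + P₂ * Z₁) := by
  have hd3' : (d : ℝ) ≤ 3 := by exact_mod_cast hd3
  have hn' : (2 : ℝ) ≤ n := by exact_mod_cast hn
  -- The condition for the embedding with `q = 3 n`. For `d ≤ 2` there is room; for `d = 3`, `n = 2`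
  -- it is an equality.
  have hdq : (d : ℝ) - 4 / (3 * n - 2) ≤ 2 := by
    have h0 : 0 ≤ 4 / (3 * (n : ℝ) - 2) := div_nonneg (by norm_num) (by linarith)
    rcases Nat.lt_or_ge d 3 with h | h
    · have : (d : ℝ) ≤ 2 := by exact_mod_cast Nat.lt_succ_iff.1 h
      linarith
    · have h3 : d = 3 := le_antisymm hd3 h
      rw [hdn h3, h3]
      norm_num
  have hd6 : (d : ℝ) - 4 / (6 - 2) ≤ 2 := by norm_num; linarith
  obtain ⟨Cs, hCs, hsup⟩ := exists_ae_norm_le hab hd hd3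
  obtain ⟨C6, hC6, h6⟩ := exists_eLpNorm_le hab hd (le_refl 6) hd6
  obtain ⟨Cg6, hCg6, hg6⟩ := exists_eLpNorm_gradient_le hab hd (le_refl 6) hd6
  obtain ⟨Cgq, hCgq, hgq⟩ := exists_eLpNorm_gradient_le hab hd (q := 3 * n) (by linarith) hdq
  obtain ⟨Cg2, hCg2, hg2⟩ := exists_eLpNorm_gradient_two_le hab
  -- `δ` bounds in `H²` both the error and the high-frequency remainder of `u`; its `n`-th power
  -- brings the superlinear coefficient down to `θ`.
  obtain ⟨δ, hδ, hδ1, hδθ⟩ := exists_pos_pow_le (n := n) (by omega)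
    (c := K * 3 ^ n * (2 * Cgq ^ n) * (Cg6 + Cg2 * C6)) (ε := θ) (by positivity) hθ
  -- `S₀` carries the part of `u` with bounded gradient. The bound `R`, and with it the final `K₀`,
  -- may be huge when `θ` is small, but multiplies only lower order terms.
  obtain ⟨S₀, hS₀⟩ := hu.exists_finset_tail_le hab (δ := δ ^ 2) (by positivity)
  set A₀ := Cs * (M + 1) with hA₀
  set R := (Real.sqrt (boxVolume a b))⁻¹
    * ∑ i : Fin d, ∑ k ∈ S₀, ‖symbol a b (Pi.single i 1) k‖ * M with hR
  have hRnn : 0 ≤ R := mul_nonneg (by positivity)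
    (Finset.sum_nonneg fun _ _ => Finset.sum_nonneg fun _ _ => by positivity)
  refine ⟨δ, K * (1 + A₀ ^ n + 3 ^ n * R ^ n) * (1 + Cg2), hδ, by positivity,
    fun t ht w ρ₁ z hw hρ₁ A P₁ P₂ Z₀ Z₁ hA hP₁ hP₂ hZ₀ hZ₁ hρδ hρA hρP₁ hρP₂ hz₀ hz₁ => ?_⟩
  have hut := hu.mem t ht
  have hut1 := hut.mono (s' := 1) (by norm_num)
  have hw1 := hw.mono (s' := 1) (by norm_num)
  have hρ1 : MemHp 1 (u t - w) := hut1.sub hw1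
  have hρ₁1 := hρ₁.mono (s' := 1) (by norm_num)
  set uR : L2 a b := trigPoly a b S₀ fun k => coeff k (u t) with huR
  have huR1 : MemHp 1 uR := memHp_trigPoly hab 1 _ _
  have hγδ : HBound 2 (u t - uR) δ := hBound_sub_trigPoly hab S₀ (hS₀ t ht)
  have hgradR : ∀ᵐ x ∂(boxMeasure a b), ‖gradient uR x‖ ≤ R := by
    filter_upwards [gradient_trigPoly hab S₀ fun k => coeff k (u t)] with x hx
    rw [huR, hx]
    refine (norm_trigGrad_le a b S₀ _ x).trans ?_
    refine mul_le_mul_of_nonneg_left (Finset.sum_le_sum fun i _ => Finset.sum_le_sum fun k _ => ?_)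
      (by positivity)
    exact mul_le_mul_of_nonneg_left ((huM t ht).norm_coeff_le hM k) (norm_nonneg _)
  have hF : ∀ᵐ x ∂(boxMeasure a b), ‖nonlinearity f t (u t) x - nonlinearity f t w x‖
      ≤ K * (1 + A₀ ^ n + 3 ^ n * R ^ n) * (‖(u t - w) x‖ + ‖gradient (u t - w) x‖)
        + K * 3 ^ n * (‖gradient (u t - uR) x‖ ^ n + ‖gradient (u t - w) x‖ ^ n)
          * ‖gradient (u t - w) x‖ := by
    filter_upwards [hsup _ _ hM (huM t ht), hsup _ _ hδ.le hρδ, hgradR, Lp.coeFn_sub (u t) w,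
      gradient_sub hab hut1 hw1, gradient_sub hab hut1 huR1] with x h1 h2 h3 h4 h5 h6
    rw [h4, Pi.sub_apply] at h2 ⊢
    refine hf.norm_sub_le hK ht (A := A₀) (by positivity) ?_ ?_ ?_ h5 h3
    · refine h1.trans ?_
      rw [hA₀]
      nlinarith
    · have h7 : ‖w x‖ ≤ ‖u t x‖ + ‖u t x - w x‖ := by
        have := norm_sub_le (u t x) (u t x - w x)
        rwa [sub_sub_cancel] at this
      rw [hA₀]
      nlinarith
    · rw [h6]
      abel
  have key := norm_integral_mul_conj_le (μ := boxMeasure a b) (n := n) (by omega)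
    (F := fun x => nonlinearity f t (u t) x - nonlinearity f t w x) (ρ := (u t - w : L2 a b))
    (z := z) (γ := gradient (u t - uR)) (g := gradient (u t - w)) (g₁ := gradient ρ₁)
    (g₂ := gradient (u t - w - ρ₁)) (Lp.aestronglyMeasurable _) (Lp.aestronglyMeasurable _)
    (aestronglyMeasurable_gradient _) (aestronglyMeasurable_gradient _)
    (aestronglyMeasurable_gradient _) (aestronglyMeasurable_gradient _)
    (K₀ := K * (1 + A₀ ^ n + 3 ^ n * R ^ n)) (K₁ := K * 3 ^ n) (Γ := Cgq * δ) (R := Cgq * δ)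
    (R₀ := A) (G₀ := Cg2 * A) (G₁ := Cg6 * P₁) (G₂ := Cg2 * P₂) (Z₂ := Z₀) (Z₆ := C6 * Z₁)
    (by positivity) (by positivity) (by positivity) (by positivity) hA (by positivity)
    (by positivity) (by positivity) hZ₀ (by positivity) hF
    (by
      filter_upwards [gradient_sub hab hρ1 hρ₁1] with x hx
      rw [hx]
      abel)
    (hgq _ _ hδ.le (hut1.sub huR1) hγδ) (hgq _ _ hδ.le hρ1 hρδ)
    (by
      rw [eLpNorm_two_eq]
      exact ENNReal.ofReal_le_ofReal (hρA.norm_le hab hA))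
    (hg2 _ _ hA hρ1 hρA) (hg6 _ _ hP₁ hρ₁1 hρP₁) (hg2 _ _ hP₂ (hρ1.sub hρ₁1) hρP₂)
    (by
      rw [eLpNorm_two_eq]
      exact ENNReal.ofReal_le_ofReal (hz₀.norm_le hab hZ₀))
    (h6 _ _ hZ₁ hz₁)
  refine key.trans (add_le_add (le_of_eq (by ring)) ?_)
  calc K * 3 ^ n * ((Cgq * δ) ^ n + (Cgq * δ) ^ n) * (Cg6 * P₁ * Z₀ + Cg2 * P₂ * (C6 * Z₁))
      ≤ K * 3 ^ n * ((Cgq * δ) ^ n + (Cgq * δ) ^ n)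
          * ((Cg6 + Cg2 * C6) * (P₁ * Z₀ + P₂ * Z₁)) := by
        refine mul_le_mul_of_nonneg_left ?_ (by positivity)
        have h1 : 0 ≤ Cg2 * C6 * (P₁ * Z₀) := by positivity
        have h2 : 0 ≤ Cg6 * (P₂ * Z₁) := by positivity
        nlinarith
    _ = K * 3 ^ n * (2 * Cgq ^ n) * (Cg6 + Cg2 * C6) * δ ^ n * (P₁ * Z₀ + P₂ * Z₁) := by
        rw [mul_pow]
        ring
    _ ≤ θ * (P₁ * Z₀ + P₂ * Z₁) := mul_le_mul_of_nonneg_right hδθ (by positivity)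

/-! ### Energy decay of one block, and the decomposition into blocks -/

/-- Decay estimate for a block of Fourier coefficients solving a forced diagonal system. -/
theorem sqrt_sum_sq_le_of_hasDerivWithinAt {ι : Type*} {B : Finset ι} {c F : ι → ℝ → ℂ}
    {lam : ι → ℝ} {τ L ν β : ℝ} (hLν : 0 < L + ν) (hβ : 0 ≤ β)
    (hlam : ∀ k ∈ B, L ≤ lam k)
    (hc : ∀ t ∈ Icc 0 τ, ∀ k ∈ B,
      HasDerivWithinAt (c k) (-(lam k : ℂ) * c k t + F k t) (Icc 0 τ) t)
    (hc0 : ∀ k ∈ B, c k 0 = 0)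
    (hF : ∀ t ∈ Icc 0 τ, ‖∑ k ∈ B, conj (c k t) * F k t‖
      ≤ β * Real.exp (ν * t) * Real.sqrt (∑ k ∈ B, ‖c k t‖ ^ 2)) :
    ∀ t ∈ Icc 0 τ, Real.sqrt (∑ k ∈ B, ‖c k t‖ ^ 2) ≤ β / (L + ν) * Real.exp (ν * t) := by
  set q : ℝ → ℝ := fun t => ∑ k ∈ B, ‖c k t‖ ^ 2 with hq
  have hq0 : ∀ t, 0 ≤ q t := fun t => Finset.sum_nonneg fun _ _ => sq_nonneg _
  set m := L + ν with hm
  -- With `y = exp (-ν t) * √q` the energy inequality reads `(y²)' ≤ -2 m y² + 2 β y`, and then `G'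
  -- ≤ -exp (m t) * m * (y - β / m)²`. Using `y²` avoids differentiating the root at zero.
  set G : ℝ → ℝ := fun t => Real.exp (m * t) * (Real.exp (-(2 * ν * t)) * q t - (β / m) ^ 2) with hG
  set q' : ℝ → ℝ := fun t => ∑ k ∈ B, 2 * (conj (c k t) * (-(lam k : ℂ) * c k t + F k t)).re with hq'
  have hqd : ∀ t ∈ Icc 0 τ, HasDerivWithinAt q (q' t) (Icc 0 τ) t := by
    intro t ht
    refine HasDerivWithinAt.fun_sum fun k hk => ?_
    have h1 := (hc t ht k hk).norm_sq
    have h2 : 2 * (conj (c k t) * (-(lam k : ℂ) * c k t + F k t)).re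
        = 2 * inner ℝ (c k t) (-(lam k : ℂ) * c k t + F k t) := by
      rw [Complex.inner, mul_comm (conj (c k t))]
    rw [h2]
    exact h1
  have hq'le : ∀ t ∈ Icc 0 τ, q' t
      ≤ -(2 * L) * q t + 2 * (β * Real.exp (ν * t) * Real.sqrt (q t)) := by
    intro t ht
    have h1 : q' t = ∑ k ∈ B, -(2 * lam k) * ‖c k t‖ ^ 2
        + 2 * (∑ k ∈ B, conj (c k t) * F k t).re := by
      rw [Complex.re_sum, Finset.mul_sum, ← Finset.sum_add_distrib]
      refine Finset.sum_congr rfl fun k _ => ?_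
      have h2 : conj (c k t) * (-(lam k : ℂ) * c k t + F k t)
          = ((-(lam k) * ‖c k t‖ ^ 2 : ℝ) : ℂ) + conj (c k t) * F k t := by
        push_cast
        rw [← Complex.conj_mul']
        ring
      rw [h2, Complex.add_re, Complex.ofReal_re]
      ring
    rw [h1]
    refine add_le_add ?_ ?_
    · rw [hq, Finset.mul_sum]
      refine Finset.sum_le_sum fun k hk => mul_le_mul_of_nonneg_right ?_ (sq_nonneg _)
      have := hlam k hk
      linarith
    · have := (Complex.re_le_norm _).trans (hF t ht)
      linarith
  have hGd : ∀ t ∈ Icc 0 τ, HasDerivWithinAt G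
      (Real.exp (m * t) * m * (Real.exp (-(2 * ν * t)) * q t - (β / m) ^ 2)
        + Real.exp (m * t) * (Real.exp (-(2 * ν * t)) * (-(2 * ν)) * q t
          + Real.exp (-(2 * ν * t)) * q' t)) (Icc 0 τ) t := by
    intro t ht
    have e1 : HasDerivWithinAt (fun t => Real.exp (m * t)) (Real.exp (m * t) * m) (Icc 0 τ) t := by
      have := ((hasDerivAt_id t).const_mul m).exp
      simpa using this.hasDerivWithinAt
    have e2 : HasDerivWithinAt (fun t => Real.exp (-(2 * ν * t)))
        (Real.exp (-(2 * ν * t)) * (-(2 * ν))) (Icc 0 τ) t := by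
      have := ((hasDerivAt_id t).const_mul (2 * ν)).neg.exp
      simpa using this.hasDerivWithinAt
    exact e1.mul ((e2.mul (hqd t ht)).sub_const _)
  have hGd' : ∀ t ∈ Icc 0 τ,
      Real.exp (m * t) * m * (Real.exp (-(2 * ν * t)) * q t - (β / m) ^ 2)
        + Real.exp (m * t) * (Real.exp (-(2 * ν * t)) * (-(2 * ν)) * q t
          + Real.exp (-(2 * ν * t)) * q' t) ≤ 0 := by
    intro t ht
    have h1 := hq'le t ht
    have hE : Real.exp (-(2 * ν * t)) = Real.exp (-(ν * t)) ^ 2 := by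
      rw [← Real.exp_nat_mul]
      congr 1
      push_cast
      ring
    have hEE : Real.exp (-(ν * t)) * Real.exp (ν * t) = 1 := by
      rw [← Real.exp_add]
      simp
    set y := Real.exp (-(ν * t)) * Real.sqrt (q t) with hy
    have hy2 : y ^ 2 = Real.exp (-(2 * ν * t)) * q t := by
      rw [hy, mul_pow, Real.sq_sqrt (hq0 t), hE]
    have h2 : Real.exp (-(2 * ν * t)) * q' t ≤ -(2 * L) * y ^ 2 + 2 * β * y := by
      have := mul_le_mul_of_nonneg_left h1 (Real.exp_pos (-(2 * ν * t))).le
      refine this.trans (le_of_eq ?_)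
      rw [hy2, hE, hy]
      linear_combination (2 * β * Real.exp (-(ν * t)) * Real.sqrt (q t)) * hEE
    have h3 : m * (y ^ 2 - (β / m) ^ 2) + (-(2 * ν) * y ^ 2 + (-(2 * L) * y ^ 2 + 2 * β * y))
        = -(m * (y - β / m) ^ 2) := by
      field_simp
      rw [hm]
      ring
    have h4 : 0 ≤ m * (y - β / m) ^ 2 := by positivity
    calc _ = Real.exp (m * t) * (m * (y ^ 2 - (β / m) ^ 2) + (-(2 * ν) * y ^ 2
          + Real.exp (-(2 * ν * t)) * q' t)) := by
          rw [hy2]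
          ring
      _ ≤ Real.exp (m * t) * (m * (y ^ 2 - (β / m) ^ 2) + (-(2 * ν) * y ^ 2
          + (-(2 * L) * y ^ 2 + 2 * β * y))) := by
          gcongr
      _ ≤ 0 := by
          rw [h3]
          exact mul_nonpos_of_nonneg_of_nonpos (Real.exp_pos _).le (by linarith)
  have hanti : AntitoneOn G (Icc 0 τ) := by
    refine antitoneOn_of_hasDerivWithinAt_nonpos (convex_Icc 0 τ)
      (fun t ht => (hGd t ht).continuousWithinAt)
      (fun t ht => (hGd t (interior_subset ht)).mono interior_subset)
      (fun t ht => hGd' t (interior_subset ht))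
  intro t ht
  have hG0 : G 0 ≤ 0 := by
    have : q 0 = 0 := Finset.sum_eq_zero fun k hk => by simp [hc0 k hk]
    simp only [hG, this]
    simp only [mul_zero, Real.exp_zero, one_mul, zero_sub]
    exact neg_nonpos.2 (sq_nonneg _)
  have hGt : G t ≤ 0 := (hanti ⟨le_rfl, ht.1.trans ht.2⟩ ht ht.1).trans hG0
  have h5 : Real.exp (-(2 * ν * t)) * q t ≤ (β / m) ^ 2 := by
    by_contra h
    push Not at h
    have := mul_pos (Real.exp_pos (m * t)) (sub_pos.2 h)
    exact absurd hGt (not_le.2 this)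
  have hE2 : Real.exp (ν * t) ^ 2 * Real.exp (-(2 * ν * t)) = 1 := by
    rw [← Real.exp_nat_mul, ← Real.exp_add, ← Real.exp_zero]
    congr 1
    push_cast
    ring
  refine Real.sqrt_le_iff.2 ⟨by positivity, ?_⟩
  rw [mul_pow]
  calc q t = Real.exp (ν * t) ^ 2 * (Real.exp (-(2 * ν * t)) * q t) := by
        rw [← mul_assoc, hE2, one_mul]
    _ ≤ Real.exp (ν * t) ^ 2 * (β / m) ^ 2 := mul_le_mul_of_nonneg_left h5 (sq_nonneg _)
    _ = _ := mul_comm _ _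

/-- The index of the dyadic block (in base `16`) containing the frequency `k`. -/
def blockIndex (k : Fin d → ℤ) : ℕ := Nat.log 16 (natWeight k)

theorem pow_blockIndex_le (k : Fin d → ℤ) : (16 : ℝ) ^ blockIndex k ≤ weight k := by
  have h : natWeight k ≠ 0 := by unfold natWeight; omega
  have := Nat.pow_log_le_self 16 h
  unfold weight blockIndex
  exact_mod_cast this

theorem weight_le_pow_blockIndex (k : Fin d → ℤ) : weight k ≤ (16 : ℝ) ^ (blockIndex k + 1) := by
  have := (Nat.lt_pow_succ_log_self (b := 16) (by norm_num) (natWeight k)).le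
  unfold weight blockIndex
  exact_mod_cast this

/-- The frequencies of `Λ` in the `j`-th block. -/
def block (Λ : Finset (Fin d → ℤ)) (j : ℕ) : Finset (Fin d → ℤ) :=
  Λ.filter fun k => blockIndex k = j

theorem sum_filter_blockIndex (Λ : Finset (Fin d → ℤ)) (I : Finset ℕ) (g : (Fin d → ℤ) → ℝ) :
    ∑ k ∈ Λ.filter (fun k => blockIndex k ∈ I), g k = ∑ j ∈ I, ∑ k ∈ block Λ j, g k := by
  rw [← Finset.sum_fiberwise_of_maps_to (s := Λ.filter fun k => blockIndex k ∈ I) (t := I)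
    (g := blockIndex) fun k hk => (Finset.mem_filter.1 hk).2]
  refine Finset.sum_congr rfl fun j hj => Finset.sum_congr ?_ fun _ _ => rfl
  ext k
  simp only [block, Finset.mem_filter]
  constructor
  · rintro ⟨⟨h1, _⟩, h3⟩
    exact ⟨h1, h3⟩
  · rintro ⟨h1, h2⟩
    exact ⟨⟨h1, h2 ▸ hj⟩, h2⟩

/-- On block `j` the weight is at most `16 ^ (j + 1)`, while the squared scale is `4 ^ J * 64 ^ j`.
Since `16 < 64 < 16²`, these bounds decrease in `j` for `s = 1` and increase for `s = 2`. -/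
theorem sum_weight_pow_block_le {a b : Fin d → ℝ} (v : L2 a b) (Λ : Finset (Fin d → ℤ)) (s : ℕ)
    {J j : ℕ} {E : ℝ}
    (hE : (2 : ℝ) ^ J * 8 ^ j * Real.sqrt (∑ k ∈ block Λ j, ‖coeff k v‖ ^ 2) ≤ E) :
    ∑ k ∈ block Λ j, weight k ^ s * ‖coeff k v‖ ^ 2
      ≤ (16 ^ (j + 1)) ^ s * (E ^ 2 * (4 ^ J * 64 ^ j)⁻¹) := by
  have h0 : 0 ≤ ∑ k ∈ block Λ j, ‖coeff k v‖ ^ 2 := Finset.sum_nonneg fun _ _ => sq_nonneg _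
  have h1 : ∑ k ∈ block Λ j, ‖coeff k v‖ ^ 2 ≤ E ^ 2 * (4 ^ J * 64 ^ j)⁻¹ := by
    have h2 := pow_le_pow_left₀ (by positivity) hE 2
    rw [mul_pow, Real.sq_sqrt h0, mul_pow, ← pow_mul, ← pow_mul, mul_comm J, mul_comm j, pow_mul,
      pow_mul] at h2
    norm_num at h2
    rw [← div_eq_mul_inv, le_div_iff₀ (by positivity)]
    linarith
  calc ∑ k ∈ block Λ j, weight k ^ s * ‖coeff k v‖ ^ 2
      ≤ ∑ k ∈ block Λ j, (16 ^ (j + 1)) ^ s * ‖coeff k v‖ ^ 2 := by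
        refine Finset.sum_le_sum fun k hk => mul_le_mul_of_nonneg_right ?_ (sq_nonneg _)
        have h3 := weight_le_pow_blockIndex k
        rw [(Finset.mem_filter.1 hk).2] at h3
        exact pow_le_pow_left₀ (weight_pos k).le h3 s
    _ = (16 ^ (j + 1)) ^ s * ∑ k ∈ block Λ j, ‖coeff k v‖ ^ 2 := by rw [Finset.mul_sum]
    _ ≤ _ := mul_le_mul_of_nonneg_left h1 (by positivity)

theorem sum_Ico_inv_four_pow_le (i n : ℕ) :
    ∑ j ∈ Finset.Ico i n, ((4 : ℝ) ^ j)⁻¹ ≤ 4 / 3 * (4 ^ i)⁻¹ := by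
  rcases le_total i n with h | h
  · have key : ∑ j ∈ Finset.Ico i n, ((4 : ℝ) ^ j)⁻¹ = 4 / 3 * ((4 ^ i)⁻¹ - (4 ^ n)⁻¹) := by
      induction n, h using Nat.le_induction with
      | base => simp
      | succ n hn ih =>
        rw [Finset.sum_Ico_succ_top hn, ih, pow_succ]
        field_simp
        ring
    rw [key]
    have : (0 : ℝ) ≤ (4 ^ n)⁻¹ := by positivity
    linarith
  · rw [Finset.Ico_eq_empty_of_le h, Finset.sum_empty]
    positivity

theorem sum_range_four_pow_le (i : ℕ) : ∑ j ∈ Finset.range i, (4 : ℝ) ^ j ≤ 4 ^ i / 3 := by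
  rw [geom_sum_eq (by norm_num)]
  norm_num
  have : (0 : ℝ) < 4 ^ i := by positivity
  linarith

/-- The low blocks of a function whose blocks are controlled. -/
theorem hBound_two_low_blocks {a b : Fin d → ℝ} (hab : ∀ i, a i < b i) {v : L2 a b}
    {Λ : Finset (Fin d → ℤ)} {J i : ℕ} {E : ℝ} (hi : i ≤ J + 1)
    (hE : ∀ j ≤ J, (2 : ℝ) ^ J * 8 ^ j * Real.sqrt (∑ k ∈ block Λ j, ‖coeff k v‖ ^ 2) ≤ E) :
    HBound 2 (trigPoly a b (Λ.filter fun k => blockIndex k ∈ Finset.range i) fun k => coeff k v)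
      (10 * 2 ^ i * E / 2 ^ J) := by
  classical
  intro S
  set Λ' := Λ.filter fun k => blockIndex k ∈ Finset.range i with hΛ'
  have hnn : ∀ k : Fin d → ℤ, 0 ≤ weight k ^ 2 * ‖coeff k v‖ ^ 2 := fun k =>
    mul_nonneg (pow_nonneg (weight_pos k).le _) (sq_nonneg _)
  calc ∑ k ∈ S, weight k ^ 2 * ‖coeff k (trigPoly a b Λ' fun k => coeff k v)‖ ^ 2
      = ∑ k ∈ S with k ∈ Λ', weight k ^ 2 * ‖coeff k v‖ ^ 2 := by
        rw [Finset.sum_filter]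
        refine Finset.sum_congr rfl fun k _ => ?_
        rw [coeff_trigPoly hab]
        by_cases hk : k ∈ Λ'
        · simp [hk]
        · simp [hk]
    _ ≤ ∑ k ∈ Λ', weight k ^ 2 * ‖coeff k v‖ ^ 2 :=
        Finset.sum_le_sum_of_subset_of_nonneg (fun k hk => (Finset.mem_filter.1 hk).2)
          fun k _ _ => hnn k
    _ = ∑ j ∈ Finset.range i, ∑ k ∈ block Λ j, weight k ^ 2 * ‖coeff k v‖ ^ 2 :=
        sum_filter_blockIndex Λ _ _
    -- The factor `16 ^ (2 * j) / 64 ^ j = 4 ^ j` grows, so the highest block below `i` dominates.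
    _ ≤ ∑ j ∈ Finset.range i, 256 * E ^ 2 / 4 ^ J * 4 ^ j := by
        refine Finset.sum_le_sum fun j hj => ?_
        refine (sum_weight_pow_block_le v Λ 2
          (hE j (by have := Finset.mem_range.1 hj; omega))).trans (le_of_eq ?_)
        have : (64 : ℝ) ^ j * 4 ^ j = (16 ^ j) ^ 2 := by
          rw [← mul_pow, ← pow_mul, mul_comm j, pow_mul]; norm_num
        rw [pow_succ (16 : ℝ) j, mul_pow, ← this]
        field_simp
        ring
    _ = 256 * E ^ 2 / 4 ^ J * ∑ j ∈ Finset.range i, (4 : ℝ) ^ j := by rw [Finset.mul_sum]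
    _ ≤ 256 * E ^ 2 / 4 ^ J * (4 ^ i / 3) :=
        mul_le_mul_of_nonneg_left (sum_range_four_pow_le i) (by positivity)
    _ ≤ 100 * E ^ 2 / 4 ^ J * 4 ^ i := by
        have : 0 ≤ E ^ 2 / 4 ^ J * 4 ^ i := by positivity
        have e1 : 256 * E ^ 2 / 4 ^ J * (4 ^ i / 3) = 256 / 3 * (E ^ 2 / 4 ^ J * 4 ^ i) := by ring
        have e2 : 100 * E ^ 2 / 4 ^ J * 4 ^ i = 100 * (E ^ 2 / 4 ^ J * 4 ^ i) := by ring
        rw [e1, e2]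
        linarith
    _ = (10 * 2 ^ i * E / 2 ^ J) ^ 2 := by
        rw [div_pow, mul_pow, mul_pow, ← pow_mul, ← pow_mul, mul_comm i, mul_comm J, pow_mul,
          pow_mul]
        norm_num
        ring

/-- The high blocks and the frequencies outside `Λ`. -/
theorem hBound_one_high_blocks {a b : Fin d → ℝ} (hab : ∀ i, a i < b i) {v : L2 a b}
    {Λ : Finset (Fin d → ℤ)} {J i : ℕ} {E ε κ' : ℝ} (hE0 : 0 ≤ E) (hε : 0 ≤ ε) (hκ : 0 ≤ κ')
    (hE : ∀ j ≤ J, (2 : ℝ) ^ J * 8 ^ j * Real.sqrt (∑ k ∈ block Λ j, ‖coeff k v‖ ^ 2) ≤ E)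
    (hΛ : ∀ k ∈ Λ, blockIndex k ≤ J) (hΛ' : ∀ k ∉ Λ, (16 : ℝ) ^ J ≤ κ' ^ 2 * weight k)
    (htail : ∀ S : Finset (Fin d → ℤ), Disjoint S Λ →
      ∑ k ∈ S, weight k ^ 2 * ‖coeff k v‖ ^ 2 ≤ ε ^ 2) :
    HBound 1 (v - trigPoly a b (Λ.filter fun k => blockIndex k ∈ Finset.range i)
      fun k => coeff k v) (5 * E / (2 ^ J * 2 ^ i) + κ' * ε / 4 ^ J) := by
  classical
  refine hBound_sub_trigPoly hab _ fun S hS => ?_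
  simp only [pow_one]
  have hnn : ∀ k : Fin d → ℤ, 0 ≤ weight k * ‖coeff k v‖ ^ 2 := fun k =>
    mul_nonneg (weight_pos k).le (sq_nonneg _)
  have hin : ∑ k ∈ S with k ∈ Λ, weight k * ‖coeff k v‖ ^ 2 ≤ (5 * E / (2 ^ J * 2 ^ i)) ^ 2 := by
    calc ∑ k ∈ S with k ∈ Λ, weight k * ‖coeff k v‖ ^ 2
        ≤ ∑ k ∈ Λ.filter (fun k => blockIndex k ∈ Finset.Ico i (J + 1)),
            weight k * ‖coeff k v‖ ^ 2 := by
          refine Finset.sum_le_sum_of_subset_of_nonneg (fun k hk => ?_) fun k _ _ => hnn k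
          obtain ⟨hkS, hkΛ⟩ := Finset.mem_filter.1 hk
          refine Finset.mem_filter.2 ⟨hkΛ, Finset.mem_Ico.2 ⟨?_, Nat.lt_succ_of_le (hΛ k hkΛ)⟩⟩
          by_contra hlt
          exact Finset.disjoint_left.1 hS hkS
            (Finset.mem_filter.2 ⟨hkΛ, Finset.mem_range.2 (not_le.1 hlt)⟩)
      _ = ∑ j ∈ Finset.Ico i (J + 1), ∑ k ∈ block Λ j, weight k * ‖coeff k v‖ ^ 2 :=
          sum_filter_blockIndex Λ _ _
      -- In `H¹` the factor is `16 ^ j / 64 ^ j`, so the lowest block, `i`, dominates.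
      _ ≤ ∑ j ∈ Finset.Ico i (J + 1), 16 * E ^ 2 / 4 ^ J * (4 ^ j)⁻¹ := by
          refine Finset.sum_le_sum fun j hj => ?_
          have h1 := sum_weight_pow_block_le v Λ 1
            (hE j (by have := (Finset.mem_Ico.1 hj).2; omega))
          simp only [pow_one] at h1
          refine h1.trans (le_of_eq ?_)
          have : (64 : ℝ) ^ j = 16 ^ j * 4 ^ j := by rw [← mul_pow]; norm_num
          rw [pow_succ, this]
          field_simp
      _ = 16 * E ^ 2 / 4 ^ J * ∑ j ∈ Finset.Ico i (J + 1), ((4 : ℝ) ^ j)⁻¹ := by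
          rw [Finset.mul_sum]
      _ ≤ 16 * E ^ 2 / 4 ^ J * (4 / 3 * (4 ^ i)⁻¹) :=
          mul_le_mul_of_nonneg_left (sum_Ico_inv_four_pow_le _ _) (by positivity)
      _ ≤ 25 * E ^ 2 / 4 ^ J * (4 ^ i)⁻¹ := by
          have : 0 ≤ E ^ 2 / 4 ^ J * (4 ^ i)⁻¹ := by positivity
          have e1 : 16 * E ^ 2 / 4 ^ J * (4 / 3 * (4 ^ i)⁻¹)
            = 64 / 3 * (E ^ 2 / 4 ^ J * (4 ^ i)⁻¹) := by ring
          have e2 : 25 * E ^ 2 / 4 ^ J * (4 ^ i)⁻¹ = 25 * (E ^ 2 / 4 ^ J * (4 ^ i)⁻¹) := by ring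
          rw [e1, e2]
          linarith
      _ = _ := by
          rw [div_pow, mul_pow, mul_pow, ← pow_mul, ← pow_mul, mul_comm i, mul_comm J, pow_mul,
            pow_mul]
          norm_num
          field_simp
  -- Outside `Λ` the weight is at least of order `16 ^ J`, so passing from `H²` down to `H¹` gains
  -- `4 ^ J`.
  have hout : ∑ k ∈ S with k ∉ Λ, weight k * ‖coeff k v‖ ^ 2 ≤ (κ' * ε / 4 ^ J) ^ 2 := by
    have h1 := htail (S.filter fun k => k ∉ Λ)
      (Finset.disjoint_left.2 fun k hk => (Finset.mem_filter.1 hk).2)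
    have h16 : (0 : ℝ) < 16 ^ J := by positivity
    calc ∑ k ∈ S with k ∉ Λ, weight k * ‖coeff k v‖ ^ 2
        ≤ ∑ k ∈ S with k ∉ Λ, κ' ^ 2 / 16 ^ J * (weight k ^ 2 * ‖coeff k v‖ ^ 2) := by
          refine Finset.sum_le_sum fun k hk => ?_
          have h2 := hΛ' k (Finset.mem_filter.1 hk).2
          rw [← mul_assoc]
          refine mul_le_mul_of_nonneg_right ?_ (sq_nonneg _)
          rw [div_mul_eq_mul_div, le_div_iff₀ h16]
          have := weight_pos k
          nlinarith
      _ = κ' ^ 2 / 16 ^ J * ∑ k ∈ S with k ∉ Λ, weight k ^ 2 * ‖coeff k v‖ ^ 2 := by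
          rw [Finset.mul_sum]
      _ ≤ κ' ^ 2 / 16 ^ J * ε ^ 2 := mul_le_mul_of_nonneg_left h1 (by positivity)
      _ = _ := by
          rw [div_pow, mul_pow, ← pow_mul, mul_comm J, pow_mul]
          norm_num
          ring
  rw [← Finset.sum_filter_add_sum_filter_not S (fun k => k ∈ Λ)]
  have h1 : 0 ≤ 5 * E / (2 ^ J * 2 ^ i) := by positivity
  have h2 : 0 ≤ κ' * ε / 4 ^ J := by positivity
  nlinarith [mul_nonneg h1 h2]

theorem hBound_trigPoly_block {a b : Fin d → ℝ} (hab : ∀ i, a i < b i) (v : L2 a b)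
    (Λ : Finset (Fin d → ℤ)) (j s : ℕ) :
    HBound s (trigPoly a b (block Λ j) fun k => coeff k v)
      ((4 ^ (j + 1)) ^ s * Real.sqrt (∑ k ∈ block Λ j, ‖coeff k v‖ ^ 2)) := by
  classical
  intro S
  calc ∑ k ∈ S, weight k ^ s * ‖coeff k (trigPoly a b (block Λ j) fun k => coeff k v)‖ ^ 2
      = ∑ k ∈ S with k ∈ block Λ j, weight k ^ s * ‖coeff k v‖ ^ 2 := by
        rw [Finset.sum_filter]
        refine Finset.sum_congr rfl fun k _ => ?_
        rw [coeff_trigPoly hab]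
        by_cases hk : k ∈ block Λ j
        · simp [hk]
        · simp [hk]
    _ ≤ ∑ k ∈ block Λ j, weight k ^ s * ‖coeff k v‖ ^ 2 :=
        Finset.sum_le_sum_of_subset_of_nonneg (fun k hk => (Finset.mem_filter.1 hk).2)
          fun k _ _ => mul_nonneg (pow_nonneg (weight_pos k).le _) (sq_nonneg _)
    _ ≤ ∑ k ∈ block Λ j, (16 ^ (j + 1)) ^ s * ‖coeff k v‖ ^ 2 := by
        refine Finset.sum_le_sum fun k hk => mul_le_mul_of_nonneg_right ?_ (sq_nonneg _)
        have h3 := weight_le_pow_blockIndex k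
        rw [(Finset.mem_filter.1 hk).2] at h3
        exact pow_le_pow_left₀ (weight_pos k).le h3 s
    _ = _ := by
        have h : (((4 : ℝ) ^ (j + 1)) ^ s) ^ 2 = (16 ^ (j + 1)) ^ s := by
          rw [show (16 : ℝ) = 4 ^ 2 by norm_num]
          simp only [← pow_mul]
          congr 1
          ring
        rw [mul_pow, Real.sq_sqrt (Finset.sum_nonneg fun _ _ => sq_nonneg _), Finset.mul_sum, h]

/-- With `y = 2 ^ j` this absorbs the lower order forcing `Q * 8 ^ j` into the dissipation `16 ^ j`
and a constant supplied by `ν`. -/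
theorem mul_cube_le_add {Q y : ℝ} (hQ : 0 ≤ Q) (hy : 0 ≤ y) : Q * y ^ 3 ≤ y ^ 4 + Q ^ 4 := by
  rcases le_total Q y with h | h
  · have := mul_le_mul_of_nonneg_right h (pow_nonneg hy 3)
    have := pow_nonneg hQ 4
    nlinarith
  · have := mul_le_mul_of_nonneg_left (pow_le_pow_left₀ hy h 3) hQ
    have := pow_nonneg hy 4
    nlinarith

/-- `Λ` lies in the first `J` blocks and contains all frequencies of size less than `4 ^ J / κ'`. -/
def IsResolvedBy (κ' : ℝ) (J : ℕ) (Λ : Finset (Fin d → ℤ)) : Prop :=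
  (∀ k ∈ Λ, blockIndex k ≤ J) ∧ ∀ k ∉ Λ, (16 : ℝ) ^ J ≤ κ' ^ 2 * weight k

/-- The forcing of one block by the difference of the nonlinearities. -/
theorem norm_integral_block_le {a b : Fin d → ℝ} (hab : ∀ i, a i < b i) {θ δ K₀ κ' E ε t : ℝ}
    {f : ℝ → ℂ → EuclideanSpace ℂ (Fin d) → ℂ} {v w : L2 a b} (hθ : 0 ≤ θ)
    (hK₀ : 0 ≤ K₀) (hκ : 0 ≤ κ')
    (hest : ∀ ρ₁ z : L2 a b, MemHp 2 ρ₁ →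
      ∀ A P₁ P₂ Z₀ Z₁ : ℝ, 0 ≤ A → 0 ≤ P₁ → 0 ≤ P₂ → 0 ≤ Z₀ → 0 ≤ Z₁ →
      HBound 2 (v - w) δ → HBound 1 (v - w) A → HBound 2 ρ₁ P₁ → HBound 1 (v - w - ρ₁) P₂ →
      HBound 0 z Z₀ → HBound 1 z Z₁ →
      ‖∫ x, (nonlinearity f t v x - nonlinearity f t w x) * conj (z x) ∂(boxMeasure a b)‖
        ≤ K₀ * A * Z₀ + θ * (P₁ * Z₀ + P₂ * Z₁))
    (hδ : HBound 2 (v - w) δ) {J : ℕ} {Λ : Finset (Fin d → ℤ)} (hΛ : IsResolvedBy κ' J Λ)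
    (hE0 : 0 ≤ E) (hε : 0 ≤ ε)
    (hE : ∀ j ≤ J, (2 : ℝ) ^ J * 8 ^ j * Real.sqrt (∑ k ∈ block Λ j, ‖coeff k (v - w)‖ ^ 2) ≤ E)
    (htail : ∀ S : Finset (Fin d → ℤ), Disjoint S Λ →
      ∑ k ∈ S, weight k ^ 2 * ‖coeff k (v - w)‖ ^ 2 ≤ ε ^ 2) {j : ℕ} (hj : j ≤ J) :
    ‖∫ x, (nonlinearity f t v x - nonlinearity f t w x)
        * conj (trigPoly a b (block Λ j) (fun k => coeff k (v - w)) x) ∂(boxMeasure a b)‖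
      ≤ (E + ε) * ((1 + κ') * (5 * K₀ + 30 * θ * 2 ^ j) / 2 ^ J)
        * Real.sqrt (∑ k ∈ block Λ j, ‖coeff k (v - w)‖ ^ 2) := by
  set Z := Real.sqrt (∑ k ∈ block Λ j, ‖coeff k (v - w)‖ ^ 2) with hZ
  have hZ0 : 0 ≤ Z := Real.sqrt_nonneg _
  -- With `i = 0` no low blocks are removed, and the whole error is bounded in `H¹`.
  have hA : HBound 1 (v - w) (5 * E / 2 ^ J + κ' * ε / 4 ^ J) := by
    have := hBound_one_high_blocks hab (i := 0) hE0 hε hκ hE hΛ.1 hΛ.2 htail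
    simpa [trigPoly] using this
  have hP2 := hBound_one_high_blocks hab (i := j) hE0 hε hκ hE hΛ.1 hΛ.2 htail
  have hP1 := hBound_two_low_blocks hab (i := j) (by omega) hE
  have hz0 := hBound_trigPoly_block hab (v - w) Λ j 0
  have hz1 := hBound_trigPoly_block hab (v - w) Λ j 1
  rw [pow_zero, one_mul] at hz0
  rw [pow_one] at hz1
  refine (hest _ _ (memHp_trigPoly hab 2 _ _) _ _ _ _ _ (by positivity) (by positivity)
    (by positivity) hZ0 (by positivity) hδ hA hP1 hP2 hz0 hz1).trans ?_
  rw [← hZ]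
  have h4J : (4 : ℝ) ^ J = 2 ^ J * 2 ^ J := by rw [← mul_pow]; norm_num
  have h4j : (4 : ℝ) ^ (j + 1) = 4 * (2 ^ j * 2 ^ j) := by rw [pow_succ, ← mul_pow]; norm_num; ring
  have hxy : (2 : ℝ) ^ j ≤ 2 ^ J := pow_le_pow_right₀ (by norm_num) hj
  have hx1 : (1 : ℝ) ≤ 2 ^ j := one_le_pow₀ (by norm_num)
  rw [h4J, h4j]
  clear_value Z
  clear hE hA hP2 hP1 hz0 hz1 h4J h4j
  generalize (2 : ℝ) ^ j = x at *
  generalize (2 : ℝ) ^ J = y at *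
  have hy : 0 < y := by linarith
  have hx : 0 < x := by linarith
  have hY : 0 ≤ 1 - y⁻¹ := by
    have := inv_le_one_of_one_le₀ (hx1.trans hxy)
    linarith
  have hX : 0 ≤ 1 - x * y⁻¹ := by
    rw [← div_eq_mul_inv]
    have := (div_le_one hy).2 hxy
    linarith
  -- The gap between the two sides is written as a combination that is visibly nonnegative, using `1
  -- ≤ x ≤ y` for `x = 2 ^ j` and `y = 2 ^ J`.
  have key : (E + ε) * ((1 + κ') * (5 * K₀ + 30 * θ * x) / y) * Z
      - (K₀ * (5 * E / y + κ' * ε / (y * y)) * Z + θ * (10 * x * E / y * Z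
        + (5 * E / (y * x) + κ' * ε / (y * y)) * (4 * (x * x) * Z)))
      = Z / y * (5 * K₀ * (ε + κ' * E) + 4 * K₀ * κ' * ε + K₀ * κ' * ε * (1 - y⁻¹)
        + 30 * θ * x * (ε + κ' * E) + 26 * θ * x * κ' * ε
        + 4 * θ * x * κ' * ε * (1 - x * y⁻¹)) := by
    field_simp
    ring
  have : 0 ≤ Z / y * (5 * K₀ * (ε + κ' * E) + 4 * K₀ * κ' * ε + K₀ * κ' * ε * (1 - y⁻¹)
        + 30 * θ * x * (ε + κ' * E) + 26 * θ * x * κ' * ε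
        + 4 * θ * x * κ' * ε * (1 - x * y⁻¹)) := by positivity
  linarith

/-! ### The a priori estimate for the error -/

/-- The Fourier coefficients of the error solve a forced diagonal system. -/
theorem exists_hasDerivWithinAt_coeff_sub {a b : Fin d → ℝ} (hab : ∀ i, a i < b i) {T τ : ℝ}
    (hτ : τ ≤ T) {f : ℝ → ℂ → EuclideanSpace ℂ (Fin d) → ℂ}
    (hfc : Continuous fun z : ℝ × ℂ × EuclideanSpace ℂ (Fin d) => f z.1 z.2.1 z.2.2)
    {u₀ : L2 a b} {u : ℝ → L2 a b} (hu : IsExactSolution T f u₀ u) {Nn : Fin d → ℕ}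
    {uN : ℝ → L2 a b} (huN : IsSemidiscreteSolution τ f u₀ Nn uN) {t : ℝ} (ht : t ∈ Icc 0 τ) :
    ∃ F : L2 a b, (F =ᵐ[boxMeasure a b]
        fun x => nonlinearity f t (u t) x - nonlinearity f t (uN t) x) ∧
      ∀ k ∈ frequencies Nn, HasDerivWithinAt (fun s => coeff k (u s - uN s))
        (-(eigenvalue a b k : ℂ) * coeff k (u t - uN t) + coeff k F) (Icc 0 τ) t := by
  obtain ⟨hF, u', hu', hcu⟩ := hu.exists_hasDerivWithinAt hab ⟨ht.1, ht.2.trans hτ⟩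
  obtain ⟨w', hw', heq⟩ := huN.equation t ht
  have hG := memLp_nonlinearity_of_mem_XN hab hfc t (huN.mem t ht)
  have hcw := (galerkin_equation_iff hab (huN.mem t ht) (w' := w') hG).1 heq
  refine ⟨hF.toLp _ - hG.toLp _, ?_, fun k hk => ?_⟩
  · filter_upwards [Lp.coeFn_sub (hF.toLp _) (hG.toLp _), hF.coeFn_toLp, hG.coeFn_toLp]
      with x h1 h2 h3
    rw [h1, Pi.sub_apply, h2, h3]
  · have h1 : HasDerivWithinAt (fun s => u s - uN s) (u' - w') (Icc 0 τ) t :=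
      (hu'.mono (Icc_subset_Icc_right hτ)).sub hw'
    have h2 := ((coeff k).restrictScalars ℝ).hasFDerivAt.comp_hasDerivWithinAt t h1
    have h3 : ((coeff k).restrictScalars ℝ) (u' - w')
        = -(eigenvalue a b k : ℂ) * coeff k (u t - uN t) + coeff k (hF.toLp _ - hG.toLp _) := by
      rw [ContinuousLinearMap.coe_restrictScalars', map_sub, map_sub, map_sub, hcu, hcw k hk]
      ring
    rw [← h3]
    exact h2

/-- A priori estimate: as long as the error is small in `H²`, it is controlled by the truncation
error of the exact solution. -/
theorem exists_apriori_estimate {a b : Fin d → ℝ} (hab : ∀ i, a i < b i) (hd : 1 ≤ d)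
    (hd3 : d ≤ 3) {T K M κ' : ℝ} {n : ℕ} (hn : 2 ≤ n) (hdn : d = 3 → n = 2)
    {f : ℝ → ℂ → EuclideanSpace ℂ (Fin d) → ℂ}
    (hfc : Continuous fun z : ℝ × ℂ × EuclideanSpace ℂ (Fin d) => f z.1 z.2.1 z.2.2)
    (hK : 0 ≤ K) (hf : HasPowerGrowth T n K f)
    {u₀ : L2 a b} {u : ℝ → L2 a b} (hu : IsExactSolution T f u₀ u) (hM : 0 ≤ M)
    (huM : ∀ t ∈ Icc 0 T, HBound 2 (u t) M) (hκ : 0 ≤ κ') :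
    ∃ δ C : ℝ, 0 < δ ∧ 0 < C ∧ ∀ (Nn : Fin d → ℕ) (J : ℕ), IsResolvedBy κ' J (frequencies Nn) →
      ∀ (τ : ℝ), τ ≤ T → ∀ uN : ℝ → L2 a b, IsSemidiscreteSolution τ f u₀ Nn uN →
      ∀ ε : ℝ, 0 ≤ ε → (∀ t ∈ Icc 0 τ, ∀ S : Finset (Fin d → ℤ), Disjoint S (frequencies Nn) →
        ∑ k ∈ S, weight k ^ 2 * ‖coeff k (u t)‖ ^ 2 ≤ ε ^ 2) →
      (∀ t ∈ Icc 0 τ, HBound 2 (u t - uN t) δ) →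
      ∀ t ∈ Icc 0 τ, HBound 2 (u t - uN t) (C * ε) := by
  classical
  obtain ⟨c₀, hc₀, hcw⟩ := exists_mul_weight_le_eigenvalue hab
  have hκ1 : 0 < 1 + κ' := by linarith
  -- Chosen so that the critical part of the block forcing uses `c₀ / 4` of the dissipation `c₀ * 16
  -- ^ j`. `K₀` depends on `θ`, and `Q`, `ν` on `K₀`; nothing depends on the mesh.
  set θ := c₀ / (120 * (1 + κ')) with hθ
  have hθ0 : 0 < θ := by positivity
  obtain ⟨δ, K₀, hδ, hK₀, hest⟩ := exists_nonlinear_estimate hab hd hd3 hn hdn hK hf hu hM huM hθ0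
  set Q := 20 * K₀ * (1 + κ') / c₀ with hQ
  have hQ0 : 0 ≤ Q := by positivity
  -- The rate of block `j` is at least `c₀ * 16 ^ j - 1`. Adding `ν` cancels the `-1` and supplies
  -- the `Q ^ 4` needed by `mul_cube_le_add`.
  set ν := 1 + c₀ * (Q ^ 4 + 1) with hν
  have hν0 : 0 < ν := by positivity
  -- The first summand comes from the blocks, the `1` from the unresolved frequencies.
  refine ⟨δ, 20 * Real.exp (ν * T) + 1, hδ, by positivity, ?_⟩
  intro Nn J hΛ τ hτ uN huN ε hε htail hsmall
  set Λ := frequencies Nn with hΛdef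
  have htail' : ∀ t ∈ Icc 0 τ, ∀ S : Finset (Fin d → ℤ), Disjoint S Λ →
      ∑ k ∈ S, weight k ^ 2 * ‖coeff k (u t - uN t)‖ ^ 2 ≤ ε ^ 2 := by
    intro t ht S hS
    refine le_trans (le_of_eq (Finset.sum_congr rfl fun k hk => ?_)) (htail t ht S hS)
    rw [map_sub, coeff_eq_zero_of_mem_XN hab (huN.mem t ht) (Finset.disjoint_left.1 hS hk), sub_zero]
  choose! F hFae hFd using fun t (ht : t ∈ Icc 0 τ) =>
    exists_hasDerivWithinAt_coeff_sub hab hτ hfc hu huN ht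
  -- One pass through the block equations: the forcing is estimated with the bound `D`, and the
  -- decay returns it improved to `(D + ε) / 2`.
  have hstep : ∀ D : ℝ, 0 ≤ D →
      (∀ t ∈ Icc 0 τ, ∀ j ≤ J, (2 : ℝ) ^ J * 8 ^ j
        * Real.sqrt (∑ k ∈ block Λ j, ‖coeff k (u t - uN t)‖ ^ 2) ≤ D * Real.exp (ν * t)) →
      ∀ t ∈ Icc 0 τ, ∀ j ≤ J, (2 : ℝ) ^ J * 8 ^ j
        * Real.sqrt (∑ k ∈ block Λ j, ‖coeff k (u t - uN t)‖ ^ 2)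
          ≤ (D + ε) / 2 * Real.exp (ν * t) := by
    intro D hD hvalid t ht j hj
    have e1 : (c₀ * 16 ^ j - 1) + ν = c₀ * (16 ^ j + (Q ^ 4 + 1)) := by rw [hν]; ring
    have hden : 0 < (c₀ * 16 ^ j - 1) + ν := by
      rw [e1]
      positivity
    set β := (D + ε) * ((1 + κ') * (5 * K₀ + 30 * θ * 2 ^ j) / 2 ^ J) with hβ
    have hβ0 : 0 ≤ β := by positivity
    have hmain := sqrt_sum_sq_le_of_hasDerivWithinAt (B := block Λ j)
      (c := fun k t => coeff k (u t - uN t)) (F := fun k t => coeff k (F t))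
      (lam := fun k => eigenvalue a b k) (τ := τ) hden hβ0 ?_ ?_ ?_ ?_ t ht
    · refine (mul_le_mul_of_nonneg_left hmain (by positivity)).trans ?_
      rw [← mul_assoc]
      refine mul_le_mul_of_nonneg_right ?_ (Real.exp_pos _).le
      have h2 := mul_cube_le_add hQ0 (pow_nonneg zero_le_two j : (0 : ℝ) ≤ 2 ^ j)
      have h8 : ((2 : ℝ) ^ j) ^ 3 = 8 ^ j := by rw [← pow_mul, mul_comm, pow_mul]; norm_num
      have h16 : ((2 : ℝ) ^ j) ^ 4 = 16 ^ j := by rw [← pow_mul, mul_comm, pow_mul]; norm_num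
      have h16' : (8 : ℝ) ^ j * 2 ^ j = 16 ^ j := by rw [← mul_pow]; norm_num
      rw [h8, h16] at h2
      have h3 : (1 + κ') * (5 * K₀ * 8 ^ j) = c₀ / 4 * (Q * 8 ^ j) := by
        rw [hQ]; field_simp; ring
      have h4 : (1 + κ') * (30 * θ) = c₀ / 4 := by rw [hθ]; field_simp; ring
      rw [e1, mul_div_assoc', div_le_iff₀ (by positivity)]
      have e2 : (2 : ℝ) ^ J * 8 ^ j * β
          = (D + ε) * ((1 + κ') * (5 * K₀ * 8 ^ j) + (1 + κ') * (30 * θ) * (8 ^ j * 2 ^ j)) := by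
        rw [hβ]
        field_simp
      rw [e2, h3, h4, h16']
      have h5 : c₀ / 4 * (Q * 8 ^ j) ≤ c₀ / 4 * (16 ^ j + Q ^ 4) :=
        mul_le_mul_of_nonneg_left h2 (by positivity)
      have hQ4 : 0 ≤ Q ^ 4 := by positivity
      calc (D + ε) * (c₀ / 4 * (Q * 8 ^ j) + c₀ / 4 * 16 ^ j)
          ≤ (D + ε) * (c₀ / 2 * (16 ^ j + (Q ^ 4 + 1))) := by
            refine mul_le_mul_of_nonneg_left ?_ (by positivity)
            have := mul_nonneg hc₀.le hQ4
            linarith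
        _ = _ := by ring
    · intro k hk
      have h1 := hcw k
      have h2 := pow_blockIndex_le k
      rw [(Finset.mem_filter.1 hk).2] at h2
      have := mul_le_mul_of_nonneg_left h2 hc₀.le
      linarith
    · exact fun s hs k hk => hFd s hs k (Finset.mem_filter.1 hk).1
    · intro k hk
      simp only [hu.init, huN.init, map_sub, coeff_PN hab Nn u₀ (Finset.mem_filter.1 hk).1,
        sub_self]
    · intro s hs
      have hs' : s ∈ Icc 0 T := ⟨hs.1, hs.2.trans hτ⟩
      have hw := memHp_of_mem_XN hab 2 (huN.mem s hs)
      have h1 := norm_integral_block_le hab hθ0.le hK₀ hκ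
        (fun ρ₁ z hρ₁ => hest s hs' (uN s) ρ₁ z hw hρ₁) (hsmall s hs) hΛ
        (mul_nonneg hD (Real.exp_pos (ν * s)).le) hε (hvalid s hs) (htail' s hs) hj
      rw [← inner_trigPoly, inner_eq_integral]
      have h2 : ∫ x, F s x * conj (trigPoly a b (block Λ j) (fun k => coeff k (u s - uN s)) x)
            ∂(boxMeasure a b)
          = ∫ x, (nonlinearity f s (u s) x - nonlinearity f s (uN s) x)
            * conj (trigPoly a b (block Λ j) (fun k => coeff k (u s - uN s)) x)
              ∂(boxMeasure a b) := by
        refine integral_congr_ae ?_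
        filter_upwards [hFae s hs] with x hx
        rw [hx]
      rw [h2]
      refine h1.trans (mul_le_mul_of_nonneg_right ?_ (Real.sqrt_nonneg _))
      rw [hβ]
      have h3 : 1 ≤ Real.exp (ν * s) := Real.one_le_exp (mul_nonneg hν0.le hs.1)
      have h4 : D * Real.exp (ν * s) + ε ≤ (D + ε) * Real.exp (ν * s) := by
        have := mul_le_mul_of_nonneg_left h3 hε
        linarith
      have h5 : 0 ≤ (1 + κ') * (5 * K₀ + 30 * θ * 2 ^ j) / 2 ^ J := by positivity
      have := mul_le_mul_of_nonneg_right h4 h5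
      linarith
  -- The iteration starts from the smallness hypothesis. The starting value depends on `J`, but its
  -- excess over `ε` is halved each time and disappears in the limit.
  have hiter : ∀ N : ℕ, ∀ t ∈ Icc 0 τ, ∀ j ≤ J, (2 : ℝ) ^ J * 8 ^ j
      * Real.sqrt (∑ k ∈ block Λ j, ‖coeff k (u t - uN t)‖ ^ 2)
        ≤ (ε + 16 ^ J * δ * (1 / 2) ^ N) * Real.exp (ν * t) := by
    intro N
    induction N with
    | zero =>
      intro t ht j hj
      have h1 : Real.sqrt (∑ k ∈ block Λ j, ‖coeff k (u t - uN t)‖ ^ 2) ≤ δ := by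
        refine Real.sqrt_le_iff.2 ⟨hδ.le, ?_⟩
        simpa using (hsmall t ht).mono_exponent (Nat.zero_le 2) (block Λ j)
      have h2 : (2 : ℝ) ^ J * 8 ^ j ≤ 16 ^ J := by
        have : (8 : ℝ) ^ j ≤ 8 ^ J := pow_le_pow_right₀ (by norm_num) hj
        calc (2 : ℝ) ^ J * 8 ^ j ≤ 2 ^ J * 8 ^ J := mul_le_mul_of_nonneg_left this (by positivity)
          _ = 16 ^ J := by rw [← mul_pow]; norm_num
      have h3 : 1 ≤ Real.exp (ν * t) := Real.one_le_exp (mul_nonneg hν0.le ht.1)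
      rw [pow_zero, mul_one]
      calc _ ≤ 16 ^ J * δ := mul_le_mul h2 h1 (Real.sqrt_nonneg _) (by positivity)
        _ ≤ ε + 16 ^ J * δ := by linarith
        _ ≤ _ := le_mul_of_one_le_right (by positivity) h3
    | succ N ih =>
      have := hstep _ (by positivity) ih
      intro t ht j hj
      refine (this t ht j hj).trans (le_of_eq ?_)
      rw [pow_succ]
      ring
  have hfinal : ∀ t ∈ Icc 0 τ, ∀ j ≤ J, (2 : ℝ) ^ J * 8 ^ j
      * Real.sqrt (∑ k ∈ block Λ j, ‖coeff k (u t - uN t)‖ ^ 2) ≤ ε * Real.exp (ν * T) := by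
    intro t ht j hj
    have hlim : Filter.Tendsto (fun N : ℕ => (ε + 16 ^ J * δ * (1 / 2) ^ N) * Real.exp (ν * t))
        Filter.atTop (nhds ((ε + 16 ^ J * δ * 0) * Real.exp (ν * t))) :=
      ((tendsto_pow_atTop_nhds_zero_of_lt_one (by norm_num) (by norm_num)).const_mul _
        |>.const_add _).mul_const _
    refine (ge_of_tendsto' hlim fun N => hiter N t ht j hj).trans ?_
    rw [mul_zero, add_zero]
    refine mul_le_mul_of_nonneg_left (Real.exp_le_exp.2 ?_) hε
    exact mul_le_mul_of_nonneg_left (ht.2.trans hτ) hν0.le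
  intro t ht S
  -- With `i = J + 1` the low blocks are all of `Λ`, and `10 * 2 ^ (J + 1) / 2 ^ J = 20`.
  have h1 := hBound_two_low_blocks hab (le_refl (J + 1)) (hfinal t ht) S
  have h2 := htail' t ht (S.filter fun k => k ∉ Λ)
    (Finset.disjoint_left.2 fun k hk => (Finset.mem_filter.1 hk).2)
  have h3 : ∑ k ∈ S with k ∈ Λ, weight k ^ 2 * ‖coeff k (u t - uN t)‖ ^ 2
      ≤ (20 * (ε * Real.exp (ν * T))) ^ 2 := by
    refine le_trans (le_of_eq ?_) (h1.trans (le_of_eq ?_))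
    · rw [Finset.sum_filter]
      refine Finset.sum_congr rfl fun k _ => ?_
      rw [coeff_trigPoly hab]
      by_cases hk : k ∈ Λ
      · simp [hk, hΛ.1 k hk]
      · simp [hk]
    · rw [pow_succ]
      field_simp
      ring
  rw [← Finset.sum_filter_add_sum_filter_not S (fun k => k ∈ Λ)]
  have h4 : 0 ≤ ε * Real.exp (ν * T) := by positivity
  nlinarith [mul_nonneg h4 hε]

/-! ### The Galerkin system as an ordinary differential equation -/

theorem integrable_of_continuous (a b : Fin d → ℝ) {g : (Fin d → ℝ) → ℂ} (hg : Continuous g) :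
    Integrable g (boxMeasure a b) := by
  refine IntegrableOn.mono_set (t := Icc a b)
    (hg.locallyIntegrable.integrableOn_isCompact isCompact_Icc) fun x hx => ?_
  exact ⟨fun i => (hx i (mem_univ i)).1.le, fun i => (hx i (mem_univ i)).2.le⟩

/-- The vector field of the Galerkin system, in terms of Fourier coefficients. -/
def galerkinField (a b : Fin d → ℝ) (f : ℝ → ℂ → EuclideanSpace ℂ (Fin d) → ℂ)
    (S : Finset (Fin d → ℤ)) (t : ℝ) (c : (Fin d → ℤ) → ℂ) (k : Fin d → ℤ) : ℂ :=
  -(eigenvalue a b k : ℂ) * c k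
    + ∫ x, f t (trigFun a b S c x) (trigGrad a b S c x) * conj (modeFun a b k x) ∂(boxMeasure a b)

theorem trigFun_sub (a b : Fin d → ℝ) (S : Finset (Fin d → ℤ)) (c c' : (Fin d → ℤ) → ℂ)
    (x : Fin d → ℝ) :
    trigFun a b S c x - trigFun a b S c' x = trigFun a b S (fun k => c k - c' k) x := by
  simp only [trigFun, ← Finset.sum_sub_distrib, sub_mul]

theorem trigGrad_sub (a b : Fin d → ℝ) (S : Finset (Fin d → ℤ)) (c c' : (Fin d → ℤ) → ℂ)
    (x : Fin d → ℝ) :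
    trigGrad a b S c x - trigGrad a b S c' x = trigGrad a b S (fun k => c k - c' k) x := by
  ext i
  simp only [trigGrad, PiLp.sub_apply, trigFun_sub, mul_sub]

theorem continuous_field_integrand (a b : Fin d → ℝ)
    {f : ℝ → ℂ → EuclideanSpace ℂ (Fin d) → ℂ}
    (hfc : Continuous fun z : ℝ × ℂ × EuclideanSpace ℂ (Fin d) => f z.1 z.2.1 z.2.2)
    (S : Finset (Fin d → ℤ)) (c : (Fin d → ℤ) → ℂ) (k : Fin d → ℤ) :
    Continuous fun z : ℝ × (Fin d → ℝ) =>
      f z.1 (trigFun a b S c z.2) (trigGrad a b S c z.2) * conj (modeFun a b k z.2) := by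
  have h1 : Continuous fun z : ℝ × (Fin d → ℝ) =>
      f z.1 (trigFun a b S c z.2) (trigGrad a b S c z.2) :=
    hfc.comp (continuous_fst.prodMk (((continuous_trigFun a b S c).comp continuous_snd).prodMk
      ((continuous_trigGrad a b S c).comp continuous_snd)))
  exact h1.mul (Complex.continuous_conj.comp ((continuous_modeFun a b k).comp continuous_snd))

theorem continuous_galerkinField (a b : Fin d → ℝ)
    {f : ℝ → ℂ → EuclideanSpace ℂ (Fin d) → ℂ}
    (hfc : Continuous fun z : ℝ × ℂ × EuclideanSpace ℂ (Fin d) => f z.1 z.2.1 z.2.2)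
    (S : Finset (Fin d → ℤ)) (c : (Fin d → ℤ) → ℂ) (k : Fin d → ℤ) :
    Continuous fun t => galerkinField a b f S t c k := by
  have h := continuous_parametric_integral_of_continuous (μ := volume)
    (f := fun (t : ℝ) (x : Fin d → ℝ) =>
      f t (trigFun a b S c x) (trigGrad a b S c x) * conj (modeFun a b k x))
    (continuous_field_integrand a b hfc S c k) (isCompact_Icc (a := a) (b := b))
  have hμ : boxMeasure a b = volume.restrict (Icc a b) :=
    Measure.restrict_congr_set Measure.univ_pi_Ioo_ae_eq_Icc
  unfold galerkinField
  rw [hμ]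
  exact continuous_const.add h

/-- Bounded coefficients on a finite set give trigonometric functions and gradients bounded on all
of space, where `f` is Lipschitz. The constant may depend on the mesh, as it serves only existence
and uniqueness. -/
theorem exists_galerkinField_lipschitz (a b : Fin d → ℝ) {T K : ℝ} {n : ℕ}
    {f : ℝ → ℂ → EuclideanSpace ℂ (Fin d) → ℂ}
    (hfc : Continuous fun z : ℝ × ℂ × EuclideanSpace ℂ (Fin d) => f z.1 z.2.1 z.2.2)
    (hK : 0 ≤ K) (hf : HasPowerGrowth T n K f) (S : Finset (Fin d → ℤ)) {R : ℝ} (hR : 0 ≤ R) :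
    ∃ C : ℝ, 0 ≤ C ∧ ∀ t ∈ Icc 0 T, ∀ c c' : (Fin d → ℤ) → ℂ, (∀ k ∈ S, ‖c k‖ ≤ R) →
      (∀ k ∈ S, ‖c' k‖ ≤ R) → ∀ k ∈ S,
      ‖galerkinField a b f S t c k - galerkinField a b f S t c' k‖
        ≤ C * ∑ l ∈ S, ‖c l - c' l‖ := by
  set v := (Real.sqrt (boxVolume a b))⁻¹ with hv
  have hv0 : 0 ≤ v := by positivity
  set W := ∑ i : Fin d, ∑ k ∈ S, ‖symbol a b (Pi.single i 1) k‖ with hW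
  have hW0 : 0 ≤ W := by positivity
  set X := v * (S.card * R) with hX
  set Y := v * (W * R) with hY
  set Q := K * (1 + X ^ n) * v + K * (1 + Y ^ n) * (v * W) with hQ
  have hX0 : 0 ≤ X := by positivity
  have hY0 : 0 ≤ Y := by positivity
  have hQ0 : 0 ≤ Q := by positivity
  have hfun : ∀ c : (Fin d → ℤ) → ℂ, (∀ k ∈ S, ‖c k‖ ≤ R) → ∀ x, ‖trigFun a b S c x‖ ≤ X := by
    intro c hc x
    refine (norm_trigFun_le a b S c x).trans (mul_le_mul_of_nonneg_left ?_ hv0)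
    simpa using Finset.sum_le_card_nsmul S _ R hc
  have hgrad : ∀ (c : (Fin d → ℤ) → ℂ) (B : ℝ), (∀ k ∈ S, ‖c k‖ ≤ B) → ∀ x,
      ‖trigGrad a b S c x‖ ≤ v * (W * B) := by
    intro c B hc x
    refine (norm_trigGrad_le a b S c x).trans (mul_le_mul_of_nonneg_left ?_ hv0)
    rw [hW, Finset.sum_mul]
    refine Finset.sum_le_sum fun i _ => ?_
    rw [Finset.sum_mul]
    exact Finset.sum_le_sum fun k hk => mul_le_mul_of_nonneg_left (hc k hk) (norm_nonneg _)
  set m := (boxMeasure a b).real univ with hm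
  have hm0 : 0 ≤ m := measureReal_nonneg
  have hE0 : 0 ≤ ∑ k ∈ S, eigenvalue a b k := Finset.sum_nonneg fun k _ => eigenvalue_nonneg a b k
  refine ⟨∑ k ∈ S, eigenvalue a b k + Q * v * m, by positivity, ?_⟩
  intro t ht c c' hc hc' k hk
  set Δ := ∑ l ∈ S, ‖c l - c' l‖ with hΔ
  have hΔ0 : 0 ≤ Δ := by positivity
  have hle : ∀ l ∈ S, ‖c l - c' l‖ ≤ Δ := fun l hl =>
    Finset.single_le_sum (f := fun l => ‖c l - c' l‖) (fun _ _ => norm_nonneg _) hl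
  have hcont : ∀ c : (Fin d → ℤ) → ℂ, Integrable (fun x =>
      f t (trigFun a b S c x) (trigGrad a b S c x) * conj (modeFun a b k x)) (boxMeasure a b) :=
    fun c => integrable_of_continuous a b
      ((continuous_field_integrand a b hfc S c k).comp (continuous_const.prodMk continuous_id))
  have hint : ‖(∫ x, f t (trigFun a b S c x) (trigGrad a b S c x) * conj (modeFun a b k x)
        ∂(boxMeasure a b))
      - ∫ x, f t (trigFun a b S c' x) (trigGrad a b S c' x) * conj (modeFun a b k x)
        ∂(boxMeasure a b)‖ ≤ Q * Δ * v * m := by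
    rw [← integral_sub (hcont c) (hcont c')]
    refine norm_integral_le_of_norm_le_const (Filter.Eventually.of_forall fun x => ?_)
    rw [← sub_mul, norm_mul, RCLike.norm_conj, norm_modeFun]
    refine mul_le_mul_of_nonneg_right ?_ hv0
    refine (hf t ht _ _ _ _ X Y (hfun c hc x) (hfun c' hc' x) (hgrad c R hc x)
      (hgrad c' R hc' x)).trans ?_
    rw [trigFun_sub, trigGrad_sub]
    have h1 := norm_trigFun_le a b S (fun k => c k - c' k) x
    have h2 := hgrad (fun k => c k - c' k) Δ hle x
    calc K * (1 + X ^ n) * ‖trigFun a b S (fun k => c k - c' k) x‖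
          + K * (1 + Y ^ n) * ‖trigGrad a b S (fun k => c k - c' k) x‖
        ≤ K * (1 + X ^ n) * (v * Δ) + K * (1 + Y ^ n) * (v * (W * Δ)) :=
          add_le_add (mul_le_mul_of_nonneg_left h1 (by positivity))
            (mul_le_mul_of_nonneg_left h2 (by positivity))
      _ = Q * Δ := by rw [hQ]; ring
  have hlin : ‖-(eigenvalue a b k : ℂ) * c k - -(eigenvalue a b k : ℂ) * c' k‖
      ≤ (∑ k ∈ S, eigenvalue a b k) * Δ := by
    rw [← mul_sub, norm_mul, norm_neg, Complex.norm_real, Real.norm_of_nonneg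
      (eigenvalue_nonneg a b k)]
    exact mul_le_mul (Finset.single_le_sum (fun k _ => eigenvalue_nonneg a b k) hk) (hle k hk)
      (norm_nonneg _) hE0
  unfold galerkinField
  rw [add_sub_add_comm]
  refine (norm_add_le _ _).trans ((add_le_add hlin hint).trans (le_of_eq ?_))
  ring

/-- Truncation of the real and imaginary parts to `[-R, R]`. -/
def truncate (R : ℝ) (z : ℂ) : ℂ := ⟨max (-R) (min R z.re), max (-R) (min R z.im)⟩

theorem norm_truncate_le {R : ℝ} (hR : 0 ≤ R) (z : ℂ) : ‖truncate R z‖ ≤ 2 * R := by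
  have h : ∀ x : ℝ, |max (-R) (min R x)| ≤ R := fun x =>
    abs_le.2 ⟨le_max_left _ _, max_le (by linarith) (min_le_left _ _)⟩
  have := Complex.norm_le_abs_re_add_abs_im (truncate R z)
  have h1 := h z.re
  have h2 := h z.im
  simp only [truncate] at this ⊢
  linarith

theorem norm_truncate_sub_le (R : ℝ) (z w : ℂ) :
    ‖truncate R z - truncate R w‖ ≤ 2 * ‖z - w‖ := by
  have h : ∀ x y : ℝ, |max (-R) (min R x) - max (-R) (min R y)| ≤ |x - y| := by
    intro x y
    refine (abs_max_sub_max_le_max _ _ _ _).trans (max_le (by simp) ?_)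
    exact (abs_min_sub_min_le_max _ _ _ _).trans (max_le (by simp) le_rfl)
  have h1 := Complex.norm_le_abs_re_add_abs_im (truncate R z - truncate R w)
  have h2 := h z.re w.re
  have h3 := h z.im w.im
  have h4 := Complex.abs_re_le_norm (z - w)
  have h5 := Complex.abs_im_le_norm (z - w)
  simp only [truncate, Complex.sub_re, Complex.sub_im] at h1 h2 h3 h4 h5 ⊢
  linarith

theorem truncate_eq {R : ℝ} {z : ℂ} (hz : ‖z‖ ≤ R) : truncate R z = z := by
  have h1 := abs_le.1 ((Complex.abs_re_le_norm z).trans hz)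
  have h2 := abs_le.1 ((Complex.abs_im_le_norm z).trans hz)
  apply Complex.ext
  · simp only [truncate, min_eq_right h1.2, max_eq_right h1.1]
  · simp only [truncate, min_eq_right h2.2, max_eq_right h2.1]

/-- The Galerkin vector field with truncated arguments, which is bounded and globally Lipschitz. -/
def truncatedField (a b : Fin d → ℝ) (f : ℝ → ℂ → EuclideanSpace ℂ (Fin d) → ℂ)
    (S : Finset (Fin d → ℤ)) (R t : ℝ) (v : L2 a b) : L2 a b :=
  trigPoly a b S (galerkinField a b f S t fun k => truncate R (coeff k v))

theorem norm_trigPoly_sub_le {a b : Fin d → ℝ} (hab : ∀ i, a i < b i) (S : Finset (Fin d → ℤ))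
    (c c' : (Fin d → ℤ) → ℂ) :
    ‖trigPoly a b S c - trigPoly a b S c'‖ ≤ ∑ k ∈ S, ‖c k - c' k‖ := by
  rw [trigPoly, trigPoly, ← Finset.sum_sub_distrib]
  refine (norm_sum_le _ _).trans (le_of_eq (Finset.sum_congr rfl fun k _ => ?_))
  rw [← sub_smul, norm_smul, (orthonormal_mode hab).1 k, mul_one]

/-- Truncated coefficients have size at most `2 * R` whatever `v` is, so the local Lipschitz bound
at radius `2 * R` becomes global. -/
theorem exists_truncatedField_bounds {a b : Fin d → ℝ} (hab : ∀ i, a i < b i) {T K : ℝ} {n : ℕ}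
    {f : ℝ → ℂ → EuclideanSpace ℂ (Fin d) → ℂ}
    (hfc : Continuous fun z : ℝ × ℂ × EuclideanSpace ℂ (Fin d) => f z.1 z.2.1 z.2.2)
    (hK : 0 ≤ K) (hf : HasPowerGrowth T n K f) (S : Finset (Fin d → ℤ)) {R : ℝ} (hR : 0 ≤ R) :
    ∃ C B : NNReal, ∀ t ∈ Icc 0 T, LipschitzWith C (truncatedField a b f S R t) ∧
      ∀ v, ‖truncatedField a b f S R t v‖ ≤ B := by
  obtain ⟨C, hC, hlip⟩ := exists_galerkinField_lipschitz a b hfc hK hf S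
    (by positivity : (0 : ℝ) ≤ 2 * R)
  have h1 : ∀ t ∈ Icc 0 T, ∀ v w, ‖truncatedField a b f S R t v - truncatedField a b f S R t w‖
      ≤ S.card * (C * ∑ l ∈ S, ‖truncate R (coeff l v) - truncate R (coeff l w)‖) := by
    intro t ht v w
    refine (norm_trigPoly_sub_le hab S _ _).trans ?_
    rw [← nsmul_eq_mul]
    exact Finset.sum_le_card_nsmul S _ _ fun k hk => hlip t ht _ _
      (fun l _ => norm_truncate_le hR _) (fun l _ => norm_truncate_le hR _) k hk
  have hcont : Continuous fun t => truncatedField a b f S R t 0 :=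
    continuous_finsetSum _ fun k _ => (continuous_galerkinField a b hfc S _ k).smul
      continuous_const
  obtain ⟨B, hB⟩ := isCompact_Icc.exists_bound_of_continuousOn (s := Icc 0 T) hcont.continuousOn
  refine ⟨NNReal.mk (S.card * (C * (S.card * 2))) (by positivity),
    NNReal.mk (|B| + S.card * (C * (S.card * (2 * R + 2 * R)))) (by positivity), fun t ht => ⟨?_, fun v => ?_⟩⟩
  · refine LipschitzWith.of_dist_le_mul fun v w => ?_
    rw [dist_eq_norm, dist_eq_norm]
    refine (h1 t ht v w).trans ?_
    have h2 : ∑ l ∈ S, ‖truncate R (coeff l v) - truncate R (coeff l w)‖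
        ≤ S.card * (2 * ‖v - w‖) := by
      rw [← nsmul_eq_mul]
      refine Finset.sum_le_card_nsmul S _ _ fun l _ => (norm_truncate_sub_le R _ _).trans ?_
      rw [← map_sub]
      have := (hBound_zero_norm hab (v - w)).norm_coeff_le (norm_nonneg _) l
      linarith
    calc _ ≤ S.card * (C * (S.card * (2 * ‖v - w‖))) := by gcongr
      _ = _ := by rw [NNReal.coe_mk]; ring
  · have h2 := h1 t ht v 0
    have h3 : ∑ l ∈ S, ‖truncate R (coeff l v) - truncate R (coeff l (0 : L2 a b))‖
        ≤ S.card * (2 * R + 2 * R) := by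
      rw [← nsmul_eq_mul]
      exact Finset.sum_le_card_nsmul S _ _ fun l _ => (norm_sub_le _ _).trans
        (add_le_add (norm_truncate_le hR _) (norm_truncate_le hR _))
    have h4 : ‖truncatedField a b f S R t v‖ ≤ ‖truncatedField a b f S R t 0‖
        + ‖truncatedField a b f S R t v - truncatedField a b f S R t 0‖ := by
      rw [add_comm]
      exact norm_le_norm_sub_add _ _
    rw [NNReal.coe_mk]
    refine h4.trans (add_le_add ((hB t ht).trans (le_abs_self B)) (h2.trans ?_))
    gcongr

theorem exists_truncated_solution {a b : Fin d → ℝ} (hab : ∀ i, a i < b i) {T K : ℝ} (hT : 0 ≤ T)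
    {n : ℕ} {f : ℝ → ℂ → EuclideanSpace ℂ (Fin d) → ℂ}
    (hfc : Continuous fun z : ℝ × ℂ × EuclideanSpace ℂ (Fin d) => f z.1 z.2.1 z.2.2)
    (hK : 0 ≤ K) (hf : HasPowerGrowth T n K f) (S : Finset (Fin d → ℤ)) {R : ℝ} (hR : 0 ≤ R)
    (y₀ : L2 a b) :
    ∃ y : ℝ → L2 a b, y 0 = y₀ ∧
      ∀ t ∈ Icc 0 T, HasDerivWithinAt y (truncatedField a b f S R t (y t)) (Icc 0 T) t := by
  obtain ⟨C, B, h⟩ := exists_truncatedField_bounds hab hfc hK hf S hR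
  -- A field bounded by `B` cannot leave the ball of radius `B * T` within time `T`, so
  -- Picard–Lindelöf covers the whole interval at once.
  have hpl : IsPicardLindelof (truncatedField a b f S R) (tmin := 0) (tmax := T)
      ⟨0, le_rfl, hT⟩ y₀ (B * NNReal.mk T hT) 0 B C := by
    refine ⟨fun t ht => (h t ht).1.lipschitzOnWith, fun v _ => ?_, fun t ht v _ => (h t ht).2 v, ?_⟩
    · exact (continuous_finsetSum _ fun k _ => (continuous_galerkinField a b hfc S _ k).smul
        continuous_const).continuousOn
    · simp [hT]
  exact hpl.exists_eq_forall_mem_Icc_hasDerivWithinAt₀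

theorem truncated_solution_unique {a b : Fin d → ℝ} (hab : ∀ i, a i < b i) {T K : ℝ}
    {n : ℕ} {f : ℝ → ℂ → EuclideanSpace ℂ (Fin d) → ℂ}
    (hfc : Continuous fun z : ℝ × ℂ × EuclideanSpace ℂ (Fin d) => f z.1 z.2.1 z.2.2)
    (hK : 0 ≤ K) (hf : HasPowerGrowth T n K f) (S : Finset (Fin d → ℤ)) {R : ℝ} (hR : 0 ≤ R)
    {y z : ℝ → L2 a b}
    (hy : ∀ t ∈ Icc 0 T, HasDerivWithinAt y (truncatedField a b f S R t (y t)) (Icc 0 T) t)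
    (hz : ∀ t ∈ Icc 0 T, HasDerivWithinAt z (truncatedField a b f S R t (z t)) (Icc 0 T) t)
    (h0 : y 0 = z 0) : EqOn y z (Icc 0 T) := by
  obtain ⟨C, B, h⟩ := exists_truncatedField_bounds hab hfc hK hf S hR
  have hright : ∀ {w : ℝ → L2 a b},
      (∀ t ∈ Icc 0 T, HasDerivWithinAt w (truncatedField a b f S R t (w t)) (Icc 0 T) t) →
      ∀ t ∈ Ico 0 T, HasDerivWithinAt w (truncatedField a b f S R t (w t)) (Ici t) t :=
    fun hw t ht => (hw t (Ico_subset_Icc_self ht)).mono_of_mem_nhdsWithin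
      (Icc_mem_nhdsGE_of_mem ht)
  exact ODE_solution_unique_of_mem_Icc_right (s := fun _ => univ)
    (fun t ht => (h t (Ico_subset_Icc_self ht)).1.lipschitzOnWith)
    (fun t ht => (hy t ht).continuousWithinAt) (hright hy) (fun _ _ => trivial)
    (fun t ht => (hz t ht).continuousWithinAt) (hright hz) (fun _ _ => trivial) h0

theorem galerkinField_coeff {a b : Fin d → ℝ} (hab : ∀ i, a i < b i)
    {f : ℝ → ℂ → EuclideanSpace ℂ (Fin d) → ℂ}
    (hfc : Continuous fun z : ℝ × ℂ × EuclideanSpace ℂ (Fin d) => f z.1 z.2.1 z.2.2) (t : ℝ)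
    {Nn : Fin d → ℕ} {v : L2 a b} (hv : v ∈ XN a b Nn)
    (hg : MemLp (nonlinearity f t v) 2 (boxMeasure a b)) (k : Fin d → ℤ) :
    galerkinField a b f (frequencies Nn) t (fun k => coeff k v) k
      = -(eigenvalue a b k : ℂ) * coeff k v + coeff k (hg.toLp _) := by
  rw [galerkinField, coeff_toLp]
  congr 1
  refine integral_congr_ae ?_
  have h := (memLp_nonlinearity_trigPoly hab hfc t (frequencies Nn) fun k => coeff k v).1
  rw [← eq_trigPoly_of_mem_XN hab hv] at h
  filter_upwards [h] with x hx
  rw [hx]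

theorem truncatedField_eq {a b : Fin d → ℝ} {f : ℝ → ℂ → EuclideanSpace ℂ (Fin d) → ℂ}
    {S : Finset (Fin d → ℤ)} {R t : ℝ} {v : L2 a b} (hv : ∀ k, ‖coeff k v‖ ≤ R) :
    truncatedField a b f S R t v = trigPoly a b S (galerkinField a b f S t fun k => coeff k v) := by
  rw [truncatedField]
  congr 2
  funext k
  exact truncate_eq (hv k)

theorem hasDerivWithinAt_coeff {a b : Fin d → ℝ} {y : ℝ → L2 a b} {y' : L2 a b} {s : Set ℝ}
    {t : ℝ} (hy : HasDerivWithinAt y y' s t) (k : Fin d → ℤ) :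
    HasDerivWithinAt (fun t => coeff k (y t)) (coeff k y') s t :=
  ((coeff k).restrictScalars ℝ).hasFDerivAt.comp_hasDerivWithinAt t hy

/-- The truncated equation is posed in all of `L²`, but its field has no components outside the
frequency set, so those coefficients keep their initial value zero. -/
theorem mem_XN_of_truncated {a b : Fin d → ℝ} (hab : ∀ i, a i < b i) {T R : ℝ}
    {f : ℝ → ℂ → EuclideanSpace ℂ (Fin d) → ℂ} {Nn : Fin d → ℕ} {y : ℝ → L2 a b}
    (hy : ∀ t ∈ Icc 0 T,
      HasDerivWithinAt y (truncatedField a b f (frequencies Nn) R t (y t)) (Icc 0 T) t)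
    (h0 : y 0 ∈ XN a b Nn) : ∀ t ∈ Icc 0 T, y t ∈ XN a b Nn := by
  classical
  intro t ht
  rw [eq_trigPoly_of_coeff_eq_zero hab (v := y t) (S := frequencies Nn)]
  · exact trigPoly_mem_XN hab Nn subset_rfl _
  intro k hk
  have hd : ∀ s ∈ Icc 0 T, HasDerivWithinAt (fun s => coeff k (y s)) 0 (Icc 0 T) s := by
    intro s hs
    have h1 := hasDerivWithinAt_coeff (hy s hs) k
    rwa [truncatedField, coeff_trigPoly hab, if_neg hk] at h1
  have h := constant_of_has_deriv_right_zero (fun s hs => (hd s hs).continuousWithinAt)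
    (fun s hs => (hd s (Ico_subset_Icc_self hs)).mono_of_mem_nhdsWithin
      (Icc_mem_nhdsGE_of_mem hs)) t ht
  exact h.trans (coeff_eq_zero_of_mem_XN hab h0 hk)

theorem isSemidiscreteSolution_of_truncated {a b : Fin d → ℝ} (hab : ∀ i, a i < b i) {T τ R : ℝ}
    (hτ : τ ≤ T) {f : ℝ → ℂ → EuclideanSpace ℂ (Fin d) → ℂ}
    (hfc : Continuous fun z : ℝ × ℂ × EuclideanSpace ℂ (Fin d) => f z.1 z.2.1 z.2.2)
    {u₀ : L2 a b} {Nn : Fin d → ℕ} {y : ℝ → L2 a b} (h0 : y 0 = PN Nn u₀)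
    (hy : ∀ t ∈ Icc 0 T,
      HasDerivWithinAt y (truncatedField a b f (frequencies Nn) R t (y t)) (Icc 0 T) t)
    (hR : ∀ t ∈ Icc 0 τ, ∀ k, ‖coeff k (y t)‖ ≤ R) :
    IsSemidiscreteSolution τ f u₀ Nn y := by
  classical
  have hsub : Icc 0 τ ⊆ Icc 0 T := Icc_subset_Icc_right hτ
  have hmem := mem_XN_of_truncated hab hy
    (h0 ▸ Submodule.starProjection_apply_mem (XN a b Nn) u₀)
  refine ⟨fun t ht => hmem t (hsub ht), h0, fun t ht => ⟨_, (hy t (hsub ht)).mono hsub, ?_⟩⟩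
  have hg := memLp_nonlinearity_of_mem_XN hab hfc t (hmem t (hsub ht))
  refine (galerkin_equation_iff hab (hmem t (hsub ht)) hg).2 fun k hk => ?_
  rw [truncatedField_eq (hR t ht), coeff_trigPoly hab, if_pos hk,
    galerkinField_coeff hab hfc t (hmem t (hsub ht)) hg]

theorem IsSemidiscreteSolution.hasDerivWithinAt_truncated {a b : Fin d → ℝ}
    (hab : ∀ i, a i < b i) {T R : ℝ} {f : ℝ → ℂ → EuclideanSpace ℂ (Fin d) → ℂ}
    (hfc : Continuous fun z : ℝ × ℂ × EuclideanSpace ℂ (Fin d) => f z.1 z.2.1 z.2.2)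
    {u₀ : L2 a b} {Nn : Fin d → ℕ} {y : ℝ → L2 a b} (hy : IsSemidiscreteSolution T f u₀ Nn y)
    (hR : ∀ t ∈ Icc 0 T, ∀ k, ‖coeff k (y t)‖ ≤ R) :
    ∀ t ∈ Icc 0 T,
      HasDerivWithinAt y (truncatedField a b f (frequencies Nn) R t (y t)) (Icc 0 T) t := by
  intro t ht
  obtain ⟨y', hy', heq⟩ := hy.equation t ht
  have hg := memLp_nonlinearity_of_mem_XN hab hfc t (hy.mem t ht)
  have hc := (galerkin_equation_iff hab (hy.mem t ht) (w' := y') hg).1 heq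
  have h1 : HasDerivWithinAt (fun s => trigPoly a b (frequencies Nn) fun k => coeff k (y s))
      (trigPoly a b (frequencies Nn) fun k => coeff k y') (Icc 0 T) t :=
    HasDerivWithinAt.fun_sum fun k _ => (hasDerivWithinAt_coeff hy' k).smul_const _
  have h2 : truncatedField a b f (frequencies Nn) R t (y t)
      = trigPoly a b (frequencies Nn) fun k => coeff k y' := by
    rw [truncatedField_eq (hR t ht)]
    refine Finset.sum_congr rfl fun k hk => ?_
    rw [galerkinField_coeff hab hfc t (hy.mem t ht) hg, ← hc k hk]
  rw [h2]
  exact h1.congr (fun s hs => eq_trigPoly_of_mem_XN hab (hy.mem s hs))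
    (eq_trigPoly_of_mem_XN hab (hy.mem t ht))

theorem IsSemidiscreteSolution.continuousOn {a b : Fin d → ℝ} {T : ℝ}
    {f : ℝ → ℂ → EuclideanSpace ℂ (Fin d) → ℂ} {u₀ : L2 a b} {Nn : Fin d → ℕ} {y : ℝ → L2 a b}
    (hy : IsSemidiscreteSolution T f u₀ Nn y) : ContinuousOn y (Icc 0 T) := fun t ht => by
  obtain ⟨y', hy', -⟩ := hy.equation t ht
  exact hy'.continuousWithinAt

theorem IsExactSolution.continuousOn {a b : Fin d → ℝ} {T : ℝ}
    {f : ℝ → ℂ → EuclideanSpace ℂ (Fin d) → ℂ} {u₀ : L2 a b} {u : ℝ → L2 a b}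
    (hu : IsExactSolution T f u₀ u) : ContinuousOn u (Icc 0 T) := fun t ht => by
  obtain ⟨u', hu', -⟩ := hu.equation t ht
  exact hu'.continuousWithinAt

/-- Two solutions are continuous, hence bounded on `[0, T]`; for a common large `R` both solve the
same truncated, globally Lipschitz equation. -/
theorem IsSemidiscreteSolution.eqOn {a b : Fin d → ℝ} (hab : ∀ i, a i < b i) {T K : ℝ} {n : ℕ}
    {f : ℝ → ℂ → EuclideanSpace ℂ (Fin d) → ℂ}
    (hfc : Continuous fun z : ℝ × ℂ × EuclideanSpace ℂ (Fin d) => f z.1 z.2.1 z.2.2)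
    (hK : 0 ≤ K) (hf : HasPowerGrowth T n K f) {u₀ : L2 a b} {Nn : Fin d → ℕ} {y z : ℝ → L2 a b}
    (hy : IsSemidiscreteSolution T f u₀ Nn y) (hz : IsSemidiscreteSolution T f u₀ Nn z) :
    EqOn y z (Icc 0 T) := by
  obtain ⟨R₁, h₁⟩ := isCompact_Icc.exists_bound_of_continuousOn hy.continuousOn
  obtain ⟨R₂, h₂⟩ := isCompact_Icc.exists_bound_of_continuousOn hz.continuousOn
  have hle : ∀ (v : L2 a b) (k : Fin d → ℤ), ‖coeff k v‖ ≤ ‖v‖ := fun v k =>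
    (hBound_zero_norm hab v).norm_coeff_le (norm_nonneg _) k
  have hR : (0 : ℝ) ≤ |R₁| + |R₂| := by positivity
  refine truncated_solution_unique hab hfc hK hf (frequencies Nn) hR
    (hy.hasDerivWithinAt_truncated hab hfc fun t ht k => ?_)
    (hz.hasDerivWithinAt_truncated hab hfc fun t ht k => ?_) (hy.init.trans hz.init.symm)
  · exact (hle _ k).trans ((h₁ t ht).trans ((le_abs_self _).trans
      (le_add_of_nonneg_right (abs_nonneg _))))
  · exact (hle _ k).trans ((h₂ t ht).trans ((le_abs_self _).trans
      (le_add_of_nonneg_left (abs_nonneg _))))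

/-! ### Bootstrap, mesh geometry and the estimate on fine meshes -/

/-- The `H²` norm of a function as the sum of its resolved and unresolved parts. -/
theorem hBound_two_of_resolved {a b : Fin d → ℝ} (hab : ∀ i, a i < b i) {Nn : Fin d → ℕ}
    {v w : L2 a b} (hw : w ∈ XN a b Nn) {X Y B : ℝ}
    (hX : ∑ k ∈ frequencies Nn, weight k ^ 2 * ‖coeff k (v - w)‖ ^ 2 ≤ X)
    (hY : ∀ S : Finset (Fin d → ℤ), Disjoint S (frequencies Nn) →
      ∑ k ∈ S, weight k ^ 2 * ‖coeff k v‖ ^ 2 ≤ Y) (hB : X + Y ≤ B ^ 2) :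
    HBound 2 (v - w) B := by
  classical
  intro S
  rw [← Finset.sum_filter_add_sum_filter_not S (fun k => k ∈ frequencies Nn)]
  refine (add_le_add (le_trans ?_ hX) (le_trans (le_of_eq ?_) (hY (S.filter fun k =>
    k ∉ frequencies Nn) (Finset.disjoint_left.2 fun k hk => (Finset.mem_filter.1 hk).2)))).trans hB
  · exact Finset.sum_le_sum_of_subset_of_nonneg (fun k hk => (Finset.mem_filter.1 hk).2)
      fun k _ _ => mul_nonneg (pow_nonneg (weight_pos k).le _) (sq_nonneg _)
  · refine Finset.sum_congr rfl fun k hk => ?_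
    rw [map_sub, coeff_eq_zero_of_mem_XN hab hw (Finset.mem_filter.1 hk).2, sub_zero]

/-- A continuous function that is bounded by `A` as long as it is bounded by `A' > A` never
exceeds `A`. -/
theorem le_of_forall_bootstrap {h : ℝ → ℝ} {T A A' : ℝ} (hA : A < A')
    (hc : ContinuousOn h (Icc 0 T)) (h0 : h 0 ≤ A)
    (hboot : ∀ τ ∈ Icc 0 T, (∀ t ∈ Icc 0 τ, h t ≤ A') → h τ ≤ A) :
    ∀ t ∈ Icc 0 T, h t ≤ A := by
  have key : ∀ t ∈ Icc 0 T, h t ≤ A' := by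
    by_contra hcon
    push Not at hcon
    obtain ⟨t₁, ht₁, hlt⟩ := hcon
    have hivt : ∀ s ∈ Icc 0 T, A' ≤ h s → ∃ r ∈ Icc 0 s, h r = A' := fun s hs hle =>
      intermediate_value_Icc hs.1 (hc.mono (Icc_subset_Icc_right hs.2))
        ⟨h0.trans hA.le, hle⟩
    have hcpt : IsCompact (Icc 0 T ∩ h ⁻¹' {A'}) :=
      isCompact_Icc.of_isClosed_subset
        (hc.preimage_isClosed_of_isClosed isClosed_Icc isClosed_singleton) inter_subset_left
    obtain ⟨r, hr, hrA⟩ := hivt t₁ ht₁ hlt.le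
    -- `τ` is the first time at which `h` takes the value `A'`. Up to then `h ≤ A'` by the
    -- intermediate value theorem, so the hypothesis forces `h τ ≤ A < A'`.
    obtain ⟨τ, ⟨hτ, hτA⟩, hmin⟩ := hcpt.exists_isLeast
      ⟨r, ⟨hr.1, hr.2.trans ht₁.2⟩, hrA⟩
    have hle := hboot τ hτ fun t ht => by
      by_contra hgt
      push Not at hgt
      obtain ⟨r', hr', hr'A⟩ := hivt t ⟨ht.1, ht.2.trans hτ.2⟩ hgt.le
      have h1 : τ ≤ r' := hmin ⟨⟨hr'.1, hr'.2.trans (ht.2.trans hτ.2)⟩, hr'A⟩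
      have h2 : t = τ := le_antisymm ht.2 (h1.trans hr'.2)
      rw [h2] at hgt
      exact hgt.ne' hτA
    exact absurd hle (not_le.2 ((show h τ = A' from hτA) ▸ hA))
  exact fun t ht => hboot t ht fun s hs => key s ⟨hs.1, hs.2.trans ht.2⟩

/-- Continuity in time is needed only for the resolved part, a finite sum that vanishes at time
zero. The unresolved part is at most `δ / 2` throughout, and the thresholds `δ² / 4 < δ² / 2` leave
room for it. -/
theorem hBound_of_bootstrap {a b : Fin d → ℝ} (hab : ∀ i, a i < b i) {T δ : ℝ} (hδ : 0 < δ)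
    {u w : ℝ → L2 a b} {Nn : Fin d → ℕ} (hu : ContinuousOn u (Icc 0 T))
    (hw : ContinuousOn w (Icc 0 T)) (hmem : ∀ t ∈ Icc 0 T, w t ∈ XN a b Nn)
    (h0 : w 0 = PN Nn (u 0))
    (htail : ∀ t ∈ Icc 0 T, ∀ S : Finset (Fin d → ℤ), Disjoint S (frequencies Nn) →
      ∑ k ∈ S, weight k ^ 2 * ‖coeff k (u t)‖ ^ 2 ≤ (δ / 2) ^ 2)
    (hboot : ∀ τ ≤ T, (∀ t ∈ Icc 0 τ, HBound 2 (u t - w t) δ) →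
      ∀ t ∈ Icc 0 τ, HBound 2 (u t - w t) (δ / 2)) :
    ∀ t ∈ Icc 0 T, HBound 2 (u t - w t) δ := by
  set h : ℝ → ℝ := fun t =>
    ∑ k ∈ frequencies Nn, weight k ^ 2 * ‖coeff k (u t - w t)‖ ^ 2 with hh
  have hc : ContinuousOn h (Icc 0 T) := continuousOn_finsetSum _ fun k _ =>
    continuousOn_const.mul (((coeff k).continuous.comp_continuousOn (hu.sub hw)).norm.pow 2)
  have hh0 : h 0 ≤ (δ / 2) ^ 2 := by
    have : h 0 = 0 := Finset.sum_eq_zero fun k hk => by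
      rw [h0, map_sub, coeff_PN hab Nn _ hk, sub_self, norm_zero]
      ring
    rw [this]
    positivity
  have hB : ∀ t ∈ Icc 0 T, h t ≤ δ ^ 2 / 2 → HBound 2 (u t - w t) δ := fun t ht hle =>
    hBound_two_of_resolved hab (hmem t ht) hle (htail t ht) (by nlinarith)
  have hA : (δ / 2) ^ 2 < δ ^ 2 / 2 := by nlinarith [pow_pos hδ 2]
  have := le_of_forall_bootstrap hA hc hh0 fun τ hτ hle =>
    hboot τ hτ.2 (fun t ht => hB t ⟨ht.1, ht.2.trans hτ.2⟩ (hle t ht)) τ ⟨hτ.1, le_rfl⟩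
      (frequencies Nn)
  exact fun t ht => hB t ht ((this t ht).trans hA.le)

/-- A missing frequency has some `|k j| ≥ Nn j / 2`, and `Nn j` is comparable with the mesh number.
Evenness makes the halving exact. -/
theorem sq_meshNumber_le {κ : ℝ} {Nn : Fin d → ℕ}
    (hpos : ∀ j, 0 < Nn j ∧ Even (Nn j)) (hκ : ∀ j, (meshNumber Nn : ℝ) ≤ κ * Nn j)
    {k : Fin d → ℤ} (hk : k ∉ frequencies Nn) :
    (meshNumber Nn : ℝ) ^ 2 ≤ (2 * |κ|) ^ 2 * weight k := by
  have h1 : ∃ j, (Nn j : ℤ) ≤ 2 * |k j| := by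
    by_contra hcon
    push Not at hcon
    refine hk (Fintype.mem_piFinset.2 fun j => Finset.mem_Icc.2 ?_)
    obtain ⟨r, hr⟩ := (hpos j).2
    have h2 := hcon j
    rw [hr] at h2 ⊢
    have h3 := abs_lt.1 (show |k j| < r by push_cast at h2; linarith)
    have h4 : (r + r) / 2 = r := by omega
    rw [h4]
    omega
  obtain ⟨j, hj⟩ := h1
  have h2 : (Nn j : ℝ) ≤ 2 * |(k j : ℝ)| := by exact_mod_cast hj
  have h3 : (meshNumber Nn : ℝ) ≤ |κ| * (2 * |(k j : ℝ)|) :=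
    (hκ j).trans (mul_le_mul (le_abs_self κ) h2 (Nat.cast_nonneg _) (abs_nonneg _))
  calc (meshNumber Nn : ℝ) ^ 2 ≤ (|κ| * (2 * |(k j : ℝ)|)) ^ 2 :=
        pow_le_pow_left₀ (Nat.cast_nonneg _) h3 2
    _ = (2 * |κ|) ^ 2 * (k j : ℝ) ^ 2 := by rw [mul_pow, mul_pow, mul_pow, sq_abs (k j : ℝ)]; ring
    _ ≤ _ := mul_le_mul_of_nonneg_left (sq_le_weight k j) (sq_nonneg _)

/-- The number of blocks is such that `4 ^ J` is comparable with `N`. For a resolved frequency the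
weight is at most `1 + 3 N² / 4 ≤ N²`, by `d ≤ 3` and `N ≥ 2`. -/
theorem isResolvedBy_frequencies (hd : 1 ≤ d) (hd3 : d ≤ 3) {κ : ℝ} {Nn : Fin d → ℕ}
    (hpos : ∀ j, 0 < Nn j ∧ Even (Nn j)) (hκ : ∀ j, (meshNumber Nn : ℝ) ≤ κ * Nn j) :
    IsResolvedBy (2 * |κ|) (Nat.log 16 (meshNumber Nn ^ 2)) (frequencies Nn) := by
  have hle : ∀ j, Nn j ≤ meshNumber Nn := fun j => Finset.le_sup (Finset.mem_univ j)
  have hN : 2 ≤ meshNumber Nn := by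
    refine le_trans ?_ (hle ⟨0, hd⟩)
    obtain ⟨r, hr⟩ := (hpos ⟨0, hd⟩).2
    have := (hpos ⟨0, hd⟩).1
    omega
  refine ⟨fun k hk => Nat.log_mono_right ?_, fun k hk => le_trans ?_ (sq_meshNumber_le hpos hκ hk)⟩
  · have h1 : ∀ j, 4 * (k j).natAbs ^ 2 ≤ meshNumber Nn ^ 2 := by
      intro j
      have h2 := Finset.mem_Icc.1 (Fintype.mem_piFinset.1 hk j)
      have h3 : 2 * (k j).natAbs ≤ meshNumber Nn := by
        have := hle j
        omega
      calc 4 * (k j).natAbs ^ 2 = (2 * (k j).natAbs) ^ 2 := by ring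
        _ ≤ _ := Nat.pow_le_pow_left h3 2
    have h2 : 4 * ∑ j, (k j).natAbs ^ 2 ≤ d * meshNumber Nn ^ 2 := by
      rw [Finset.mul_sum]
      refine (Finset.sum_le_card_nsmul _ _ _ fun j _ => h1 j).trans (le_of_eq ?_)
      simp
    have h3 : d * meshNumber Nn ^ 2 ≤ 3 * meshNumber Nn ^ 2 := Nat.mul_le_mul_right _ hd3
    have h4 : 4 ≤ meshNumber Nn ^ 2 := by nlinarith
    unfold natWeight
    omega
  · have := Nat.pow_log_le_self 16 (x := meshNumber Nn ^ 2) (by positivity)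
    exact_mod_cast this

/-- The unresolved part of a function in `H^m`. -/
theorem sum_tail_le {a b : Fin d → ℝ} {m : ℕ} (hm : 2 ≤ m) {v : L2 a b} {M ℓ : ℝ}
    (hv : HBound m v M) {Λ : Finset (Fin d → ℤ)} (hΛ : ∀ k ∉ Λ, 1 ≤ ℓ ^ 2 * weight k)
    {S : Finset (Fin d → ℤ)} (hS : Disjoint S Λ) :
    ∑ k ∈ S, weight k ^ 2 * ‖coeff k v‖ ^ 2 ≤ (ℓ ^ (m - 2) * M) ^ 2 := by
  obtain ⟨r, rfl⟩ := Nat.exists_eq_add_of_le hm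
  rw [Nat.add_sub_cancel_left]
  calc ∑ k ∈ S, weight k ^ 2 * ‖coeff k v‖ ^ 2
      ≤ ∑ k ∈ S, (ℓ ^ 2) ^ r * (weight k ^ (2 + r) * ‖coeff k v‖ ^ 2) := by
        refine Finset.sum_le_sum fun k hk => ?_
        have h1 := one_le_pow₀ (hΛ k (Finset.disjoint_left.1 hS hk)) (n := r)
        have h2 : 0 ≤ weight k ^ 2 * ‖coeff k v‖ ^ 2 := by
          have := weight_pos k
          positivity
        calc weight k ^ 2 * ‖coeff k v‖ ^ 2
            ≤ (ℓ ^ 2 * weight k) ^ r * (weight k ^ 2 * ‖coeff k v‖ ^ 2) :=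
              le_mul_of_one_le_left h2 h1
          _ = _ := by rw [mul_pow, pow_add]; ring
    _ = (ℓ ^ 2) ^ r * ∑ k ∈ S, weight k ^ (2 + r) * ‖coeff k v‖ ^ 2 := by rw [Finset.mul_sum]
    _ ≤ (ℓ ^ 2) ^ r * M ^ 2 := mul_le_mul_of_nonneg_left (hv S) (by positivity)
    _ = _ := by rw [mul_pow, ← pow_mul, ← pow_mul, mul_comm 2 r]

/-- For one discretization the error is bounded, uniformly over all semi-discrete solutions. -/
theorem exists_hBound_semidiscrete {a b : Fin d → ℝ} (hab : ∀ i, a i < b i) {T K M : ℝ} {n : ℕ}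
    {f : ℝ → ℂ → EuclideanSpace ℂ (Fin d) → ℂ}
    (hfc : Continuous fun z : ℝ × ℂ × EuclideanSpace ℂ (Fin d) => f z.1 z.2.1 z.2.2)
    (hK : 0 ≤ K) (hf : HasPowerGrowth T n K f) {u₀ : L2 a b} {u : ℝ → L2 a b}
    (hu : ContinuousOn u (Icc 0 T)) (huM : ∀ t ∈ Icc 0 T, HBound 2 (u t) M) (Nn : Fin d → ℕ) :
    ∃ B : ℝ, 0 ≤ B ∧ ∀ uN : ℝ → L2 a b, IsSemidiscreteSolution T f u₀ Nn uN →
      ∀ t ∈ Icc 0 T, HBound 2 (u t - uN t) B := by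
  -- If a solution exists it is unique on `[0, T]`, so a bound for one is a bound for all; otherwise
  -- there is nothing to bound.
  by_cases hex : ∃ w : ℝ → L2 a b, IsSemidiscreteSolution T f u₀ Nn w
  · obtain ⟨w, hw⟩ := hex
    have hc : ContinuousOn (fun t => ∑ k ∈ frequencies Nn, weight k ^ 2
        * ‖coeff k (u t - w t)‖ ^ 2) (Icc 0 T) := continuousOn_finsetSum _ fun k _ =>
      continuousOn_const.mul
        (((coeff k).continuous.comp_continuousOn (hu.sub hw.continuousOn)).norm.pow 2)
    obtain ⟨X, hX⟩ := isCompact_Icc.exists_bound_of_continuousOn hc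
    refine ⟨Real.sqrt (|X| + M ^ 2), Real.sqrt_nonneg _, fun uN huN t ht => ?_⟩
    rw [huN.eqOn hab hfc hK hf hw ht]
    exact hBound_two_of_resolved hab (hw.mem t ht)
      (((le_abs_self _).trans (hX t ht)).trans (le_abs_self X)) (fun S _ => huM t ht S)
      (Real.sq_sqrt (by positivity)).ge
  · exact ⟨0, le_rfl, fun uN huN => absurd ⟨uN, huN⟩ hex⟩

/-- On fine meshes a semi-discrete solution exists, and the error in `H²` is controlled by the
truncation error of the exact solution. -/
theorem exists_error_estimate {a b : Fin d → ℝ} (hab : ∀ i, a i < b i) (hd : 1 ≤ d)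
    (hd3 : d ≤ 3) {T K M κ : ℝ} (hT : 0 ≤ T) {n : ℕ} (hn : 2 ≤ n) (hdn : d = 3 → n = 2)
    {f : ℝ → ℂ → EuclideanSpace ℂ (Fin d) → ℂ}
    (hfc : Continuous fun z : ℝ × ℂ × EuclideanSpace ℂ (Fin d) => f z.1 z.2.1 z.2.2)
    (hK : 0 ≤ K) (hf : HasPowerGrowth T n K f)
    {u₀ : L2 a b} {u : ℝ → L2 a b} (hu : IsExactSolution T f u₀ u) (hM : 0 ≤ M)
    (huM : ∀ t ∈ Icc 0 T, HBound 2 (u t) M) :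
    ∃ C : ℝ, 0 < C ∧ ∃ N₀ : ℕ, ∀ Nn : Fin d → ℕ, (∀ j, 0 < Nn j ∧ Even (Nn j)) →
      (∀ j, (meshNumber Nn : ℝ) ≤ κ * Nn j) → N₀ ≤ meshNumber Nn →
      (∃ uN : ℝ → L2 a b, IsSemidiscreteSolution T f u₀ Nn uN) ∧
      ∀ uN : ℝ → L2 a b, IsSemidiscreteSolution T f u₀ Nn uN → ∀ ε : ℝ, 0 ≤ ε →
        (∀ t ∈ Icc 0 T, ∀ S : Finset (Fin d → ℤ), Disjoint S (frequencies Nn) →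
          ∑ k ∈ S, weight k ^ 2 * ‖coeff k (u t)‖ ^ 2 ≤ ε ^ 2) →
        ∀ t ∈ Icc 0 T, HBound 2 (u t - uN t) (C * ε) := by
  obtain ⟨δ, C, hδ, hC, hap⟩ := exists_apriori_estimate (κ' := 2 * |κ|) hab hd hd3 hn hdn hfc hK hf
    hu hM huM (by positivity)
  -- A tail of size `ε₀` meets both needs of the bootstrap: the tail is at most `δ / 2`, and so is
  -- the a priori bound `C * ε₀`.
  set ε₀ := δ / (2 * (C + 1)) with hε₀
  have hε₀0 : 0 < ε₀ := by positivity
  have hε₀δ : ε₀ ≤ δ / 2 := by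
    rw [hε₀]
    gcongr
    linarith
  have hCε₀ : C * ε₀ ≤ δ / 2 := by
    rw [hε₀, mul_div_assoc', div_le_div_iff₀ (by positivity) (by positivity)]
    nlinarith
  obtain ⟨S₀, hS₀⟩ := hu.exists_finset_tail_le hab (pow_pos hε₀0 2)
  -- Large enough that, by `sq_meshNumber_le`, every frequency of `S₀` is resolved.
  obtain ⟨N₀, hN₀⟩ := exists_nat_gt ((2 * |κ|) ^ 2 * ∑ k ∈ S₀, weight k)
  refine ⟨C, hC, N₀, fun Nn hpos hκ hN => ?_⟩
  have hres := isResolvedBy_frequencies hd hd3 hpos hκ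
  have hsub : S₀ ⊆ frequencies Nn := by
    intro k hk
    by_contra hkn
    have h1 := sq_meshNumber_le hpos hκ hkn
    have h2 : weight k ≤ ∑ k ∈ S₀, weight k :=
      Finset.single_le_sum (fun k _ => (weight_pos k).le) hk
    have h3 : (N₀ : ℝ) ≤ (meshNumber Nn : ℝ) ^ 2 := by
      exact_mod_cast hN.trans (Nat.le_self_pow two_ne_zero _)
    have h4 := mul_le_mul_of_nonneg_left h2 (sq_nonneg (2 * |κ|))
    linarith
  have htail : ∀ t ∈ Icc 0 T, ∀ S : Finset (Fin d → ℤ), Disjoint S (frequencies Nn) →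
      ∑ k ∈ S, weight k ^ 2 * ‖coeff k (u t)‖ ^ 2 ≤ ε₀ ^ 2 := fun t ht S hS =>
    hS₀ t ht S (hS.mono_right hsub)
  have htail' : ∀ t ∈ Icc 0 T, ∀ S : Finset (Fin d → ℤ), Disjoint S (frequencies Nn) →
      ∑ k ∈ S, weight k ^ 2 * ‖coeff k (u t)‖ ^ 2 ≤ (δ / 2) ^ 2 := fun t ht S hS =>
    (htail t ht S hS).trans (pow_le_pow_left₀ hε₀0.le hε₀δ 2)
  -- Here `w` need only be a Galerkin solution as long as it is close to `u`. This covers both the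
  -- truncated solution, in the existence proof, and an arbitrary semi-discrete solution.
  have hsmall : ∀ w : ℝ → L2 a b, ContinuousOn w (Icc 0 T) → (∀ t ∈ Icc 0 T, w t ∈ XN a b Nn) →
      w 0 = PN Nn u₀ → (∀ τ ≤ T, (∀ t ∈ Icc 0 τ, HBound 2 (u t - w t) δ) →
        IsSemidiscreteSolution τ f u₀ Nn w) → ∀ t ∈ Icc 0 T, HBound 2 (u t - w t) δ := by
    intro w hw hmem h0 hsol
    refine hBound_of_bootstrap hab hδ hu.continuousOn hw hmem (by rw [h0, hu.init]) htail'
      fun τ hτ hle t ht => ?_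
    exact (hap Nn _ hres τ hτ w (hsol τ hτ hle) ε₀ hε₀0.le
      (fun t ht => htail t ⟨ht.1, ht.2.trans hτ⟩) hle t ht).mono (by positivity) hCε₀
  refine ⟨?_, fun uN huN ε hε htε => ?_⟩
  -- While the error is at most `δ`, the coefficients of `y` are at most `M + δ`; truncating at this
  -- height changes nothing.
  · have hR : 0 ≤ M + δ := by positivity
    obtain ⟨y, hy0, hy⟩ := exists_truncated_solution hab hT hfc hK hf (frequencies Nn) hR
      (PN Nn u₀)
    have hmem := mem_XN_of_truncated hab hy
      (hy0 ▸ Submodule.starProjection_apply_mem (XN a b Nn) u₀)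
    have hsol : ∀ τ ≤ T, (∀ t ∈ Icc 0 τ, HBound 2 (u t - y t) δ) →
        IsSemidiscreteSolution τ f u₀ Nn y := by
      intro τ hτ hle
      refine isSemidiscreteSolution_of_truncated hab hτ hfc hy0 hy fun t ht k => ?_
      have h1 := (huM t ⟨ht.1, ht.2.trans hτ⟩).norm_coeff_le hM k
      have h2 := (hle t ht).norm_coeff_le hδ.le k
      have h3 : coeff k (y t) = coeff k (u t) - coeff k (u t - y t) := by rw [map_sub]; ring
      rw [h3]
      exact (norm_sub_le _ _).trans (add_le_add h1 h2)
    exact ⟨y, hsol T le_rfl (hsmall y (fun t ht => (hy t ht).continuousWithinAt) hmem hy0 hsol)⟩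
  · refine hap Nn _ hres T le_rfl uN huN ε hε htε (hsmall uN huN.continuousOn huN.mem huN.init
      fun τ hτ _ => ?_)
    have hsubI : Icc 0 τ ⊆ Icc 0 T := Icc_subset_Icc_right hτ
    refine ⟨fun t ht => huN.mem t (hsubI ht), huN.init, fun t ht => ?_⟩
    obtain ⟨w', hw', heq⟩ := huN.equation t (hsubI ht)
    exact ⟨w', hw'.mono hsubI, heq⟩

end FourierGalerkin

end

/-! ### Fine and coarse meshes together -/

theorem mainTheorem3 (d : ℕ) (hd1 : 1 ≤ d) (hd3 : d ≤ 3)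
    (a b : Fin d → ℝ) (hab : ∀ i, a i < b i) (T : ℝ) (hT : 0 < T)
    (p : ℝ) (hp : 0 < p) (hp3 : d = 3 → p ≤ 2)
    (f : ℝ → ℂ → EuclideanSpace ℂ (Fin d) → ℂ)
    (hf : FourierGalerkin.IsMildNonlinearity T p f)
    (u₀ : FourierGalerkin.L2 a b) (u : ℝ → FourierGalerkin.L2 a b)
    (hu : FourierGalerkin.IsExactSolution T f u₀ u)
    (m : ℕ) (hm : 2 ≤ m)
    (hmem : ∀ t ∈ Set.Icc 0 T, FourierGalerkin.MemHp m (u t))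
    (hreg : ∃ M : ℝ, ∀ t ∈ Set.Icc 0 T, FourierGalerkin.sobolevNorm m (u t) ≤ M)
    (κ : ℝ) :
    ∃ C : ℝ, 0 < C ∧ ∃ N₀ : ℕ, ∀ Nn : Fin d → ℕ,
      (∀ j, 0 < Nn j ∧ Even (Nn j)) →
      (∀ j, (FourierGalerkin.meshNumber Nn : ℝ) ≤ κ * Nn j) →
      (N₀ ≤ FourierGalerkin.meshNumber Nn →
        ∃ uN : ℝ → FourierGalerkin.L2 a b,
          FourierGalerkin.IsSemidiscreteSolution T f u₀ Nn uN) ∧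
      ∀ uN : ℝ → FourierGalerkin.L2 a b,
        FourierGalerkin.IsSemidiscreteSolution T f u₀ Nn uN →
        ∀ t ∈ Set.Icc 0 T,
          FourierGalerkin.sobolevNorm 2 (u t - uN t)
            ≤ C * (FourierGalerkin.meshNumber Nn : ℝ) ^ (2 - (m : ℤ)) := by
  open FourierGalerkin in
  classical
  -- `2 ≤ n` makes the exponent `3 n` at least `6`; for `d = 3` the critical value `n = 2` is
  -- forced, and `p ≤ 2` permits it.
  obtain ⟨n, hpn, hn, hdn⟩ : ∃ n : ℕ, p ≤ n ∧ 2 ≤ n ∧ (d = 3 → n = 2) := by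
    by_cases h3 : d = 3
    · exact ⟨2, by exact_mod_cast hp3 h3, le_rfl, fun _ => rfl⟩
    · exact ⟨max 2 ⌈p⌉₊, (Nat.le_ceil p).trans (by exact_mod_cast le_max_right _ _),
        le_max_left _ _, fun h => absurd h h3⟩
  have hfc : Continuous fun z : ℝ × ℂ × EuclideanSpace ℂ (Fin d) => f z.1 z.2.1 z.2.2 :=
    hf.smooth.continuous
  obtain ⟨K, hK, hgrow⟩ := hf.exists_hasPowerGrowth hp hpn
  obtain ⟨M₀, hM₀⟩ := hreg
  obtain ⟨Cm, hCm, hbound⟩ := exists_hBound_sobolevNorm hab m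
  set M := Cm * |M₀| with hMdef
  have hM : 0 ≤ M := by positivity
  have huMm : ∀ t ∈ Set.Icc 0 T, HBound m (u t) M := fun t ht =>
    (hbound (u t) (hmem t ht)).mono (mul_nonneg hCm.le (Real.sqrt_nonneg _))
      (mul_le_mul_of_nonneg_left ((hM₀ t ht).trans (le_abs_self _)) hCm.le)
  have huM : ∀ t ∈ Set.Icc 0 T, HBound 2 (u t) M := fun t ht => (huMm t ht).mono_exponent hm
  obtain ⟨Cs, hCs, hsob⟩ := exists_sobolevNorm_le hab 2
  obtain ⟨C, hC, N₀, hmain⟩ := exists_error_estimate (κ := κ) hab hd1 hd3 hT.le hn hdn hfc hK hgrow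
    hu hM huM
  choose B hB0 hB using exists_hBound_semidiscrete (u₀ := u₀) hab hfc hK hgrow hu.continuousOn huM
  -- A finite set containing every mesh with mesh number below `N₀`; the sum of their error bounds
  -- serves all of them.
  set coarse : Finset (Fin d → ℕ) := Fintype.piFinset fun _ => Finset.range N₀ with hcoarse
  set C₁ := Cs * (C * ((2 * |κ|) ^ (m - 2) * M)) with hC₁
  set C₂ := Cs * (∑ Nn ∈ coarse, B Nn) * (N₀ : ℝ) ^ (m - 2) with hC₂
  have hC₁0 : 0 ≤ C₁ := by positivity
  have hsum0 : 0 ≤ ∑ Nn ∈ coarse, B Nn := Finset.sum_nonneg fun Nn _ => hB0 Nn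
  have hC₂0 : 0 ≤ C₂ := by positivity
  refine ⟨C₁ + C₂ + 1, by positivity, N₀, fun Nn hpos hκ => ⟨fun hN => (hmain Nn hpos hκ hN).1,
    fun uN huN t ht => ?_⟩⟩
  have hle : ∀ j, Nn j ≤ meshNumber Nn := fun j => Finset.le_sup (Finset.mem_univ j)
  have hN1 : 1 ≤ meshNumber Nn := ((hpos ⟨0, hd1⟩).1).trans_le (hle ⟨0, hd1⟩)
  have hN0 : (0 : ℝ) < meshNumber Nn := by exact_mod_cast hN1
  have hpow : (meshNumber Nn : ℝ) ^ (2 - (m : ℤ)) = ((meshNumber Nn : ℝ) ^ (m - 2))⁻¹ := by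
    rw [← zpow_natCast, ← zpow_neg]
    congr 1
    omega
  have hpow0 : 0 < ((meshNumber Nn : ℝ) ^ (m - 2))⁻¹ := by positivity
  have hmemH : MemHp 2 (u t - uN t) := (hu.mem t ht).sub (memHp_of_mem_XN hab 2 (huN.mem t ht))
  rw [hpow]
  rcases le_or_gt N₀ (meshNumber Nn) with hN | hN
  -- `1 / ℓ` bounds the unresolved frequencies from below, so the truncation error of `u` in `H²` is
  -- at most `ℓ ^ (m - 2) * M`, which has the required rate.
  · set ℓ := 2 * |κ| / meshNumber Nn with hℓ
    have hℓ0 : 0 ≤ ℓ := by positivity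
    have hout : ∀ k ∉ frequencies Nn, 1 ≤ ℓ ^ 2 * weight k := by
      intro k hk
      rw [hℓ, div_pow, div_mul_eq_mul_div, le_div_iff₀ (by positivity), one_mul]
      exact sq_meshNumber_le hpos hκ hk
    have h1 := (hmain Nn hpos hκ hN).2 uN huN (ℓ ^ (m - 2) * M) (by positivity)
      (fun t ht S hS => sum_tail_le hm (huMm t ht) hout hS) t ht
    have h2 := hsob _ _ (by positivity) hmemH h1
    calc sobolevNorm 2 (u t - uN t) ≤ Cs * (C * (ℓ ^ (m - 2) * M)) := h2
      _ = C₁ * ((meshNumber Nn : ℝ) ^ (m - 2))⁻¹ := by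
          rw [hC₁, hℓ, div_pow]
          ring
      _ ≤ _ := mul_le_mul_of_nonneg_right (by linarith) hpow0.le
  · have h2 := hsob _ _ (hB0 Nn) hmemH (hB Nn uN huN t ht)
    have hin : Nn ∈ coarse :=
      Fintype.mem_piFinset.2 fun j => Finset.mem_range.2 ((hle j).trans_lt hN)
    have h3 : B Nn ≤ ∑ Nn ∈ coarse, B Nn := Finset.single_le_sum (fun Nn _ => hB0 Nn) hin
    -- Below `N₀` the rate is bounded from below, so a constant bound can be rewritten with the
    -- factor `N ^ (2 - m)`.
    have h4 : 1 ≤ (N₀ : ℝ) ^ (m - 2) * ((meshNumber Nn : ℝ) ^ (m - 2))⁻¹ := by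
      rw [← div_eq_mul_inv, le_div_iff₀ (by positivity), one_mul]
      exact pow_le_pow_left₀ hN0.le (by exact_mod_cast hN.le) _
    calc sobolevNorm 2 (u t - uN t) ≤ Cs * B Nn := h2
      _ ≤ Cs * ∑ Nn ∈ coarse, B Nn := mul_le_mul_of_nonneg_left h3 hCs.le
      _ ≤ Cs * (∑ Nn ∈ coarse, B Nn)
          * ((N₀ : ℝ) ^ (m - 2) * ((meshNumber Nn : ℝ) ^ (m - 2))⁻¹) :=
          le_mul_of_one_le_right (by positivity) h4
      _ = C₂ * ((meshNumber Nn : ℝ) ^ (m - 2))⁻¹ := by rw [hC₂]; ring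
      _ ≤ _ := mul_le_mul_of_nonneg_right (by linarith) hpow0.le
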